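/- Let $k$ be a field and let $H$ be a Hopf algebra over $k$ with bijective antipode. Let $A$ be a right $H$-comodule algebra, i.e. a (unital, associative) $k$-algebra with a right $H$-comodule structure $\delta\colon A\to A\otimes H$, $\delta(a)=a_{(0)}\otimes a_{(1)}$, that is an algebra homomorphism. Put $B:=\{b\in A\mid \delta(b)=b\otimes 1\}$, a subalgebra of $A$, and let $$\beta\colon A\otimes_B A\to A\otimes H,\qquad x\otimes y\mapsto xy_{(0)}\otimes y_{(1)},$$ be the Galois map; $A$ is called an $H$-Galois extension of $B$ if $\beta$ is bijective. Let $\mathcal M_A^H$ be the category of Hopf modules: right $A$-modules $M$ that are also right $H$-comodules such that $\delta(ma)=m_{(0)}a_{(0)}\otimes m_{(1)}a_{(1)}$ for all $m\in M$, $a\in A$, with the $A$-linear and $H$-colinear maps as morphisms. The induction functor $\mathrm{Mod}_B\to\mathcal M_A^H$ sends a right $B$-module $N$ to $N\otimes_B A$, with $A$-action $(n\otimes x)a=n\otimes xa$ and coaction $n\otimes a\mapsto (n\otimes a_{(0)})\otimes a_{(1)}$. The following are equivalent: 1. $\beta$ is surjective, and $A$ is injective as a right $H$-comodule. 2. $A$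 is an $H$-Galois extension of $B$ and a faithfully flat left $B$-module. 3. $A$ is an $H$-Galois extension of $B$ and a faithfully flat right $B$-module. 4. The induction functor $\mathrm{Mod}_B\to\mathcal M_A^H$ is an equivalence of categories. In this case $A$ is projective as a left and as a right $B$-module, and $B$ is a direct summand of $A$ both as a left and as a right $B$-module. -/

import Mathlib

open scoped TensorProduct

universe u t

namespace HopfGalois

open MulOpposite

/-! ### Comodules, comodule algebras, coinvariants -/

/-- A right comodule `M` over a coalgebra `C`: a coassociative and counital coaction
`δ : M → M ⊗ C`. -/
class RightComodule (k C M : Type*) [CommRing k] [AddCommGroup C] [Module k C] [Coalgebra k C]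
    [AddCommGroup M] [Module k M] where
  coact : M →ₗ[k] M ⊗[k] C
  coact_coassoc : (TensorProduct.assoc k M C C).toLinearMap ∘ₗ coact.rTensor C ∘ₗ coact =
    (Coalgebra.comul (R := k) (A := C)).lTensor M ∘ₗ coact
  coact_counit : (TensorProduct.rid k M).toLinearMap ∘ₗ
    (Coalgebra.counit (R := k) (A := C)).lTensor M ∘ₗ coact = LinearMap.id

/-- The coaction `δ : M → M ⊗ C`. -/
abbrev coaction (k C M : Type*) [CommRing k] [AddCommGroup C] [Module k C] [Coalgebra k C]
    [AddCommGroup M] [Module k M] [RightComodule k C M] : M →ₗ[k] M ⊗[k] C :=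
  RightComodule.coact

/-- A linear map is a comodule map (is colinear) if it commutes with the coactions. -/
def IsColinear (k C : Type*) {M N : Type*} [CommRing k] [AddCommGroup C] [Module k C]
    [Coalgebra k C] [AddCommGroup M] [Module k M] [RightComodule k C M]
    [AddCommGroup N] [Module k N] [RightComodule k C N] (f : M →ₗ[k] N) : Prop :=
  f.rTensor C ∘ₗ coaction k C M = coaction k C N ∘ₗ f

/-- Injectivity of a comodule `I`: every comodule map to `I` extends along every injective
comodule map (the test comodules live in `Type t`). -/
def IsInjectiveComodule (k C I : Type*) [CommRing k] [AddCommGroup C] [Module k C]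
    [Coalgebra k C] [AddCommGroup I] [Module k I] [RightComodule k C I] : Prop :=
  ∀ (X Y : Type t) [AddCommGroup X] [Module k X] [RightComodule k C X]
    [AddCommGroup Y] [Module k Y] [RightComodule k C Y]
    (i : X →ₗ[k] Y) (f : X →ₗ[k] I), IsColinear k C i → Function.Injective i → IsColinear k C f →
      ∃ g : Y →ₗ[k] I, IsColinear k C g ∧ g ∘ₗ i = f

/-- A right `H`-comodule algebra: an algebra `A` with a coaction `δ : A → A ⊗ H` which is
an algebra homomorphism. -/
class RightComoduleAlgebra (k H A : Type*) [CommRing k] [Ring H] [Bialgebra k H] [Ring A]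
    [Algebra k A] extends RightComodule k H A where
  coact_one : coact 1 = 1
  coact_mul : ∀ a b : A, coact (a * b) = coact a * coact b

section Coinvariants

variable (k H A : Type*) [CommRing k] [Ring H] [Bialgebra k H] [Ring A] [Algebra k A]
  [RightComoduleAlgebra k H A]

theorem coaction_one : coaction k H A 1 = 1 := RightComoduleAlgebra.coact_one

theorem coaction_mul (a b : A) :
    coaction k H A (a * b) = coaction k H A a * coaction k H A b :=
  RightComoduleAlgebra.coact_mul a b

/-- The subalgebra of coinvariants `{b ∈ A | δ(b) = b ⊗ 1}`. -/
def coinvariants : Subalgebra k A where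
  carrier := {b | coaction k H A b = b ⊗ₜ[k] 1}
  mul_mem' {a b} ha hb := by
    simp only [Set.mem_ofPred_eq] at ha hb ⊢
    rw [coaction_mul, ha, hb, Algebra.TensorProduct.tmul_mul_tmul, one_mul]
  add_mem' {a b} ha hb := by
    simp only [Set.mem_ofPred_eq] at ha hb ⊢
    rw [map_add, ha, hb, TensorProduct.add_tmul]
  algebraMap_mem' r := by
    simp only [Set.mem_ofPred_eq]
    rw [Algebra.algebraMap_eq_smul_one, map_smul, coaction_one, Algebra.TensorProduct.one_def,
      TensorProduct.smul_tmul']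

theorem coaction_coe_mul (b : coinvariants k H A) (a : A) :
    coaction k H A ((b : A) * a) = ((b : A) ⊗ₜ[k] (1 : H)) * coaction k H A a := by
  rw [coaction_mul, show coaction k H A (b : A) = (b : A) ⊗ₜ[k] 1 from b.2]

end Coinvariants

/-! ### Tensor products over a noncommutative algebra

Right modules over a ring `R` are modules over `Rᵐᵒᵖ`; `op r • n` is `n r`. -/

section Balanced

variable (k R N M : Type*) [CommRing k] [Ring R]
  [AddCommGroup N] [Module k N] [Module Rᵐᵒᵖ N] [AddCommGroup M] [Module k M] [Module R M]

/-- The subspace of `N ⊗ M` spanned by all `n r ⊗ m - n ⊗ r m`. -/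
def balancedRel : Submodule k (N ⊗[k] M) :=
  Submodule.span k {x | ∃ (n : N) (r : R) (m : M), x = (op r • n) ⊗ₜ[k] m - n ⊗ₜ[k] (r • m)}

/-- The tensor product of a right `R`-module `N` and a left `R`-module `M` over the `k`-algebra
`R`. -/
def BalancedTensor : Type _ := (N ⊗[k] M) ⧸ balancedRel k R N M

noncomputable instance : AddCommGroup (BalancedTensor k R N M) :=
  inferInstanceAs (AddCommGroup ((N ⊗[k] M) ⧸ balancedRel k R N M))

noncomputable instance : Module k (BalancedTensor k R N M) :=
  inferInstanceAs (Module k ((N ⊗[k] M) ⧸ balancedRel k R N M))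

namespace BalancedTensor

/-- The quotient map from the tensor product over `k` to the tensor product over `R`. -/
noncomputable def mk : N ⊗[k] M →ₗ[k] BalancedTensor k R N M := (balancedRel k R N M).mkQ

variable {k N M}

theorem mk_smul_tmul (n : N) (r : R) (m : M) :
    mk k R N M ((op r • n) ⊗ₜ[k] m) = mk k R N M (n ⊗ₜ[k] (r • m)) := by
  rw [← sub_eq_zero, ← map_sub]
  exact (Submodule.Quotient.mk_eq_zero _).2 (Submodule.subset_span ⟨n, r, m, rfl⟩)

variable {R}

/-- Linear maps out of the tensor product over `R`, from balanced maps. -/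
noncomputable def lift {P : Type*} [AddCommGroup P] [Module k P] (f : N ⊗[k] M →ₗ[k] P)
    (hf : ∀ (n : N) (r : R) (m : M), f ((op r • n) ⊗ₜ[k] m) = f (n ⊗ₜ[k] (r • m))) :
    BalancedTensor k R N M →ₗ[k] P :=
  (balancedRel k R N M).liftQ f <| by
    rw [balancedRel, Submodule.span_le]
    rintro _ ⟨n, r, m, rfl⟩
    simp [hf]

@[simp]
theorem lift_mk {P : Type*} [AddCommGroup P] [Module k P] (f : N ⊗[k] M →ₗ[k] P)
    (hf : ∀ (n : N) (r : R) (m : M), f ((op r • n) ⊗ₜ[k] m) = f (n ⊗ₜ[k] (r • m)))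
    (x : N ⊗[k] M) : lift f hf (mk k R N M x) = f x :=
  Submodule.liftQ_apply _ _ _

theorem hom_ext {P : Type*} [AddCommGroup P] [Module k P] {f g : BalancedTensor k R N M →ₗ[k] P}
    (h : ∀ (n : N) (m : M), f (mk k R N M (n ⊗ₜ[k] m)) = g (mk k R N M (n ⊗ₜ[k] m))) : f = g :=
  Submodule.linearMap_qext _ (TensorProduct.ext' h)

/-- The map `f ⊗ g` of tensor products over `R`. -/
noncomputable def map [Algebra k R] [IsScalarTower k Rᵐᵒᵖ N] [IsScalarTower k R M]
    {N' M' : Type*} [AddCommGroup N'] [Module k N'] [Module Rᵐᵒᵖ N'] [IsScalarTower k Rᵐᵒᵖ N']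
    [AddCommGroup M'] [Module k M'] [Module R M'] [IsScalarTower k R M']
    (f : N →ₗ[Rᵐᵒᵖ] N') (g : M →ₗ[R] M') :
    BalancedTensor k R N M →ₗ[k] BalancedTensor k R N' M' :=
  lift (mk k R N' M' ∘ₗ TensorProduct.map (f.restrictScalars k) (g.restrictScalars k)) <| by
    intro n r m
    simp [mk_smul_tmul]

@[simp]
theorem map_mk_tmul [Algebra k R] [IsScalarTower k Rᵐᵒᵖ N] [IsScalarTower k R M]
    {N' M' : Type*} [AddCommGroup N'] [Module k N'] [Module Rᵐᵒᵖ N'] [IsScalarTower k Rᵐᵒᵖ N']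
    [AddCommGroup M'] [Module k M'] [Module R M'] [IsScalarTower k R M']
    (f : N →ₗ[Rᵐᵒᵖ] N') (g : M →ₗ[R] M') (n : N) (m : M) :
    map (k := k) f g (mk k R N M (n ⊗ₜ[k] m)) = mk k R N' M' (f n ⊗ₜ[k] g m) := by
  simp [map]

end BalancedTensor

end Balanced

/-- A left `R`-module `M` is faithfully flat if a sequence of right `R`-modules `N₁ → N₂ → N₃` is
exact if and only if `N₁ ⊗_R M → N₂ ⊗_R M → N₃ ⊗_R M` is exact (the test modules live in
`Type t`). -/
def IsLeftFaithfullyFlat (k R M : Type*) [CommRing k] [Ring R] [Algebra k R]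
    [AddCommGroup M] [Module k M] [Module R M] [IsScalarTower k R M] : Prop :=
  ∀ (N₁ N₂ N₃ : Type t)
    [AddCommGroup N₁] [Module k N₁] [Module Rᵐᵒᵖ N₁] [IsScalarTower k Rᵐᵒᵖ N₁]
    [AddCommGroup N₂] [Module k N₂] [Module Rᵐᵒᵖ N₂] [IsScalarTower k Rᵐᵒᵖ N₂]
    [AddCommGroup N₃] [Module k N₃] [Module Rᵐᵒᵖ N₃] [IsScalarTower k Rᵐᵒᵖ N₃]
    (f : N₁ →ₗ[Rᵐᵒᵖ] N₂) (g : N₂ →ₗ[Rᵐᵒᵖ] N₃),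
    Function.Exact f g ↔ Function.Exact
      (BalancedTensor.map (k := k) f (LinearMap.id : M →ₗ[R] M))
      (BalancedTensor.map (k := k) g (LinearMap.id : M →ₗ[R] M))

/-- A right `R`-module `N` is faithfully flat if a sequence of left `R`-modules `M₁ → M₂ → M₃` is
exact if and only if `N ⊗_R M₁ → N ⊗_R M₂ → N ⊗_R M₃` is exact (the test modules live in
`Type t`). -/
def IsRightFaithfullyFlat (k R N : Type*) [CommRing k] [Ring R] [Algebra k R]
    [AddCommGroup N] [Module k N] [Module Rᵐᵒᵖ N] [IsScalarTower k Rᵐᵒᵖ N] : Prop :=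
  ∀ (M₁ M₂ M₃ : Type t)
    [AddCommGroup M₁] [Module k M₁] [Module R M₁] [IsScalarTower k R M₁]
    [AddCommGroup M₂] [Module k M₂] [Module R M₂] [IsScalarTower k R M₂]
    [AddCommGroup M₃] [Module k M₃] [Module R M₃] [IsScalarTower k R M₃]
    (f : M₁ →ₗ[R] M₂) (g : M₂ →ₗ[R] M₃),
    Function.Exact f g ↔ Function.Exact
      (BalancedTensor.map (k := k) (LinearMap.id : N →ₗ[Rᵐᵒᵖ] N) f)
      (BalancedTensor.map (k := k) (LinearMap.id : N →ₗ[Rᵐᵒᵖ] N) g)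

/-! ### A ring as a right module over a subalgebra -/

section Subalgebra

variable {k A : Type*} [CommRing k] [Ring A] [Algebra k A] (B : Subalgebra k A)

/-- `A` is a right `B`-module by right multiplication. -/
instance rightModule : Module (B)ᵐᵒᵖ A :=
  Module.compHom A (B.val.toRingHom.op : (B)ᵐᵒᵖ →+* Aᵐᵒᵖ)

theorem op_smul_def (b : B) (a : A) : op b • a = a * (b : A) := rfl

instance : IsScalarTower k (B)ᵐᵒᵖ A where
  smul_assoc c b a := by
    induction b using MulOpposite.rec' with
    | h b => rw [← op_smul, op_smul_def, op_smul_def]; simp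

/-- `B`, as a left `B`-submodule of `A`. -/
def leftSubmodule : Submodule B A where
  carrier := B
  add_mem' := B.add_mem
  zero_mem' := B.zero_mem
  smul_mem' b _ hx := B.mul_mem b.2 hx

/-- `B`, as a right `B`-submodule of `A`. -/
def rightSubmodule : Submodule (B)ᵐᵒᵖ A where
  carrier := B
  add_mem' := B.add_mem
  zero_mem' := B.zero_mem
  smul_mem' b _ hx := B.mul_mem hx b.unop.2

/-- Right multiplication by `a`, as a left `B`-linear map. -/
def mulRightLinear (a : A) : A →ₗ[B] A where
  toFun x := x * a
  map_add' x y := add_mul x y a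
  map_smul' b x := smul_mul_assoc b x a

variable (N : Type*) [AddCommGroup N] [Module k N] [Module (B)ᵐᵒᵖ N] [IsScalarTower k (B)ᵐᵒᵖ N]

/-- The right `A`-module structure `(n ⊗ x) a = n ⊗ x a` on `N ⊗_B A`. -/
noncomputable instance inducedModule : Module Aᵐᵒᵖ (BalancedTensor k B N A) where
  smul a x := BalancedTensor.map (k := k) (LinearMap.id : N →ₗ[(B)ᵐᵒᵖ] N)
    (mulRightLinear B a.unop) x
  one_smul x := by
    change BalancedTensor.map (k := k) _ _ x = LinearMap.id (R := k) x
    congr 1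
    exact BalancedTensor.hom_ext fun n m => by simp [mulRightLinear]
  mul_smul a b x := by
    change BalancedTensor.map (k := k) _ _ x =
      (BalancedTensor.map (k := k) _ _ ∘ₗ BalancedTensor.map (k := k) _ _) x
    congr 1
    exact BalancedTensor.hom_ext fun n m => by simp [mulRightLinear, mul_assoc]
  smul_zero a := map_zero _
  smul_add a := map_add _
  add_smul a b x := by
    change BalancedTensor.map (k := k) _ _ x =
      (BalancedTensor.map (k := k) (LinearMap.id : N →ₗ[(B)ᵐᵒᵖ] N) (mulRightLinear B a.unop) +
        BalancedTensor.map (k := k) (LinearMap.id : N →ₗ[(B)ᵐᵒᵖ] N) (mulRightLinear B b.unop) :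
          BalancedTensor k B N A →ₗ[k] BalancedTensor k B N A) x
    congr 1
    exact BalancedTensor.hom_ext fun n m => by
      simp [mulRightLinear, mul_add, TensorProduct.tmul_add]
  zero_smul x := by
    change BalancedTensor.map (k := k) _ _ x = (0 : _ →ₗ[k] BalancedTensor k B N A) x
    congr 1
    exact BalancedTensor.hom_ext fun n m => by simp [mulRightLinear]

theorem op_smul_mk (a x : A) (n : N) :
    op a • BalancedTensor.mk k B N A (n ⊗ₜ[k] x) = BalancedTensor.mk k B N A (n ⊗ₜ[k] (x * a)) :=
  BalancedTensor.map_mk_tmul _ _ _ _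

instance : IsScalarTower k Aᵐᵒᵖ (BalancedTensor k B N A) where
  smul_assoc c a x := by
    change BalancedTensor.map (k := k) _ _ x = (c • BalancedTensor.map (k := k) _ _) x
    congr 1
    exact BalancedTensor.hom_ext fun n m => by simp [mulRightLinear]

end Subalgebra

/-! ### Hopf modules and the induction functor -/

section HopfModules

/-- The right action of `A` on `M`, as a bilinear map `m ↦ a ↦ m a`. -/
def rightAction (k A M : Type*) [CommRing k] [Ring A] [Algebra k A] [AddCommGroup M] [Module k M]
    [Module Aᵐᵒᵖ M] [IsScalarTower k Aᵐᵒᵖ M] : M →ₗ[k] A →ₗ[k] M :=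
  LinearMap.mk₂ k (fun m a => op a • m) (fun _ _ _ => smul_add _ _ _)
    (fun c m a => smul_comm (op a) c m) (fun m a b => by rw [op_add, add_smul])
    (fun c m a => by rw [op_smul, smul_assoc])

/-- A Hopf module: a right `A`-module and right `H`-comodule `M` with
`δ(m a) = m₍₀₎ a₍₀₎ ⊗ m₍₁₎ a₍₁₎`. -/
class IsHopfModule (k H A M : Type*) [CommRing k] [Ring H] [Bialgebra k H] [Ring A] [Algebra k A]
    [RightComoduleAlgebra k H A] [AddCommGroup M] [Module k M] [Module Aᵐᵒᵖ M]
    [IsScalarTower k Aᵐᵒᵖ M] [RightComodule k H M] : Prop where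
  coact_smul : ∀ (m : M) (a : A), coaction k H M (op a • m) =
    TensorProduct.map₂ (rightAction k A M) (LinearMap.mul k H) (coaction k H M m) (coaction k H A a)

variable (k H A : Type u) [Field k] [Ring H] [Bialgebra k H] [Ring A] [Algebra k A]
  [RightComoduleAlgebra k H A]

/-- The category of Hopf modules (right `A`-modules and right `H`-comodules). -/
structure HopfModuleCat : Type (u + 1) where
  carrier : Type u
  [addCommGroup : AddCommGroup carrier]
  [moduleBase : Module k carrier]
  [module : Module Aᵐᵒᵖ carrier]
  [isScalarTower : IsScalarTower k Aᵐᵒᵖ carrier]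
  [comodule : RightComodule k H carrier]
  [isHopfModule : IsHopfModule k H A carrier]

attribute [instance] HopfModuleCat.addCommGroup HopfModuleCat.moduleBase HopfModuleCat.module
  HopfModuleCat.isScalarTower HopfModuleCat.comodule HopfModuleCat.isHopfModule

namespace HopfModuleCat

variable {k H A}

/-- Morphisms of Hopf modules: `A`-linear and `H`-colinear maps. -/
@[ext]
structure Hom (M N : HopfModuleCat k H A) : Type u where
  toLinearMap : M.carrier →ₗ[Aᵐᵒᵖ] N.carrier
  isColinear : IsColinear k H (toLinearMap.restrictScalars k)

instance : CategoryTheory.Category (HopfModuleCat k H A) where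
  Hom := Hom
  id M := ⟨LinearMap.id, by ext x; simp⟩
  comp {M N P} f g := ⟨g.toLinearMap ∘ₗ f.toLinearMap, by
    have hf := f.isColinear
    have hg := g.isColinear
    unfold IsColinear at hf hg ⊢
    rw [show (g.toLinearMap ∘ₗ f.toLinearMap).restrictScalars k =
      g.toLinearMap.restrictScalars k ∘ₗ f.toLinearMap.restrictScalars k from rfl,
      LinearMap.rTensor_comp, LinearMap.comp_assoc, hf, ← LinearMap.comp_assoc, hg,
      LinearMap.comp_assoc]⟩

end HopfModuleCat

section Induction

variable (N : Type*) [AddCommGroup N] [Module k N] [Module (coinvariants k H A)ᵐᵒᵖ N]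

/-- The coaction `n ⊗ a ↦ (n ⊗ a₍₀₎) ⊗ a₍₁₎` on `N ⊗_B A`. -/
noncomputable def inducedCoact : BalancedTensor k (coinvariants k H A) N A →ₗ[k]
    BalancedTensor k (coinvariants k H A) N A ⊗[k] H :=
  BalancedTensor.lift ((BalancedTensor.mk k (coinvariants k H A) N A).rTensor H ∘ₗ
    (TensorProduct.assoc k N A H).symm.toLinearMap ∘ₗ (coaction k H A).lTensor N) <| by
    intro n b a
    have key : ∀ z : A ⊗[k] H,
        (BalancedTensor.mk k (coinvariants k H A) N A).rTensor H
          ((TensorProduct.assoc k N A H).symm ((op b • n) ⊗ₜ[k] z)) =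
        (BalancedTensor.mk k (coinvariants k H A) N A).rTensor H
          ((TensorProduct.assoc k N A H).symm (n ⊗ₜ[k] (((b : A) ⊗ₜ[k] (1 : H)) * z))) := by
      intro z
      induction z with
      | zero => simp
      | add x y hx hy => simp only [mul_add, TensorProduct.tmul_add, map_add, hx, hy]
      | tmul x h =>
        simp only [Algebra.TensorProduct.tmul_mul_tmul, one_mul, TensorProduct.assoc_symm_tmul,
          LinearMap.rTensor_tmul, BalancedTensor.mk_smul_tmul]
        rfl
    have hb : coaction k H A (b • a) = ((b : A) ⊗ₜ[k] (1 : H)) * coaction k H A a :=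
      coaction_coe_mul k H A b a
    simp only [LinearMap.comp_apply, LinearMap.lTensor_tmul, LinearEquiv.coe_coe, hb]
    exact key _

theorem inducedCoact_mk (n : N) (a : A) :
    inducedCoact k H A N (BalancedTensor.mk k (coinvariants k H A) N A (n ⊗ₜ[k] a)) =
      (BalancedTensor.mk k (coinvariants k H A) N A ∘ₗ TensorProduct.mk k N A n).rTensor H
        (coaction k H A a) := by
  simp only [inducedCoact, BalancedTensor.lift_mk, LinearMap.comp_apply, LinearMap.lTensor_tmul,
    LinearEquiv.coe_coe]
  generalize coaction k H A a = z
  induction z with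
  | zero => simp
  | add x y hx hy => simp only [TensorProduct.tmul_add, map_add, hx, hy]
  | tmul x h => simp

noncomputable instance inducedComodule :
    RightComodule k H (BalancedTensor k (coinvariants k H A) N A) where
  coact := inducedCoact k H A N
  coact_coassoc := by
    refine BalancedTensor.hom_ext fun n a => ?_
    have h := LinearMap.congr_fun (RightComodule.coact_coassoc (k := k) (C := H) (M := A)) a
    simp only [LinearMap.comp_apply, LinearEquiv.coe_coe] at h ⊢
    rw [inducedCoact_mk]
    set φ := BalancedTensor.mk k (coinvariants k H A) N A ∘ₗ TensorProduct.mk k N A n with hφ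
    have h1 : (Coalgebra.comul (R := k) (A := H)).lTensor _ (φ.rTensor H (coaction k H A a)) =
        φ.rTensor (H ⊗[k] H) ((Coalgebra.comul (R := k) (A := H)).lTensor A
          (coaction k H A a)) := by
      generalize coaction k H A a = z
      rw [← LinearMap.comp_apply, ← LinearMap.comp_apply, LinearMap.lTensor_comp_rTensor,
        LinearMap.rTensor_comp_lTensor]
    rw [h1]
    change _ = φ.rTensor (H ⊗[k] H) ((Coalgebra.comul (R := k) (A := H)).lTensor A
      (RightComodule.coact a))
    rw [← h]
    change _ = φ.rTensor (H ⊗[k] H) ((TensorProduct.assoc k A H H)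
      ((coaction k H A).rTensor H (coaction k H A a)))
    generalize coaction k H A a = z
    induction z with
    | zero => simp
    | add x y hx hy => simp only [map_add, hx, hy]
    | tmul x h =>
      simp only [LinearMap.rTensor_tmul]
      rw [hφ, LinearMap.comp_apply, TensorProduct.mk_apply, inducedCoact_mk, ← hφ]
      generalize coaction k H A x = y
      induction y with
      | zero => simp
      | add x y hx hy => simp only [map_add, TensorProduct.add_tmul, hx, hy]
      | tmul x h' => simp
  coact_counit := by
    refine BalancedTensor.hom_ext fun n a => ?_
    have h := LinearMap.congr_fun (RightComodule.coact_counit (k := k) (C := H) (M := A)) a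
    simp only [LinearMap.comp_apply, LinearEquiv.coe_coe, LinearMap.id_apply] at h ⊢
    rw [inducedCoact_mk]
    conv_rhs => rw [← h]
    change _ = BalancedTensor.mk k (coinvariants k H A) N A
      (n ⊗ₜ[k] TensorProduct.rid k A ((Coalgebra.counit (R := k) (A := H)).lTensor A
        (coaction k H A a)))
    generalize coaction k H A a = z
    induction z with
    | zero => simp
    | add x y hx hy => simp only [map_add, TensorProduct.tmul_add, hx, hy]
    | tmul x h => simp

instance inducedIsHopfModule [IsScalarTower k (coinvariants k H A)ᵐᵒᵖ N] :
    IsHopfModule k H A (BalancedTensor k (coinvariants k H A) N A) where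
  coact_smul x a := by
    change ((coaction k H _) ∘ₗ (rightAction k A _).flip a) x =
      ((TensorProduct.map₂ (rightAction k A (BalancedTensor k (coinvariants k H A) N A))
        (LinearMap.mul k H)).flip (coaction k H A a) ∘ₗ (coaction k H _)) x
    congr 1
    refine BalancedTensor.hom_ext fun n y => ?_
    have e : ∀ z, coaction k H (BalancedTensor k (coinvariants k H A) N A)
        (BalancedTensor.mk k _ N A (n ⊗ₜ[k] z)) = _ := fun z => inducedCoact_mk k H A N n z
    simp only [LinearMap.comp_apply, LinearMap.flip_apply]
    change coaction k H _ (op a • BalancedTensor.mk k _ N A (n ⊗ₜ[k] y)) = _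
    rw [op_smul_mk, e, e, coaction_mul]
    generalize coaction k H A y = u
    generalize coaction k H A a = v
    induction u with
    | zero => simp
    | add x y hx hy => simp only [map_add, LinearMap.add_apply, add_mul, hx, hy]
    | tmul x h =>
      induction v with
      | zero => simp
      | add x y hx hy => simp only [map_add, mul_add, hx, hy]
      | tmul x' h' => simp [rightAction, op_smul_mk]

end Induction

/-- Maps `f ⊗ A` are colinear. -/
theorem isColinear_map_id {N N' : Type*} [AddCommGroup N] [Module k N]
    [Module (coinvariants k H A)ᵐᵒᵖ N] [IsScalarTower k (coinvariants k H A)ᵐᵒᵖ N]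
    [AddCommGroup N'] [Module k N'] [Module (coinvariants k H A)ᵐᵒᵖ N']
    [IsScalarTower k (coinvariants k H A)ᵐᵒᵖ N'] (f : N →ₗ[(coinvariants k H A)ᵐᵒᵖ] N') :
    IsColinear k H (BalancedTensor.map (k := k) f
      (LinearMap.id : A →ₗ[coinvariants k H A] A)) := by
  refine BalancedTensor.hom_ext fun n a => ?_
  simp only [LinearMap.comp_apply, BalancedTensor.map_mk_tmul, LinearMap.id_apply]
  change _ = inducedCoact k H A N' _
  rw [show coaction k H (BalancedTensor k (coinvariants k H A) N A)
    (BalancedTensor.mk k _ N A (n ⊗ₜ[k] a)) = _ from inducedCoact_mk k H A N n a, inducedCoact_mk]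
  generalize coaction k H A a = z
  induction z with
  | zero => simp
  | add x y hx hy => simp only [map_add, hx, hy]
  | tmul x h => simp

open scoped ModuleCat in
/-- The induction functor `N ↦ N ⊗_B A` from right `B`-modules to Hopf modules. -/
noncomputable def inductionFunctor :
    CategoryTheory.Functor (ModuleCat.{u} (coinvariants k H A)ᵐᵒᵖ) (HopfModuleCat k H A) where
  obj N := { carrier := BalancedTensor k (coinvariants k H A) N A }
  map {N N'} f :=
    { toLinearMap :=
      { toFun := BalancedTensor.map (k := k) f.hom (LinearMap.id : A →ₗ[coinvariants k H A] A)
        map_add' := map_add _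
        map_smul' := fun a x => by
          change (BalancedTensor.map (k := k) f.hom LinearMap.id ∘ₗ
              BalancedTensor.map (k := k) LinearMap.id (mulRightLinear _ a.unop)) x =
            (BalancedTensor.map (k := k) LinearMap.id (mulRightLinear _ a.unop) ∘ₗ
              BalancedTensor.map (k := k) f.hom LinearMap.id) x
          congr 1
          exact BalancedTensor.hom_ext fun n m => by simp }
      isColinear := isColinear_map_id k H A f.hom }
  map_id N := HopfModuleCat.Hom.ext <| LinearMap.ext fun x => by
    change BalancedTensor.map (k := k) _ _ x = LinearMap.id (R := k) x
    congr 1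
    exact BalancedTensor.hom_ext fun n m => by simp
  map_comp f g := HopfModuleCat.Hom.ext <| LinearMap.ext fun x => by
    change BalancedTensor.map (k := k) _ _ x =
      (BalancedTensor.map (k := k) g.hom LinearMap.id ∘ₗ
        BalancedTensor.map (k := k) f.hom LinearMap.id) x
    congr 1
    exact BalancedTensor.hom_ext fun n m => by simp

end HopfModules

/-! ### The Galois map -/

section Galois

variable (k H A : Type*) [CommRing k] [Ring H] [Bialgebra k H] [Ring A] [Algebra k A]
  [RightComoduleAlgebra k H A]

/-- The Galois map `β : A ⊗_B A → A ⊗ H`, `x ⊗ y ↦ (x ⊗ 1) δ(y) = x y₍₀₎ ⊗ y₍₁₎`. -/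
noncomputable def galoisMap :
    BalancedTensor k (coinvariants k H A) A A →ₗ[k] A ⊗[k] H :=
  BalancedTensor.lift
    (LinearMap.mul' k (A ⊗[k] H) ∘ₗ
      TensorProduct.map (Algebra.TensorProduct.includeLeft (S := k)).toLinearMap
        (coaction k H A)) <| by
    intro x b y
    have hb : coaction k H A (b • y) = ((b : A) ⊗ₜ[k] (1 : H)) * coaction k H A y :=
      coaction_coe_mul k H A b y
    simp [op_smul_def, hb, ← mul_assoc]

/-- `A` is an `H`-Galois extension of its coinvariants if the Galois map is bijective. -/
def IsHopfGalois : Prop := Function.Bijective (galoisMap k H A)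

end Galois

end HopfGalois

open HopfGalois

/-!
If `A` is an injective comodule, then extending `k → A` along `k → H` gives a total integral
`γ : H → A`, and if `β` is surjective, there is a linear map `ℓ : H → A ⊗ A`, `ℓ(h) = Σ lᵢ ⊗ rᵢ`,
lifting `1 ⊗ h` along `β`. Since the antipode `S` is bijective, every Hopf module `M` has a pairing
`⟨m, a⟩ = m₍₀₎ γ(S(m₍₁₎) S⁻¹(a₍₁₎)) a₍₀₎` with `A`, which takes values in the coinvariants of `M`
and is right `B`-linear in `a`. The map `m ↦ Σ ⟨m₍₀₎, lᵢ⟩ ⊗ rᵢ` with `ℓ(m₍₁₎) = Σ lᵢ ⊗ rᵢ` is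
inverse to the counit `M^{co H} ⊗_B A → M`. For `M = A`, it splits the left `B`-action on `A`, a
similar map with `ℓ(S⁻¹(a₍₁₎))` splits the right one, and `x ↦ ⟨x, 1⟩` and `a ↦ ⟨1, a⟩` are
`B`-linear retractions onto `B`.

If induction is an equivalence, then its counit is bijective. At the Hopf module `A ⊗ H` this counit
is `β`, and exactness in the category of Hopf modules is exactness of the underlying sequences, so
`A` is a faithfully flat left `B`-module.

If `β` is bijective and `A` is faithfully flat over `B`, then `A ⊗_B A ≅ A ⊗ H` is a cofree
comodule; the version for left modules uses the flip `a ⊗ h ↦ a₍₀₎ ⊗ a₍₁₎ S(h)`. For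
finite-dimensional `E`, flatness identifies `A ⊗_B Hom^H(E, A)` with `Hom^H(E, A ⊗_B A)`, so
comodule maps to `A` extend along inclusions of finite-dimensional comodules by descent. As every
comodule is the union of its finite-dimensional subcomodules, Zorn's lemma then gives the
injectivity of `A`, as in Baer's criterion.
-/

namespace HopfGalois

open MulOpposite Coalgebra HopfAlgebra

/-! ### Sweedler sums and the antipode -/

section Sweedler

variable {k C M P : Type*} [CommRing k] [AddCommGroup C] [Module k C] [Coalgebra k C]
  [AddCommGroup M] [Module k M] [RightComodule k C M] [AddCommGroup P] [Module k P]

theorem coaction_coassoc (m : M) : (coaction k C M).rTensor C (coaction k C M m) =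
    (TensorProduct.assoc k M C C).symm ((comul (R := k) (A := C)).lTensor M
      (coaction k C M m)) := by
  rw [LinearEquiv.eq_symm_apply]
  exact LinearMap.congr_fun (RightComodule.coact_coassoc (k := k) (C := C) (M := M)) m

theorem coaction_counit (m : M) :
    TensorProduct.rid k M ((counit (R := k) (A := C)).lTensor M (coaction k C M m)) = m :=
  LinearMap.congr_fun (RightComodule.coact_counit (k := k) (C := C) (M := M)) m

/-- The Sweedler sum `m ↦ F m₍₀₎ m₍₁₎` of a bilinear map `F`. -/
noncomputable def sweedler (F : M →ₗ[k] C →ₗ[k] P) : M →ₗ[k] P :=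
  TensorProduct.lift F ∘ₗ coaction k C M

theorem sweedler_apply (F : M →ₗ[k] C →ₗ[k] P) (m : M) :
    sweedler F m = TensorProduct.lift F (coaction k C M m) := rfl

theorem map_sweedler {Q : Type*} [AddCommGroup Q] [Module k Q] (f : P →ₗ[k] Q)
    (F : M →ₗ[k] C →ₗ[k] P) (m : M) : f (sweedler F m) = sweedler (F.compr₂ f) m := by
  simp [sweedler_apply, TensorProduct.lift_compr₂]

theorem sweedler_eq_of_coassoc (F : M ⊗[k] C →ₗ[k] C →ₗ[k] P) {G G' : M →ₗ[k] C →ₗ[k] P}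
    (hG : ∀ m c, G m c = F (coaction k C M m) c)
    (hG' : ∀ m c, G' m c = ∑ i ∈ (ℛ k c).index, F (m ⊗ₜ (ℛ k c).left i) ((ℛ k c).right i))
    (m : M) : sweedler G m = sweedler G' m := by
  have hl : TensorProduct.lift G = TensorProduct.lift F ∘ₗ (coaction k C M).rTensor C :=
    TensorProduct.ext' fun x c => by simp [hG]
  have hr : TensorProduct.lift G' = TensorProduct.lift F ∘ₗ
      (TensorProduct.assoc k M C C).symm.toLinearMap ∘ₗ (comul (R := k) (A := C)).lTensor M := by
    refine TensorProduct.ext' fun x c => ?_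
    rw [TensorProduct.lift.tmul, hG', LinearMap.comp_apply, LinearMap.comp_apply,
      LinearMap.lTensor_tmul]
    conv_rhs => rw [← (ℛ k c).eq]
    simp [TensorProduct.tmul_sum]
  rw [sweedler_apply, sweedler_apply, hl, hr, LinearMap.comp_apply, coaction_coassoc]
  rfl

theorem sweedler_eq_of_counit {F : M →ₗ[k] C →ₗ[k] P} {f : M →ₗ[k] P}
    (hF : ∀ m c, F m c = counit (R := k) c • f m) (m : M) : sweedler F m = f m := by
  have h : TensorProduct.lift F =
      f ∘ₗ (TensorProduct.rid k M).toLinearMap ∘ₗ (counit (R := k) (A := C)).lTensor M :=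
    TensorProduct.ext' fun x c => by simp [hF]
  rw [sweedler_apply, h]
  exact congr(f $(coaction_counit m))

theorem sweedler_eq_of_coassoc_of_counit (F : M ⊗[k] C →ₗ[k] C →ₗ[k] P) {G : M →ₗ[k] C →ₗ[k] P}
    {f : M →ₗ[k] P} (hG : ∀ m c, G m c = F (coaction k C M m) c)
    (hF : ∀ m c, ∑ i ∈ (ℛ k c).index, F (m ⊗ₜ (ℛ k c).left i) ((ℛ k c).right i) =
      counit (R := k) c • f m)
    (m : M) : sweedler G m = f m :=
  (sweedler_eq_of_coassoc F (G' := (LinearMap.lsmul k P).flip.compl₁₂ f counit) hG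
    (fun m c => by simp [hF]) m).trans (sweedler_eq_of_counit (fun m c => by simp) m)

end Sweedler

section Antipode

open WithConv

variable {k H : Type*} [CommRing k] [Ring H] [HopfAlgebra k H]

theorem convMul_includeLeft_includeRight :
    toConv (Algebra.TensorProduct.includeLeft : H →ₐ[k] H ⊗[k] H).toLinearMap *
      toConv (Algebra.TensorProduct.includeRight : H →ₐ[k] H ⊗[k] H).toLinearMap =
        toConv (comul (R := k) (A := H)) := by
  ext h
  rw [(ℛ k h).convMul_apply]
  simp [← (ℛ k h).eq]

theorem convMul_algHom_comp_antipode {D : Type*} [Ring D] [Algebra k D] (f : H →ₐ[k] D) :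
    toConv f.toLinearMap * toConv (f.toLinearMap ∘ₗ antipode k) = 1 := by
  ext h
  rw [(ℛ k h).convMul_apply]
  simp [← map_mul, ← map_sum, sum_mul_antipode_eq_algebraMap_counit (ℛ k h)]

theorem convMul_antipode_comp_algHom {D : Type*} [Ring D] [Algebra k D] (f : H →ₐ[k] D) :
    toConv (f.toLinearMap ∘ₗ antipode k) * toConv f.toLinearMap = 1 := by
  ext h
  rw [(ℛ k h).convMul_apply]
  simp [← map_mul, ← map_sum, sum_antipode_mul_eq_algebraMap_counit (ℛ k h)]

theorem sum_one_tmul_mul_comul_antipode {ι : Type*} {h : H} (𝓡 : Coalgebra.Repr k h ι) :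
    ∑ i ∈ 𝓡.index, ((1 : H) ⊗ₜ[k] 𝓡.left i) * comul (R := k) (antipode k (𝓡.right i)) =
      antipode k h ⊗ₜ[k] 1 := by
  have key : toConv (Algebra.TensorProduct.includeRight : H →ₐ[k] H ⊗[k] H).toLinearMap *
      toConv (comul ∘ₗ antipode k) =
        toConv ((Algebra.TensorProduct.includeLeft : H →ₐ[k] H ⊗[k] H).toLinearMap ∘ₗ
          antipode k) := by
    rw [← one_mul (_ * _), ← convMul_antipode_comp_algHom Algebra.TensorProduct.includeLeft,
      mul_assoc, ← mul_assoc (toConv (AlgHom.toLinearMap _)), convMul_includeLeft_includeRight,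
      LinearMap.comul_right_inv, mul_one]
  exact (𝓡.convMul_apply _ _).symm.trans congr($key h)

theorem sum_comul_mul_one_tmul_antipode {ι : Type*} {h : H} (𝓡 : Coalgebra.Repr k h ι) :
    ∑ i ∈ 𝓡.index, comul (R := k) (𝓡.left i) * ((1 : H) ⊗ₜ[k] antipode k (𝓡.right i)) =
      h ⊗ₜ[k] 1 := by
  have key : toConv (comul (R := k) (A := H)) *
      toConv ((Algebra.TensorProduct.includeRight : H →ₐ[k] H ⊗[k] H).toLinearMap ∘ₗ
        antipode k) =
      toConv (Algebra.TensorProduct.includeLeft : H →ₐ[k] H ⊗[k] H).toLinearMap := by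
    rw [← convMul_includeLeft_includeRight, mul_assoc, convMul_algHom_comp_antipode, mul_one]
  exact (𝓡.convMul_apply _ _).symm.trans congr($key h)

theorem comul_antipode {ι : Type*} {h : H} (𝓡 : Coalgebra.Repr k h ι) :
    comul (R := k) (antipode k h) =
      ∑ i ∈ 𝓡.index, antipode k (𝓡.right i) ⊗ₜ[k] antipode k (𝓡.left i) := by
  have key : toConv ((Algebra.TensorProduct.includeRight : H →ₐ[k] H ⊗[k] H).toLinearMap ∘ₗ
        antipode k) *
      toConv ((Algebra.TensorProduct.includeLeft : H →ₐ[k] H ⊗[k] H).toLinearMap ∘ₗ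
        antipode k) = toConv (comul ∘ₗ antipode k) := by
    refine left_inv_eq_right_inv (a := toConv (comul (R := k) (A := H))) ?_
      LinearMap.comul_right_inv
    rw [← convMul_includeLeft_includeRight, mul_assoc,
      ← mul_assoc _ (toConv (AlgHom.toLinearMap Algebra.TensorProduct.includeLeft)),
      convMul_antipode_comp_algHom, one_mul, convMul_antipode_comp_algHom]
  refine congr($key h).symm.trans ((𝓡.convMul_apply _ _).trans ?_)
  simp

/-- The inverse of a bijective antipode. -/
noncomputable def antipodeInv (hS : Function.Bijective (antipode k : H →ₗ[k] H)) : H →ₗ[k] H :=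
  (LinearEquiv.ofBijective _ hS).symm

variable (hS : Function.Bijective (antipode k : H →ₗ[k] H))

@[simp]
theorem antipode_antipodeInv (h : H) : antipode k (antipodeInv hS h) = h :=
  (LinearEquiv.ofBijective _ hS).apply_symm_apply h

@[simp]
theorem antipodeInv_antipode (h : H) : antipodeInv hS (antipode k h) = h :=
  (LinearEquiv.ofBijective _ hS).symm_apply_apply h

@[simp]
theorem antipodeInv_one : antipodeInv hS 1 = 1 :=
  hS.1 <| by simp

theorem sum_mul_antipodeInv {ι : Type*} {h : H} (𝓡 : Coalgebra.Repr k h ι) :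
    ∑ i ∈ 𝓡.index, 𝓡.right i * antipodeInv hS (𝓡.left i) = algebraMap k H (counit h) :=
  hS.1 <| by
    simp [antipode_mul_antidistrib, sum_mul_antipode_eq_algebraMap_counit 𝓡,
      Algebra.algebraMap_eq_smul_one]

theorem sum_antipodeInv_mul {ι : Type*} {h : H} (𝓡 : Coalgebra.Repr k h ι) :
    ∑ i ∈ 𝓡.index, antipodeInv hS (𝓡.right i) * 𝓡.left i = algebraMap k H (counit h) :=
  hS.1 <| by
    simp [antipode_mul_antidistrib, sum_antipode_mul_eq_algebraMap_counit 𝓡,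
      Algebra.algebraMap_eq_smul_one]

theorem sum_comul_antipodeInv_mul_one_tmul {ι : Type*} {h : H} (𝓡 : Coalgebra.Repr k h ι) :
    ∑ i ∈ 𝓡.index, comul (R := k) (antipodeInv hS (𝓡.right i)) * ((1 : H) ⊗ₜ[k] 𝓡.left i) =
      antipodeInv hS h ⊗ₜ[k] 1 := by
  obtain ⟨g, rfl⟩ := hS.2 h
  let F : H ⊗[k] H →ₗ[k] H ⊗[k] H := TensorProduct.lift <|
    ((LinearMap.mul k (H ⊗[k] H)).compl₁₂ (comul ∘ₗ antipodeInv hS)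
      (Algebra.TensorProduct.includeRight : H →ₐ[k] H ⊗[k] H).toLinearMap).flip
  have h1 := congr(F $(𝓡.eq))
  rw [comul_antipode (ℛ k g)] at h1
  simpa [F, sum_comul_mul_one_tmul_antipode] using h1

end Antipode

section Basic

variable {k H A : Type*} [CommRing k] [Ring H] [Bialgebra k H] [Ring A] [Algebra k A]
  [RightComoduleAlgebra k H A]

@[simp]
theorem rightAction_apply {k A M : Type*} [CommRing k] [Ring A] [Algebra k A] [AddCommGroup M]
    [Module k M] [Module Aᵐᵒᵖ M] [IsScalarTower k Aᵐᵒᵖ M] (m : M) (a : A) :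
    rightAction k A M m a = op a • m := rfl

theorem map₂_rightAction_self {k H A : Type*} [CommRing k] [Ring H] [Algebra k H] [Ring A]
    [Algebra k A] (u v : A ⊗[k] H) :
    TensorProduct.map₂ (rightAction k A A) (LinearMap.mul k H) u v = u * v := by
  have h : TensorProduct.map₂ (rightAction k A A) (LinearMap.mul k H) =
      LinearMap.mul k (A ⊗[k] H) :=
    TensorProduct.ext' fun x g => TensorProduct.ext' fun y h => by simp
  rw [h, LinearMap.mul_apply']

theorem rTensor_mul_tmul {k H A : Type*} [CommRing k] [Ring H] [Algebra k H] [Ring A]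
    [Algebra k A] (γ : H →ₗ[k] A) (w : H ⊗[k] H) (x : A) (h : H) :
    γ.rTensor H w * (x ⊗ₜ h) = γ.rTensor H (w * (1 ⊗ₜ h)) * (x ⊗ₜ 1) := by
  induction w <;> simp_all [add_mul]

instance regularComodule {k C : Type*} [CommRing k] [AddCommGroup C] [Module k C]
    [Coalgebra k C] : RightComodule k C C where
  coact := comul
  coact_coassoc := coassoc
  coact_counit := by rw [lTensor_counit_comp_comul]; ext; simp

theorem coaction_mul_coe (a : A) (b : coinvariants k H A) :
    coaction k H A (a * b) = coaction k H A a * ((b : A) ⊗ₜ[k] (1 : H)) := by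
  rw [coaction_mul, show coaction k H A (b : A) = (b : A) ⊗ₜ[k] 1 from b.2]

instance selfIsHopfModule : IsHopfModule k H A A where
  coact_smul m a := by rw [op_smul_eq_mul, coaction_mul, map₂_rightAction_self]

variable (k H) in
/-- The subspace `{m ∈ M | δ(m) = m ⊗ 1}` of coinvariants of a comodule. -/
def comoduleCoinvariants (M : Type*) [AddCommGroup M] [Module k M] [RightComodule k H M] :
    Submodule k M where
  carrier := {m | coaction k H M m = m ⊗ₜ[k] 1}
  add_mem' {m n} hm hn := by
    simp only [Set.mem_ofPred_eq] at hm hn ⊢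
    rw [map_add, hm, hn, TensorProduct.add_tmul]
  zero_mem' := by simp
  smul_mem' c m hm := by
    simp only [Set.mem_ofPred_eq] at hm ⊢
    rw [map_smul, hm, TensorProduct.smul_tmul']

section

variable {M : Type*} [AddCommGroup M] [Module k M] [RightComodule k H M]

theorem mem_comoduleCoinvariants {m : M} :
    m ∈ comoduleCoinvariants k H M ↔ coaction k H M m = m ⊗ₜ[k] 1 := Iff.rfl

variable [Module Aᵐᵒᵖ M] [IsScalarTower k Aᵐᵒᵖ M] [IsHopfModule k H A M]

theorem coaction_op_smul_of_mem_coinvariants {n : M} (hn : n ∈ comoduleCoinvariants k H M)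
    (a : A) : coaction k H M (op a • n) =
      TensorProduct.map (rightAction k A M n) LinearMap.id (coaction k H A a) := by
  rw [IsHopfModule.coact_smul, mem_comoduleCoinvariants.1 hn]
  generalize coaction k H A a = z
  induction z <;> simp_all

instance : Module (coinvariants k H A)ᵐᵒᵖ (comoduleCoinvariants k H M) where
  smul b n := ⟨op (b.unop : A) • (n : M), by
    rw [mem_comoduleCoinvariants, coaction_op_smul_of_mem_coinvariants n.2,
      show coaction k H A (b.unop : A) = _ from b.unop.2]
    simp⟩
  one_smul n := Subtype.ext (one_smul Aᵐᵒᵖ (n : M))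
  mul_smul b c n := Subtype.ext (mul_smul (op (b.unop : A)) (op (c.unop : A)) (n : M))
  smul_zero b := Subtype.ext (smul_zero (op (b.unop : A)))
  smul_add b n n' := Subtype.ext (smul_add (op (b.unop : A)) (n : M) (n' : M))
  add_smul b c n := Subtype.ext (add_smul (op (b.unop : A)) (op (c.unop : A)) (n : M))
  zero_smul n := Subtype.ext (zero_smul Aᵐᵒᵖ (n : M))

theorem coe_op_smul (b : coinvariants k H A) (n : comoduleCoinvariants k H M) :
    ((op b • n : comoduleCoinvariants k H M) : M) = op (b : A) • (n : M) := rfl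

instance : IsScalarTower k (coinvariants k H A)ᵐᵒᵖ (comoduleCoinvariants k H M) where
  smul_assoc c b n := Subtype.ext (smul_assoc c (op (b.unop : A)) (n : M))

end

variable (k H A) in
/-- The coinvariants of `A` as a comodule, identified with the subalgebra of coinvariants. -/
def coinvariantsEquiv : comoduleCoinvariants k H A ≃ₗ[k] coinvariants k H A :=
  LinearEquiv.ofEq (comoduleCoinvariants k H A) (coinvariants k H A).toSubmodule rfl

@[simp]
theorem coe_coinvariantsEquiv (a : comoduleCoinvariants k H A) :
    (coinvariantsEquiv k H A a : A) = a := rfl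

variable (k H A) in
/-- The lift `x ⊗ y ↦ x y₍₀₎ ⊗ y₍₁₎` of the Galois map to the tensor product over `k`. -/
noncomputable def preGaloisMap : A ⊗[k] A →ₗ[k] A ⊗[k] H :=
  LinearMap.mul' k (A ⊗[k] H) ∘ₗ
    TensorProduct.map (Algebra.TensorProduct.includeLeft (S := k)).toLinearMap (coaction k H A)

@[simp]
theorem preGaloisMap_tmul (x y : A) :
    preGaloisMap k H A (x ⊗ₜ y) = (x ⊗ₜ 1) * coaction k H A y := rfl

theorem galoisMap_mk (z : A ⊗[k] A) :
    galoisMap k H A (BalancedTensor.mk k _ A A z) = preGaloisMap k H A z :=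
  BalancedTensor.lift_mk _ _ _

/-- A total integral: a colinear map `γ : H → A` with `γ 1 = 1`. -/
structure IsTotalIntegral (γ : H →ₗ[k] A) : Prop where
  isColinear : IsColinear k H γ
  map_one : γ 1 = 1

theorem IsTotalIntegral.coaction_apply {γ : H →ₗ[k] A} (hγ : IsTotalIntegral γ) (h : H) :
    coaction k H A (γ h) = γ.rTensor H (comul h) :=
  congr($(hγ.isColinear) h).symm

/-- A linear choice `ℓ h = Σ lᵢ ⊗ rᵢ` of preimages of `1 ⊗ h` under the Galois map. -/
def IsTranslationMap (ℓ : H →ₗ[k] A ⊗[k] A) : Prop :=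
  ∀ h, preGaloisMap k H A (ℓ h) = 1 ⊗ₜ[k] h

end Basic

/-! ### The pairing of a Hopf module with `A` -/

section Twist

variable {k H A : Type*} [CommRing k] [Ring H] [HopfAlgebra k H] [Ring A] [Algebra k A]
  (hS : Function.Bijective (antipode k : H →ₗ[k] H))

theorem antipodeInv_mul (g h : H) :
    antipodeInv hS (g * h) = antipodeInv hS h * antipodeInv hS g :=
  hS.1 <| by simp [antipode_mul_antidistrib]

/-- The bilinear map `(a, c) ↦ (h ↦ γ(h S⁻¹(c)) a)`. -/
noncomputable def twistAux (γ : H →ₗ[k] A) : A →ₗ[k] H →ₗ[k] H →ₗ[k] A :=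
  (LinearMap.llcomp k H A A).compl₁₂ (LinearMap.mul k A).flip
    (LinearMap.llcomp k H H A γ ∘ₗ (LinearMap.mul k H).flip ∘ₗ antipodeInv hS)

@[simp]
theorem twistAux_apply (γ : H →ₗ[k] A) (a : A) (c h : H) :
    twistAux hS γ a c h = γ (h * antipodeInv hS c) * a := rfl

variable [RightComoduleAlgebra k H A]

/-- The map `h ↦ γ(h S⁻¹(a₍₁₎)) a₍₀₎`, which deforms `γ` by an element `a` into another colinear
map. -/
noncomputable def twist (γ : H →ₗ[k] A) : A →ₗ[k] H →ₗ[k] A :=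
  sweedler (twistAux hS γ)

variable {γ : H →ₗ[k] A}

theorem twist_apply (a : A) (h : H) :
    twist hS γ a h = sweedler ((twistAux hS γ).compr₂ (LinearMap.applyₗ h)) a :=
  map_sweedler (LinearMap.applyₗ h) _ a

theorem coaction_twist (hγ : IsTotalIntegral γ) (a : A) (h : H) :
    coaction k H A (twist hS γ a h) = (twist hS γ a).rTensor H (comul h) := by
  let ev : (H →ₗ[k] A) →ₗ[k] A ⊗[k] H := LinearMap.applyₗ (comul h) ∘ₗ LinearMap.rTensorHom H
  have hr : (twist hS γ a).rTensor H (comul h) = sweedler ((twistAux hS γ).compr₂ ev) a :=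
    map_sweedler ev _ a
  have slide (w : H ⊗[k] H) (x : A) (c : H) : (twistAux hS γ x c).rTensor H w =
      γ.rTensor H (w * (antipodeInv hS c ⊗ₜ 1)) * (x ⊗ₜ 1) := by
    induction w <;> simp_all [add_mul]
  rw [twist_apply, map_sweedler, hr]
  refine sweedler_eq_of_coassoc ((LinearMap.mul k (A ⊗[k] H) ∘ₗ coaction k H A ∘ₗ γ ∘ₗ
    LinearMap.mulLeft k h ∘ₗ antipodeInv hS).flip) (fun x c => ?_) (fun x c => ?_) a
  · simp [coaction_mul]
  · simp only [ev, LinearMap.compr₂_apply, LinearMap.comp_apply, LinearMap.applyₗ_apply_apply,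
      LinearMap.coe_rTensorHom, slide, ← sum_comul_antipodeInv_mul_one_tmul hS (ℛ k c),
      LinearMap.flip_apply, LinearMap.mul_apply', LinearMap.mulLeft_apply, hγ.coaction_apply,
      Bialgebra.comul_mul, Finset.mul_sum, map_sum, Finset.sum_mul]
    exact Finset.sum_congr rfl fun i _ => by
      rw [rTensor_mul_tmul _ _ x ((ℛ k c).left i), mul_assoc]

theorem twist_of_mem_coinvariants (b : coinvariants k H A) (h : H) :
    twist hS γ b h = γ h * b := by
  rw [twist_apply, sweedler_apply, show coaction k H A (b : A) = _ from b.2]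
  simp

theorem twist_mul_coe (a : A) (b : coinvariants k H A) (h : H) :
    twist hS γ (a * b) h = twist hS γ a h * b := by
  rw [twist_apply, twist_apply, sweedler_apply, sweedler_apply, coaction_mul_coe]
  generalize coaction k H A a = z
  induction z <;> simp_all [add_mul, mul_assoc]

theorem sweedler_twist_mul (x y : A) (g : H) :
    sweedler ((twist hS γ).compl₁₂ (LinearMap.mulLeft k x) (LinearMap.mulLeft k g)) y =
      twist hS γ x g * y := by
  refine sweedler_eq_of_coassoc_of_counit ((TensorProduct.lift (twistAux hS γ) ∘ₗ
    LinearMap.mulLeft k (coaction k H A x)).compl₂ (LinearMap.mulLeft k g))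
    (f := LinearMap.mulLeft k (twist hS γ x g)) (fun y c => ?_) (fun y c => ?_) y
  · simp [twist, sweedler_apply, coaction_mul]
  · simp only [LinearMap.compl₂_apply, LinearMap.comp_apply, LinearMap.mulLeft_apply, twist,
      sweedler_apply]
    induction coaction k H A x with
    | zero => simp
    | add z w hz hw => simp only [add_mul, map_add, LinearMap.add_apply, Finset.sum_add_distrib,
        hz, hw, smul_add]
    | tmul x d =>
      have h := congr(γ (g * $(sum_mul_antipodeInv hS (ℛ k c)) * antipodeInv hS d) * (x * y))
      simpa [antipodeInv_mul, Finset.mul_sum, Finset.sum_mul, mul_assoc,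
        Algebra.algebraMap_eq_smul_one] using h

theorem lift_twist_mul (z : A ⊗[k] A) (g : H) :
    TensorProduct.lift (LinearMap.mul k A ∘ₗ (twist hS γ).flip g) z =
      TensorProduct.lift ((twist hS γ).compl₂ (LinearMap.mulLeft k g)) (preGaloisMap k H A z) := by
  induction z with
  | zero => simp
  | add z w hz hw => simp only [map_add, hz, hw]
  | tmul x y =>
    rw [TensorProduct.lift.tmul, preGaloisMap_tmul]
    refine (sweedler_twist_mul hS x y g).symm.trans ?_
    rw [sweedler_apply]
    generalize coaction k H A y = w
    induction w <;> simp_all [mul_add]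

theorem lift_twist_mul_translation {ℓ : H →ₗ[k] A ⊗[k] A}
    (hℓ : IsTranslationMap ℓ) (g h : H) :
    TensorProduct.lift (LinearMap.mul k A ∘ₗ (twist hS γ).flip g) (ℓ h) = γ (g * h) := by
  rw [lift_twist_mul, hℓ]
  simpa using twist_of_mem_coinvariants hS (γ := γ) (1 : coinvariants k H A) (g * h)

theorem sweedler_twist (hγ : IsTotalIntegral γ) (a : A) : sweedler (twist hS γ) a = a := by
  refine sweedler_eq_of_coassoc_of_counit (TensorProduct.lift (twistAux hS γ))
    (f := LinearMap.id) (fun x c => rfl) (fun x c => ?_) a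
  have h := congr((γ $(sum_mul_antipodeInv hS (ℛ k c))) * x)
  simpa [Finset.sum_mul, Algebra.algebraMap_eq_smul_one, hγ.map_one] using h

end Twist

section Pairing

variable {k H A M : Type*} [CommRing k] [Ring H] [HopfAlgebra k H] [Ring A] [Algebra k A]
  [RightComoduleAlgebra k H A] [AddCommGroup M] [Module k M] [Module Aᵐᵒᵖ M]
  [IsScalarTower k Aᵐᵒᵖ M] (hS : Function.Bijective (antipode k : H →ₗ[k] H))

/-- The bilinear map `(m, c) ↦ (a ↦ m · twist a (S c))`. -/
noncomputable def twistedAction (γ : H →ₗ[k] A) : M →ₗ[k] H →ₗ[k] A →ₗ[k] M :=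
  (LinearMap.llcomp k A A M).compl₁₂ (rightAction k A M) ((twist hS γ).flip ∘ₗ antipode k)

@[simp]
theorem twistedAction_apply (γ : H →ₗ[k] A) (m : M) (c : H) (a : A) :
    twistedAction hS γ m c a = op (twist hS γ a (antipode k c)) • m := rfl

variable {γ : H →ₗ[k] A} (hγ : IsTotalIntegral γ)

theorem sweedler_twistedAction_apply [RightComodule k H M] (m : M) (a : A) :
    sweedler (twistedAction hS γ) m a =
      sweedler ((twistedAction hS γ).compr₂ (LinearMap.applyₗ a)) m :=
  map_sweedler (LinearMap.applyₗ a) _ m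

variable [RightComodule k H M] [IsHopfModule k H A M]

include hγ in
theorem sweedler_twistedAction_mem (m : M) (a : A) :
    sweedler (twistedAction hS γ) m a ∈ comoduleCoinvariants k H M := by
  have hinr : (TensorProduct.mk k M H).flip 1 (sweedler (twistedAction hS γ) m a) =
      sweedler ((twistedAction hS γ).compr₂
        ((TensorProduct.mk k M H).flip 1 ∘ₗ LinearMap.applyₗ a)) m :=
    map_sweedler ((TensorProduct.mk k M H).flip 1 ∘ₗ LinearMap.applyₗ a) _ m
  have slide (x : M) (c : H) (w : H ⊗[k] H) :
      TensorProduct.map₂ (rightAction k A M) (LinearMap.mul k H) (x ⊗ₜ c)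
        ((twist hS γ a).rTensor H w) =
      TensorProduct.map (rightAction k A M x ∘ₗ twist hS γ a) LinearMap.id ((1 ⊗ₜ c) * w) := by
    induction w <;> simp_all [mul_add]
  rw [mem_comoduleCoinvariants]
  refine Eq.trans ?_ hinr.symm
  rw [sweedler_twistedAction_apply, map_sweedler]
  refine sweedler_eq_of_coassoc
    ((TensorProduct.map₂ (rightAction k A M) (LinearMap.mul k H)).compl₂
      (coaction k H A ∘ₗ twist hS γ a ∘ₗ antipode k)) (fun x c => ?_) (fun x c => ?_) m
  · simp [IsHopfModule.coact_smul]
  · simp only [LinearMap.compl₂_apply, LinearMap.comp_apply, coaction_twist hS hγ, slide,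
      ← map_sum, sum_one_tmul_mul_comul_antipode (ℛ k c)]
    simp

/-- The pairing `⟨m, a⟩ = m₍₀₎ γ(S(m₍₁₎) S⁻¹(a₍₁₎)) a₍₀₎` of a Hopf module with `A`, with values in
the coinvariants. -/
noncomputable def coinvPairing : M →ₗ[k] A →ₗ[k] comoduleCoinvariants k H M :=
  LinearMap.mk₂ k (fun m a => ⟨sweedler (twistedAction hS γ) m a,
      sweedler_twistedAction_mem hS hγ m a⟩)
    (fun m n a => Subtype.ext (by simp)) (fun c m a => Subtype.ext (by simp))
    (fun m a b => Subtype.ext (by simp)) (fun c m a => Subtype.ext (by simp))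

theorem coe_coinvPairing (m : M) (a : A) :
    (coinvPairing hS hγ m a : M) = sweedler (twistedAction hS γ) m a := rfl

theorem coinvPairing_mul_coe (m : M) (a : A) (b : coinvariants k H A) :
    coinvPairing hS hγ m (a * b) = op b • coinvPairing hS hγ m a := by
  refine Subtype.ext ?_
  rw [coe_op_smul, coe_coinvPairing, coe_coinvPairing, sweedler_twistedAction_apply,
    sweedler_twistedAction_apply, sweedler_apply, sweedler_apply]
  induction coaction k H M m with
  | zero => simp
  | add z w hz hw => simp only [map_add, smul_add, hz, hw]
  | tmul x c => simp [twist_mul_coe, mul_smul]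

theorem coinvPairing_op_smul_coe (n : comoduleCoinvariants k H M) (x a : A) :
    coinvPairing hS hγ (op x • (n : M)) a =
      op (coinvariantsEquiv k H A (coinvPairing hS hγ x a)) • n := by
  refine Subtype.ext ?_
  rw [coe_op_smul, coe_coinvariantsEquiv, coe_coinvPairing, coe_coinvPairing,
    sweedler_twistedAction_apply, sweedler_twistedAction_apply, sweedler_apply, sweedler_apply,
    coaction_op_smul_of_mem_coinvariants n.2]
  induction coaction k H A x with
  | zero => simp
  | add z w hz hw => simp only [map_add, op_add, add_smul, hz, hw]
  | tmul y c => simp [mul_smul]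

theorem coinvPairing_coe (n : comoduleCoinvariants k H M) (a : A) :
    (coinvPairing hS hγ (n : M) a : M) = op (twist hS γ a 1) • (n : M) := by
  rw [coe_coinvPairing, sweedler_twistedAction_apply, sweedler_apply,
    mem_comoduleCoinvariants.1 n.2]
  simp

theorem coinvPairing_coe_coe (n : comoduleCoinvariants k H M) (b : coinvariants k H A) :
    coinvPairing hS hγ (n : M) b = op b • n := by
  refine Subtype.ext ?_
  rw [coinvPairing_coe, twist_of_mem_coinvariants, hγ.map_one, one_mul, coe_op_smul]

variable {ℓ : H →ₗ[k] A ⊗[k] A}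

variable (ℓ) in
/-- The map `m ↦ Σ ⟨m₍₀₎, lᵢ⟩ ⊗ rᵢ` with `ℓ(m₍₁₎) = Σ lᵢ ⊗ rᵢ`. -/
noncomputable def coinvSplitting : M →ₗ[k] comoduleCoinvariants k H M ⊗[k] A :=
  sweedler ((LinearMap.rTensorHom A ∘ₗ coinvPairing hS hγ).compl₂ ℓ)

theorem lift_rightAction_coinvSplitting (hℓ : IsTranslationMap ℓ) (m : M) :
    TensorProduct.lift (rightAction k A M ∘ₗ (comoduleCoinvariants k H M).subtype)
      (coinvSplitting hS hγ ℓ m) = m := by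
  have lift_rTensor (f : A →ₗ[k] comoduleCoinvariants k H M) (z : A ⊗[k] A) :
      TensorProduct.lift (rightAction k A M ∘ₗ (comoduleCoinvariants k H M).subtype)
        (f.rTensor A z) = TensorProduct.lift (rightAction k A M ∘ₗ
          (comoduleCoinvariants k H M).subtype ∘ₗ f) z := by
    induction z <;> simp_all
  have lift_smul (x : M) (f : A →ₗ[k] A) (z : A ⊗[k] A) :
      TensorProduct.lift (rightAction k A M ∘ₗ rightAction k A M x ∘ₗ f) z =
        rightAction k A M x (TensorProduct.lift (LinearMap.mul k A ∘ₗ f) z) := by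
    induction z <;> simp_all [mul_smul, add_smul]
  rw [coinvSplitting, map_sweedler]
  refine sweedler_eq_of_coassoc_of_counit (LinearMap.lcomp k M ℓ ∘ₗ
    TensorProduct.uncurry (.id k) A A M ∘ₗ
    LinearMap.llcomp k A M (A →ₗ[k] M) (rightAction k A M) ∘ₗ
    TensorProduct.lift (twistedAction hS γ)) (f := LinearMap.id) (fun x c => ?_) (fun x c => ?_) m
  · exact lift_rTensor _ _
  · have lift_twisted (d h : H) : TensorProduct.lift
        (rightAction k A M ∘ₗ twistedAction hS γ x d) (ℓ h) = op (γ (antipode k d * h)) • x := by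
      rw [← lift_twist_mul_translation hS hℓ]
      exact lift_smul x _ _
    have h := congr(op (γ $(sum_antipode_mul_eq_algebraMap_counit (ℛ k c))) • x)
    refine (Finset.sum_congr rfl fun i _ => lift_twisted _ _).trans ?_
    simpa [Finset.sum_smul, Algebra.algebraMap_eq_smul_one, hγ.map_one] using h

theorem coinvSplitting_op_smul_coe (n : comoduleCoinvariants k H M) (a : A) :
    coinvSplitting hS hγ ℓ (op a • (n : M)) =
      (rightAction k (coinvariants k H A) _ n ∘ₗ coinvariantsEquiv k H A).rTensor A
        (coinvSplitting hS hγ ℓ a) := by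
  have rTensor_pairing (x : A) (z : A ⊗[k] A) :
      (coinvPairing hS hγ (op x • (n : M))).rTensor A z =
        (rightAction k (coinvariants k H A) _ n ∘ₗ coinvariantsEquiv k H A).rTensor A
          ((coinvPairing hS hγ x).rTensor A z) := by
    induction z <;> simp_all [coinvPairing_op_smul_coe]
  rw [coinvSplitting, coinvSplitting, sweedler_apply, sweedler_apply,
    coaction_op_smul_of_mem_coinvariants n.2]
  induction coaction k H A a with
  | zero => simp
  | add z w hz hw => simp only [map_add, hz, hw]
  | tmul x c => exact rTensor_pairing x (ℓ c)

end Pairing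

namespace BalancedTensor

variable {k R N M : Type*} [CommRing k] [Ring R] [AddCommGroup N] [Module k N] [Module Rᵐᵒᵖ N]
  [AddCommGroup M] [Module k M] [Module R M]

theorem mk_surjective : Function.Surjective (mk k R N M) := (balancedRel k R N M).mkQ_surjective

@[elab_as_elim]
theorem induction_on {p : BalancedTensor k R N M → Prop} (x : BalancedTensor k R N M)
    (zero : p 0) (tmul : ∀ n m, p (mk k R N M (n ⊗ₜ m)))
    (add : ∀ x y, p x → p y → p (x + y)) : p x := by
  obtain ⟨z, rfl⟩ := mk_surjective x
  induction z with
  | zero => rwa [map_zero]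
  | add x y hx hy => rw [map_add]; exact add _ _ hx hy
  | tmul n m => exact tmul n m

variable (k R M) in
/-- The bilinear map `n ↦ m ↦ n ⊗ m` into the tensor product over `R`. -/
noncomputable def tmulLeft : N →ₗ[k] M →ₗ[k] BalancedTensor k R N M :=
  TensorProduct.curry (mk k R N M)

@[simp]
theorem tmulLeft_apply (n : N) (m : M) : tmulLeft k R M n m = mk k R N M (n ⊗ₜ m) := rfl

variable [Algebra k R] [IsScalarTower k Rᵐᵒᵖ N] [IsScalarTower k R M]

theorem bijective_map_id {N' : Type*} [AddCommGroup N'] [Module k N'] [Module Rᵐᵒᵖ N']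
    [IsScalarTower k Rᵐᵒᵖ N'] {f : N →ₗ[Rᵐᵒᵖ] N'} (hf : Function.Bijective f) :
    Function.Bijective (map (k := k) f (LinearMap.id : M →ₗ[R] M)) := by
  let e := LinearEquiv.ofBijective f hf
  have hfe (n) : f (e.symm n) = n := e.apply_symm_apply n
  have hef (n) : e.symm (f n) = n := e.symm_apply_apply n
  refine Function.bijective_iff_has_inverse.2
    ⟨map (k := k) e.symm.toLinearMap LinearMap.id, fun x => ?_, fun x => ?_⟩ <;>
  induction x using BalancedTensor.induction_on <;> simp_all

end BalancedTensor

/-! ### Induction and coinvariants -/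

section InducedMap

variable {k H A N M : Type*} [CommRing k] [Ring H] [Bialgebra k H] [Ring A] [Algebra k A]
  [RightComoduleAlgebra k H A] [AddCommGroup N] [Module k N]
  [Module (coinvariants k H A)ᵐᵒᵖ N] [IsScalarTower k (coinvariants k H A)ᵐᵒᵖ N]
  [AddCommGroup M] [Module k M] [Module Aᵐᵒᵖ M] [IsScalarTower k Aᵐᵒᵖ M] [RightComodule k H M]
  [IsHopfModule k H A M]

theorem lift_rightAction_op_smul_tmul
    (ι : N →ₗ[(coinvariants k H A)ᵐᵒᵖ] comoduleCoinvariants k H M) (n : N)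
    (b : coinvariants k H A) (a : A) :
    TensorProduct.lift (rightAction k A M ∘ₗ (comoduleCoinvariants k H M).subtype ∘ₗ
      ι.restrictScalars k) ((op b • n) ⊗ₜ a) =
    TensorProduct.lift (rightAction k A M ∘ₗ (comoduleCoinvariants k H M).subtype ∘ₗ
      ι.restrictScalars k) (n ⊗ₜ (b • a)) := by
  simp [coe_op_smul, Subalgebra.smul_def, smul_smul]

/-- The map `n ⊗ a ↦ ι(n) a` of right `A`-modules induced by a `B`-linear map `ι` from `N` to the
coinvariants of a Hopf module. -/
noncomputable def inducedMap (ι : N →ₗ[(coinvariants k H A)ᵐᵒᵖ] comoduleCoinvariants k H M) :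
    BalancedTensor k (coinvariants k H A) N A →ₗ[Aᵐᵒᵖ] M :=
  let f := BalancedTensor.lift _ (lift_rightAction_op_smul_tmul ι)
  { f with
    map_smul' := fun a x => by
      change f (op a.unop • x) = op a.unop • f x
      induction x using BalancedTensor.induction_on with
      | zero => simp
      | add x y hx hy => simp only [smul_add, map_add, hx, hy]
      | tmul n y => simp only [f, op_smul_mk, BalancedTensor.lift_mk]; simp [mul_smul] }

@[simp]
theorem inducedMap_mk (ι : N →ₗ[(coinvariants k H A)ᵐᵒᵖ] comoduleCoinvariants k H M)
    (z : N ⊗[k] A) : inducedMap ι (BalancedTensor.mk k _ N A z) =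
      TensorProduct.lift (rightAction k A M ∘ₗ
        (comoduleCoinvariants k H M).subtype ∘ₗ ι.restrictScalars k) z :=
  BalancedTensor.lift_mk _ (lift_rightAction_op_smul_tmul ι) _

theorem inducedMap_map {N' : Type*} [AddCommGroup N'] [Module k N']
    [Module (coinvariants k H A)ᵐᵒᵖ N'] [IsScalarTower k (coinvariants k H A)ᵐᵒᵖ N']
    (ι : N →ₗ[(coinvariants k H A)ᵐᵒᵖ] comoduleCoinvariants k H M)
    (f : N' →ₗ[(coinvariants k H A)ᵐᵒᵖ] N) (x : BalancedTensor k (coinvariants k H A) N' A) :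
    inducedMap ι (BalancedTensor.map (k := k) f LinearMap.id x) = inducedMap (ι ∘ₗ f) x := by
  induction x using BalancedTensor.induction_on <;> simp_all

variable (k H A M) in
/-- The map `n ⊗ a ↦ n a` from the module induced by the coinvariants of `M` to `M`. -/
noncomputable def inductionCounit :
    BalancedTensor k (coinvariants k H A) (comoduleCoinvariants k H M) A →ₗ[Aᵐᵒᵖ] M :=
  inducedMap LinearMap.id

theorem bijective_inducedMap_iff
    {ι : N →ₗ[(coinvariants k H A)ᵐᵒᵖ] comoduleCoinvariants k H M} (hι : Function.Bijective ι) :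
    Function.Bijective (inducedMap ι) ↔ Function.Bijective (inductionCounit k H A M) := by
  have hcomp : ⇑(inducedMap ι) = inductionCounit k H A M ∘
      BalancedTensor.map (k := k) ι (LinearMap.id : A →ₗ[coinvariants k H A] A) :=
    funext fun x => (inducedMap_map LinearMap.id ι x).symm
  rw [hcomp, Function.Bijective.of_comp_iff _ (BalancedTensor.bijective_map_id hι)]

end InducedMap

section Coinvariants

variable {k H A M M' : Type*} [CommRing k] [Ring H] [Bialgebra k H] [Ring A] [Algebra k A]
  [RightComoduleAlgebra k H A]
  [AddCommGroup M] [Module k M] [Module Aᵐᵒᵖ M] [IsScalarTower k Aᵐᵒᵖ M] [RightComodule k H M]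
  [IsHopfModule k H A M]
  [AddCommGroup M'] [Module k M'] [Module Aᵐᵒᵖ M'] [IsScalarTower k Aᵐᵒᵖ M'] [RightComodule k H M']
  [IsHopfModule k H A M']

/-- The `B`-linear map between coinvariants induced by a morphism of Hopf modules. -/
def coinvariantsMap (f : M →ₗ[Aᵐᵒᵖ] M') (hf : IsColinear k H (f.restrictScalars k)) :
    comoduleCoinvariants k H M →ₗ[(coinvariants k H A)ᵐᵒᵖ] comoduleCoinvariants k H M' where
  toFun n := ⟨f n, by
    have h := congr($hf (n : M))
    rw [LinearMap.comp_apply, mem_comoduleCoinvariants.1 n.2] at h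
    exact h.symm⟩
  map_add' n n' := Subtype.ext (map_add f _ _)
  map_smul' b n := Subtype.ext (map_smul f (op (b.unop : A)) (n : M))

@[simp]
theorem coe_coinvariantsMap (f : M →ₗ[Aᵐᵒᵖ] M') (hf : IsColinear k H (f.restrictScalars k))
    (n : comoduleCoinvariants k H M) : (coinvariantsMap f hf n : M') = f n := rfl

theorem map_inducedMap {N : Type*} [AddCommGroup N] [Module k N]
    [Module (coinvariants k H A)ᵐᵒᵖ N] [IsScalarTower k (coinvariants k H A)ᵐᵒᵖ N]
    (f : M →ₗ[Aᵐᵒᵖ] M') (hf : IsColinear k H (f.restrictScalars k))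
    (ι : N →ₗ[(coinvariants k H A)ᵐᵒᵖ] comoduleCoinvariants k H M)
    (x : BalancedTensor k (coinvariants k H A) N A) :
    f (inducedMap ι x) = inducedMap (coinvariantsMap f hf ∘ₗ ι) x := by
  induction x using BalancedTensor.induction_on <;> simp_all

end Coinvariants

section Unit

variable {k H A : Type u} [Field k] [Ring H] [Bialgebra k H] [Ring A] [Algebra k A]
  [RightComoduleAlgebra k H A] {N M : Type*} [AddCommGroup N] [Module k N]
  [Module (coinvariants k H A)ᵐᵒᵖ N] [IsScalarTower k (coinvariants k H A)ᵐᵒᵖ N]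
  [AddCommGroup M] [Module k M] [Module Aᵐᵒᵖ M] [IsScalarTower k Aᵐᵒᵖ M]

omit [IsScalarTower k (coinvariants k H A)ᵐᵒᵖ N] in
theorem coaction_mk_tmul (n : N) (a : A) :
    coaction k H _ (BalancedTensor.mk k (coinvariants k H A) N A (n ⊗ₜ a)) =
      (BalancedTensor.tmulLeft k (coinvariants k H A) A n).rTensor H (coaction k H A a) :=
  inducedCoact_mk k H A N n a

theorem isColinear_inducedMap [RightComodule k H M] [IsHopfModule k H A M]
    (ι : N →ₗ[(coinvariants k H A)ᵐᵒᵖ] comoduleCoinvariants k H M) :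
    IsColinear k H ((inducedMap ι).restrictScalars k) := by
  refine BalancedTensor.hom_ext fun n a => ?_
  simp only [LinearMap.comp_apply, coaction_mk_tmul, LinearMap.restrictScalars_apply,
    inducedMap_mk, TensorProduct.lift.tmul, Submodule.subtype_apply, rightAction_apply,
    coaction_op_smul_of_mem_coinvariants (ι n).2]
  generalize coaction k H A a = z
  induction z <;> simp_all

variable (k H A N) in
/-- The `B`-linear map `n ↦ n ⊗ 1` from `N` to the coinvariants of `N ⊗_B A`. -/
noncomputable def inductionUnit : N →ₗ[(coinvariants k H A)ᵐᵒᵖ]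
    comoduleCoinvariants k H (BalancedTensor k (coinvariants k H A) N A) where
  toFun n := ⟨BalancedTensor.mk k _ N A (n ⊗ₜ 1), by
    rw [mem_comoduleCoinvariants, coaction_mk_tmul, coaction_one, Algebra.TensorProduct.one_def,
      LinearMap.rTensor_tmul, BalancedTensor.tmulLeft_apply]⟩
  map_add' n n' := Subtype.ext (by simp [TensorProduct.add_tmul])
  map_smul' b n := Subtype.ext <| by
    change BalancedTensor.mk k _ N A ((op b.unop • n) ⊗ₜ 1) =
      op (b.unop : A) • BalancedTensor.mk k _ N A (n ⊗ₜ 1)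
    rw [BalancedTensor.mk_smul_tmul, op_smul_mk, Subalgebra.smul_def, smul_eq_mul, one_mul, mul_one]

@[simp]
theorem coe_inductionUnit (n : N) :
    (inductionUnit k H A N n : BalancedTensor k (coinvariants k H A) N A) =
      BalancedTensor.mk k _ N A (n ⊗ₜ 1) := rfl

theorem inducedMap_inductionUnit (x : BalancedTensor k (coinvariants k H A) N A) :
    inducedMap (inductionUnit k H A N) x = x := by
  induction x using BalancedTensor.induction_on with
  | zero => simp
  | add x y hx hy => rw [map_add, hx, hy]
  | tmul n a => simp [op_smul_mk]

end Unit

section Adjunction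

open CategoryTheory

variable {k H A : Type u} [Field k] [Ring H] [Bialgebra k H] [Ring A] [Algebra k A]
  [RightComoduleAlgebra k H A]

theorem IsColinear.symm {k C M N : Type*} [CommRing k] [AddCommGroup C] [Module k C]
    [Coalgebra k C] [AddCommGroup M] [Module k M] [RightComodule k C M] [AddCommGroup N]
    [Module k N] [RightComodule k C N] {e : M ≃ₗ[k] N} (he : IsColinear k C e.toLinearMap) :
    IsColinear k C e.symm.toLinearMap := by
  rw [IsColinear, ← LinearMap.cancel_right e.surjective, LinearMap.comp_assoc, ← he,
    ← LinearMap.comp_assoc, ← LinearMap.rTensor_comp, LinearMap.comp_assoc]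
  simp

namespace HopfModuleCat

theorem isIso_iff_bijective {M N : HopfModuleCat k H A} (f : M ⟶ N) :
    IsIso f ↔ Function.Bijective f.toLinearMap := by
  refine ⟨fun _ => ?_, fun hf => ?_⟩
  · exact ⟨Function.LeftInverse.injective (g := (inv f).toLinearMap)
      fun x => congr(Hom.toLinearMap $(IsIso.hom_inv_id f) x), Function.RightInverse.surjective
        (g := (inv f).toLinearMap) fun x => congr(Hom.toLinearMap $(IsIso.inv_hom_id f) x)⟩
  · let e := LinearEquiv.ofBijective f.toLinearMap hf
    have he : IsColinear k H (e.restrictScalars k).toLinearMap := f.isColinear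
    exact ⟨⟨e.symm.toLinearMap, he.symm⟩, Hom.ext (LinearMap.ext e.symm_apply_apply),
      Hom.ext (LinearMap.ext e.apply_symm_apply)⟩

end HopfModuleCat

open scoped ModuleCat

variable (k H A)

/-- The functor of coinvariants from Hopf modules to right `B`-modules. -/
def coinvariantsFunctor : HopfModuleCat k H A ⥤ ModuleCat.{u} (coinvariants k H A)ᵐᵒᵖ where
  obj M := ModuleCat.of _ (comoduleCoinvariants k H M.carrier)
  map f := ModuleCat.ofHom (coinvariantsMap f.toLinearMap f.isColinear)


/-- The identity of the coinvariants of `M`. Its source carries the `k`-module structure that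
`ModuleCat` obtains by restriction of scalars from `B`, its target the original one. -/
def coinvariantsFunctorObjEquiv (M : HopfModuleCat k H A) :
    (coinvariantsFunctor k H A).obj M ≃ₗ[(coinvariants k H A)ᵐᵒᵖ]
      comoduleCoinvariants k H M.carrier :=
  LinearEquiv.refl _ _

/-- The unit of the adjunction between induction and coinvariants. -/
noncomputable def inductionUnitNatTrans : 𝟭 (ModuleCat.{u} (coinvariants k H A)ᵐᵒᵖ) ⟶
    inductionFunctor k H A ⋙ coinvariantsFunctor k H A where
  app N := ModuleCat.ofHom (inductionUnit k H A N)
  naturality N N' f := ModuleCat.hom_ext <| LinearMap.ext fun n => Subtype.ext <| by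
    change BalancedTensor.mk k _ N' A (f.hom n ⊗ₜ 1) =
      BalancedTensor.map (k := k) f.hom LinearMap.id (BalancedTensor.mk k _ N A (n ⊗ₜ 1))
    rw [BalancedTensor.map_mk_tmul, LinearMap.id_apply]

/-- The counit of the adjunction between induction and coinvariants. -/
noncomputable def inductionCounitNatTrans :
    coinvariantsFunctor k H A ⋙ inductionFunctor k H A ⟶ 𝟭 (HopfModuleCat k H A) where
  app M := ⟨inducedMap (coinvariantsFunctorObjEquiv k H A M).toLinearMap, isColinear_inducedMap _⟩
  naturality M M' f := HopfModuleCat.Hom.ext <| LinearMap.ext fun x => by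
    refine (inducedMap_map (coinvariantsFunctorObjEquiv k H A M').toLinearMap
      ((coinvariantsFunctor k H A).map f).hom x).trans (Eq.trans ?_ (map_inducedMap f.toLinearMap
        f.isColinear (coinvariantsFunctorObjEquiv k H A M).toLinearMap x).symm)
    rfl

/-- The adjunction between induction and coinvariants. -/
noncomputable def inductionAdjunction : inductionFunctor k H A ⊣ coinvariantsFunctor k H A where
  unit := inductionUnitNatTrans k H A
  counit := inductionCounitNatTrans k H A
  left_triangle_components N := HopfModuleCat.Hom.ext <| LinearMap.ext fun x => by
    refine Eq.trans ?_ (inducedMap_inductionUnit x)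
    exact inducedMap_map (coinvariantsFunctorObjEquiv k H A _).toLinearMap
      ((inductionUnitNatTrans k H A).app N).hom x
  right_triangle_components M := ModuleCat.hom_ext <| LinearMap.ext fun n => Subtype.ext <|
    (inducedMap_mk (coinvariantsFunctorObjEquiv k H A M).toLinearMap (n ⊗ₜ 1)).trans
      (one_smul Aᵐᵒᵖ (coinvariantsFunctorObjEquiv k H A M n : M.carrier))

variable {k H A}

theorem isIso_counit_app_iff (M : HopfModuleCat k H A) :
    IsIso ((inductionAdjunction k H A).counit.app M) ↔
      Function.Bijective (inductionCounit k H A M.carrier) :=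
  (HopfModuleCat.isIso_iff_bijective _).trans <|
    bijective_inducedMap_iff (coinvariantsFunctorObjEquiv k H A M).bijective

theorem isEquivalence_inductionFunctor_of_bijective
    (unit : ∀ (N : Type u) [AddCommGroup N] [Module k N] [Module (coinvariants k H A)ᵐᵒᵖ N]
      [IsScalarTower k (coinvariants k H A)ᵐᵒᵖ N], Function.Bijective (inductionUnit k H A N))
    (counit : ∀ (M : Type u) [AddCommGroup M] [Module k M] [Module Aᵐᵒᵖ M]
      [IsScalarTower k Aᵐᵒᵖ M] [RightComodule k H M] [IsHopfModule k H A M],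
      Function.Bijective (inductionCounit k H A M)) :
    (inductionFunctor k H A).IsEquivalence := by
  have (N : ModuleCat.{u} (coinvariants k H A)ᵐᵒᵖ) :
      IsIso ((inductionAdjunction k H A).unit.app N) :=
    (ConcreteCategory.isIso_iff_bijective _).2 (unit N)
  have (M : HopfModuleCat k H A) : IsIso ((inductionAdjunction k H A).counit.app M) :=
    (isIso_counit_app_iff M).2 (counit M.carrier)
  exact (inductionAdjunction k H A).toEquivalence.isEquivalence_functor

/-- The `ModuleCat` instance restricts scalars along `algebraMap`, so the two `k`-module structures
have to be identified. -/
theorem eq_restrictScalars {k R N : Type*} [CommRing k] [Ring R] [Algebra k R] [AddCommGroup N]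
    (i : Module k N) [Module R N] [IsScalarTower k R N] : i = Module.restrictScalars k R N :=
  Module.ext <| funext₂ fun c n => (algebraMap_smul R c n).symm

theorem bijective_inductionUnit_of_isEquivalence
    (h : (inductionFunctor k H A).IsEquivalence) (N : Type u)
    [AddCommGroup N] [i : Module k N] [Module (coinvariants k H A)ᵐᵒᵖ N]
    [IsScalarTower k (coinvariants k H A)ᵐᵒᵖ N] :
    Function.Bijective (inductionUnit k H A N) := by
  obtain rfl := eq_restrictScalars (R := (coinvariants k H A)ᵐᵒᵖ) i
  exact (ConcreteCategory.isIso_iff_bijective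
    ((inductionAdjunction k H A).unit.app (ModuleCat.of _ N))).1 inferInstance

theorem bijective_inductionCounit_of_isEquivalence
    (h : (inductionFunctor k H A).IsEquivalence) (M : Type u)
    [AddCommGroup M] [Module k M] [Module Aᵐᵒᵖ M]
    [IsScalarTower k Aᵐᵒᵖ M] [RightComodule k H M] [IsHopfModule k H A M] :
    Function.Bijective (inductionCounit k H A M) := by
  have := (inductionAdjunction k H A).isEquivalence_right_of_isEquivalence_left
  exact (isIso_counit_app_iff ⟨M⟩).1 inferInstance

end Adjunction

/-! ### Subcomodules and cofree comodules -/

section Slices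

variable {k C M N : Type*} [CommRing k] [AddCommGroup C] [Module k C]
  [AddCommGroup M] [Module k M] [AddCommGroup N] [Module k N]

/-- The map `m ⊗ c ↦ φ(c) m`, which evaluates the second factor at a functional. -/
noncomputable def slice (M : Type*) [AddCommGroup M] [Module k M] (φ : Module.Dual k C) :
    M ⊗[k] C →ₗ[k] M :=
  (TensorProduct.rid k M).toLinearMap ∘ₗ φ.lTensor M

@[simp]
theorem slice_tmul (φ : Module.Dual k C) (m : M) (c : C) : slice M φ (m ⊗ₜ c) = φ c • m := by
  simp [slice]

theorem slice_rTensor (φ : Module.Dual k C) (f : M →ₗ[k] N) (z : M ⊗[k] C) :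
    slice N φ (f.rTensor C z) = f (slice M φ z) := by
  induction z <;> simp_all

theorem eq_zero_of_slice [Module.Free k C] {z : M ⊗[k] C}
    (h : ∀ φ : Module.Dual k C, slice M φ z = 0) : z = 0 := by
  let b := Module.Free.chooseBasis k C
  have coordinate (i) (z : M ⊗[k] C) :
      TensorProduct.equivFinsuppOfBasisRight b z i = slice M (b.coord i) z := by
    induction z <;> simp_all
  refine (TensorProduct.equivFinsuppOfBasisRight (M := M) b).injective (Finsupp.ext fun i => ?_)
  rw [coordinate, h, map_zero, Finsupp.zero_apply]

theorem mem_range_rTensor_subtype [Module.Free k C] {K : Submodule k M} {z : M ⊗[k] C} :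
    z ∈ LinearMap.range (K.subtype.rTensor C) ↔ ∀ φ : Module.Dual k C, slice M φ z ∈ K := by
  constructor
  · rintro ⟨w, rfl⟩ φ
    rw [slice_rTensor]
    exact (slice K φ w).2
  · intro h
    have exact_mkQ := rTensor_exact C (LinearMap.exact_subtype_mkQ K) K.mkQ_surjective
    refine (exact_mkQ z).1 (eq_zero_of_slice fun φ => ?_)
    rw [slice_rTensor]
    simpa using h φ

theorem assoc_rTensor_rTensor {δM : M →ₗ[k] M ⊗[k] C} {δN : N →ₗ[k] N ⊗[k] C} {f : M →ₗ[k] N}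
    (hf : ∀ m, δN (f m) = f.rTensor C (δM m)) (z : M ⊗[k] C) :
    TensorProduct.assoc k N C C (δN.rTensor C (f.rTensor C z)) =
      f.rTensor (C ⊗[k] C) (TensorProduct.assoc k M C C (δM.rTensor C z)) := by
  induction z with
  | zero => simp
  | add x y hx hy => simp only [map_add, hx, hy]
  | tmul m c =>
    simp only [LinearMap.rTensor_tmul, hf]
    generalize δM m = w
    induction w <;> simp_all [TensorProduct.add_tmul]

theorem lTensor_rTensor_apply {P Q : Type*} [AddCommGroup P] [Module k P] [AddCommGroup Q]
    [Module k Q] (g : P →ₗ[k] Q) (f : M →ₗ[k] N) (z : M ⊗[k] P) :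
    g.lTensor N (f.rTensor P z) = f.rTensor Q (g.lTensor M z) := by
  induction z <;> simp_all

end Slices

section Colinear

variable {k C M N : Type*} [CommRing k] [AddCommGroup C] [Module k C] [Coalgebra k C]
  [AddCommGroup M] [Module k M] [RightComodule k C M]
  [AddCommGroup N] [Module k N] [RightComodule k C N]

theorem slice_counit_coaction (m : M) : slice M counit (coaction k C M m) = m :=
  coaction_counit m

theorem IsColinear.coaction_apply {f : M →ₗ[k] N} (hf : IsColinear k C f) (m : M) :
    coaction k C N (f m) = f.rTensor C (coaction k C M m) :=
  congr($hf m).symm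

end Colinear

section Subcomodule

variable {k C M : Type*} [Field k] [AddCommGroup C] [Module k C] [Coalgebra k C]
  [AddCommGroup M] [Module k M] [RightComodule k C M]

variable (C) in
/-- A subspace `K` of a comodule is a subcomodule if `δ(K) ⊆ K ⊗ C`. -/
def IsSubcomodule (K : Submodule k M) : Prop :=
  ∀ x ∈ K, coaction k C M x ∈ LinearMap.range (K.subtype.rTensor C)

theorem isSubcomodule_iff_slice_mem {K : Submodule k M} :
    IsSubcomodule C K ↔ ∀ x ∈ K, ∀ φ : Module.Dual k C, slice M φ (coaction k C M x) ∈ K :=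
  forall₂_congr fun _ _ => mem_range_rTensor_subtype

theorem IsColinear.isSubcomodule_ker {N : Type*} [AddCommGroup N] [Module k N]
    [RightComodule k C N] {f : M →ₗ[k] N} (hf : IsColinear k C f) :
    IsSubcomodule C (LinearMap.ker f) :=
  isSubcomodule_iff_slice_mem.2 fun x hx φ => by
    rw [LinearMap.mem_ker] at hx ⊢
    rw [← slice_rTensor, ← hf.coaction_apply, hx, map_zero, map_zero]

theorem rTensor_subtype_injective (K : Submodule k M) (C : Type*) [AddCommGroup C] [Module k C] :
    Function.Injective (K.subtype.rTensor C) :=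
  Module.Flat.rTensor_preserves_injective_linearMap _ K.injective_subtype

/-- The restriction of the coaction to a subcomodule. -/
noncomputable def subCoact {K : Submodule k M} (hK : IsSubcomodule C K) : K →ₗ[k] K ⊗[k] C :=
  (LinearEquiv.ofInjective _ (rTensor_subtype_injective K C)).symm.toLinearMap ∘ₗ
    (coaction k C M ∘ₗ K.subtype).codRestrict _ fun x => hK x x.2

theorem rTensor_subCoact {K : Submodule k M} (hK : IsSubcomodule C K) (x : K) :
    K.subtype.rTensor C (subCoact hK x) = coaction k C M x :=
  congr(($((LinearEquiv.ofInjective _ (rTensor_subtype_injective K C)).apply_symm_apply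
    ((coaction k C M ∘ₗ K.subtype).codRestrict _ (fun x => hK x x.2) x))).1)

/-- A subcomodule, as a comodule. -/
@[reducible]
noncomputable def subcomodule {K : Submodule k M} (hK : IsSubcomodule C K) :
    RightComodule k C K where
  coact := subCoact hK
  coact_coassoc := by
    ext x
    apply rTensor_subtype_injective K (C ⊗[k] C)
    simp only [LinearMap.comp_apply, LinearEquiv.coe_coe]
    rw [← assoc_rTensor_rTensor (fun x => (rTensor_subCoact hK x).symm), ← lTensor_rTensor_apply,
      rTensor_subCoact, coaction_coassoc, LinearEquiv.apply_symm_apply]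
  coact_counit := by
    ext x
    change K.subtype (slice K counit (subCoact hK x)) = x
    rw [← slice_rTensor, rTensor_subCoact, slice_counit_coaction]

theorem isColinear_subtype {K : Submodule k M} (hK : IsSubcomodule C K) :
    let _ := subcomodule hK
    IsColinear k C K.subtype :=
  LinearMap.ext (rTensor_subCoact hK)

end Subcomodule

theorem isHopfModule_subcomodule {k H A M : Type*} [Field k] [Ring H] [Bialgebra k H] [Ring A]
    [Algebra k A] [RightComoduleAlgebra k H A] [AddCommGroup M] [Module k M] [Module Aᵐᵒᵖ M]
    [IsScalarTower k Aᵐᵒᵖ M] [RightComodule k H M] [IsHopfModule k H A M] {K : Submodule Aᵐᵒᵖ M}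
    (hK : IsSubcomodule H (K.restrictScalars k)) :
    let _ := subcomodule hK
    IsHopfModule k H A (K.restrictScalars k) := by
  let _ := subcomodule hK
  have rTensor_coaction (x : K.restrictScalars k) :
      (K.restrictScalars k).subtype.rTensor H (coaction k H (K.restrictScalars k) x) =
        coaction k H M x := rTensor_subCoact hK x
  refine ⟨fun x a => rTensor_subtype_injective (K.restrictScalars k) H ?_⟩
  have subtype_map₂ (u : K.restrictScalars k ⊗[k] H) (v : A ⊗[k] H) :
      (K.restrictScalars k).subtype.rTensor H
        (TensorProduct.map₂ (rightAction k A (K.restrictScalars k)) (LinearMap.mul k H) u v) =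
      TensorProduct.map₂ (rightAction k A M) (LinearMap.mul k H)
        ((K.restrictScalars k).subtype.rTensor H u) v := by
    induction u with
    | zero => simp
    | add x y hx hy => simp only [map_add, LinearMap.add_apply, hx, hy]
    | tmul x h =>
      induction v with
      | zero => simp
      | add y z hy hz => simp only [map_add, hy, hz]
      | tmul a g => rfl
  rw [subtype_map₂, rTensor_coaction, rTensor_coaction, ← IsHopfModule.coact_smul]
  rfl

section CofreeComodule

variable {k C Q : Type*} [CommRing k] [AddCommGroup C] [Module k C] [Coalgebra k C]
  [AddCommGroup Q] [Module k Q]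

variable (k C Q) in
/-- The coaction `q ⊗ c ↦ (q ⊗ c₁) ⊗ c₂` of the cofree comodule `Q ⊗ C`. -/
noncomputable def cofreeCoact : Q ⊗[k] C →ₗ[k] (Q ⊗[k] C) ⊗[k] C :=
  (TensorProduct.assoc k Q C C).symm.toLinearMap ∘ₗ comul.lTensor Q

theorem cofreeCoact_tmul (q : Q) (c : C) :
    cofreeCoact k C Q (q ⊗ₜ c) = (TensorProduct.mk k Q C q).rTensor C (comul c) := by
  simp only [cofreeCoact, LinearMap.comp_apply, LinearMap.lTensor_tmul, LinearEquiv.coe_coe]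
  generalize comul (R := k) c = w
  induction w <;> simp_all [TensorProduct.tmul_add]

theorem cofreeCoact_rTensor {P : Type*} [AddCommGroup P] [Module k P] (f : P →ₗ[k] Q)
    (z : P ⊗[k] C) :
    cofreeCoact k C Q (f.rTensor C z) = (f.rTensor C).rTensor C (cofreeCoact k C P z) := by
  induction z with
  | zero => simp
  | add x y hx hy => simp only [map_add, hx, hy]
  | tmul p c =>
    simp only [LinearMap.rTensor_tmul, cofreeCoact_tmul]
    generalize comul (R := k) c = w
    induction w <;> simp_all

variable (k C Q) in
/-- The cofree comodule `Q ⊗ C`. -/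
@[reducible]
noncomputable def cofreeComodule : RightComodule k C (Q ⊗[k] C) where
  coact := cofreeCoact k C Q
  coact_coassoc := by
    refine TensorProduct.ext' fun q c => ?_
    simp only [LinearMap.comp_apply, LinearEquiv.coe_coe]
    rw [cofreeCoact_tmul, assoc_rTensor_rTensor (δM := comul) (cofreeCoact_tmul q), coassoc_apply,
      lTensor_rTensor_apply]
  coact_counit := by
    refine TensorProduct.ext' fun q c => ?_
    change slice (Q ⊗[k] C) counit (cofreeCoact k C Q (q ⊗ₜ c)) = q ⊗ₜ c
    rw [cofreeCoact_tmul, slice_rTensor, show slice C counit (comul c) = c from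
      slice_counit_coaction (k := k) c, TensorProduct.mk_apply]

theorem rTensor_slice_counit_cofreeCoact (z : Q ⊗[k] C) :
    (slice Q counit).rTensor C (cofreeCoact k C Q z) = z := by
  induction z with
  | zero => simp
  | add x y hx hy => simp only [map_add, hx, hy]
  | tmul q c =>
    rw [cofreeCoact_tmul, ← LinearMap.rTensor_comp_apply,
      show slice Q counit ∘ₗ TensorProduct.mk k Q C q = LinearMap.toSpanSingleton k Q q ∘ₗ counit by
        ext; simp,
      LinearMap.rTensor_comp_apply, rTensor_counit_comul]
    simp

theorem cofreeCoact_coaction {M : Type*} [AddCommGroup M] [Module k M] [RightComodule k C M]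
    (m : M) : cofreeCoact k C M (coaction k C M m) =
      (coaction k C M).rTensor C (coaction k C M m) :=
  (coaction_coassoc m).symm

end CofreeComodule

section CofreeHopfModule

variable {k H A : Type*} [CommRing k] [Ring H] [Bialgebra k H] [Ring A] [Algebra k A]

theorem cofreeCoact_mul (z w : A ⊗[k] H) :
    cofreeCoact k H A (z * w) = cofreeCoact k H A z * cofreeCoact k H A w :=
  map_mul ((Algebra.TensorProduct.assoc k k k A H H).symm.toAlgHom.comp
    (Algebra.TensorProduct.map (AlgHom.id k A) (Bialgebra.comulAlgHom k H))) z w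

variable [RightComoduleAlgebra k H A]

variable (k H A) in
/-- The space `A ⊗ H`, as a Hopf module with action `(x ⊗ h) a = x a₍₀₎ ⊗ h a₍₁₎` and coaction
`x ⊗ h ↦ (x ⊗ h₁) ⊗ h₂`. It is a type synonym, so that this action does not clash with the right
multiplication of the ring `A ⊗ H`. -/
def CofreeHopfModule : Type _ := A ⊗[k] H

noncomputable instance : AddCommGroup (CofreeHopfModule k H A) :=
  inferInstanceAs (AddCommGroup (A ⊗[k] H))

noncomputable instance : Module k (CofreeHopfModule k H A) :=
  inferInstanceAs (Module k (A ⊗[k] H))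

variable (k H A) in
/-- The coaction of a comodule algebra, as a ring homomorphism. -/
noncomputable def coactionRingHom : A →+* A ⊗[k] H where
  toFun := coaction k H A
  map_one' := coaction_one k H A
  map_mul' := coaction_mul k H A
  map_zero' := map_zero _
  map_add' := map_add _

noncomputable instance : Module Aᵐᵒᵖ (CofreeHopfModule k H A) :=
  let _ : Module (A ⊗[k] H)ᵐᵒᵖ (CofreeHopfModule k H A) :=
    inferInstanceAs (Module (A ⊗[k] H)ᵐᵒᵖ (A ⊗[k] H))
  Module.compHom _ (coactionRingHom k H A).op

instance : IsScalarTower k Aᵐᵒᵖ (CofreeHopfModule k H A) where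
  smul_assoc c a z := by
    change A ⊗[k] H at z
    change z * coaction k H A (c • a.unop) = c • (z * coaction k H A a.unop)
    rw [map_smul, mul_smul_comm]

noncomputable instance : RightComodule k H (CofreeHopfModule k H A) :=
  cofreeComodule k H A

theorem map₂_mul_coaction (v : (A ⊗[k] H) ⊗[k] H) (u : A ⊗[k] H) :
    TensorProduct.map₂ ((LinearMap.mul k (A ⊗[k] H)).compl₂ (coaction k H A))
      (LinearMap.mul k H) v u = v * (coaction k H A).rTensor H u := by
  induction u with
  | zero => simp
  | add x y hx hy => simp only [map_add, mul_add, hx, hy]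
  | tmul a g => induction v <;> simp_all [add_mul]

instance : IsHopfModule k H A (CofreeHopfModule k H A) where
  coact_smul z a := by
    change A ⊗[k] H at z
    change cofreeCoact k H A (z * coaction k H A a) = TensorProduct.map₂
      ((LinearMap.mul k (A ⊗[k] H)).compl₂ (coaction k H A)) (LinearMap.mul k H)
        (cofreeCoact k H A z) (coaction k H A a)
    rw [map₂_mul_coaction, cofreeCoact_mul, cofreeCoact_coaction]

variable (k H A) in
/-- The inclusion `a ↦ a ⊗ 1` of `A` into the coinvariants of `A ⊗ H`. -/
noncomputable def cofreeCoinvariants : A →ₗ[(coinvariants k H A)ᵐᵒᵖ]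
    comoduleCoinvariants k H (CofreeHopfModule k H A) where
  toFun a := ⟨show A ⊗[k] H from a ⊗ₜ 1, by
    change cofreeCoact k H A (a ⊗ₜ 1) = _
    rw [cofreeCoact_tmul, Bialgebra.comul_one, Algebra.TensorProduct.one_def,
      LinearMap.rTensor_tmul, TensorProduct.mk_apply]
    rfl⟩
  map_add' a a' := Subtype.ext (TensorProduct.add_tmul a a' 1)
  map_smul' b a := Subtype.ext <| by
    change (a * (b.unop : A)) ⊗ₜ[k] (1 : H) = (a ⊗ₜ 1) * coaction k H A (b.unop : A)
    rw [show coaction k H A (b.unop : A) = _ from b.unop.2, Algebra.TensorProduct.tmul_mul_tmul,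
      mul_one]

theorem bijective_cofreeCoinvariants : Function.Bijective (cofreeCoinvariants k H A) := by
  refine ⟨fun a a' h => ?_, fun z => ⟨slice A counit (show A ⊗[k] H from z.1), Subtype.ext ?_⟩⟩
  · have h' : a ⊗ₜ[k] (1 : H) = a' ⊗ₜ[k] 1 := congr($h.1)
    simpa using congr(slice A counit $h')
  · have hz : cofreeCoact k H A z.1 = (show A ⊗[k] H from z.1) ⊗ₜ[k] 1 := z.2
    have h := rTensor_slice_counit_cofreeCoact (show A ⊗[k] H from z.1)
    rwa [hz] at h

theorem coe_galoisMap : ⇑(galoisMap k H A) = inducedMap (cofreeCoinvariants k H A) := by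
  funext x
  induction x using BalancedTensor.induction_on with
  | zero => rw [map_zero, map_zero]; rfl
  | add x y hx hy => rw [map_add, map_add, hx, hy]; rfl
  | tmul x y =>
    rw [inducedMap_mk, galoisMap_mk]
    rfl

end CofreeHopfModule

theorem BalancedTensor.map_map {k R N N' N'' M M' M'' : Type*} [CommRing k] [Ring R] [Algebra k R]
    [AddCommGroup N] [Module k N] [Module Rᵐᵒᵖ N] [IsScalarTower k Rᵐᵒᵖ N]
    [AddCommGroup N'] [Module k N'] [Module Rᵐᵒᵖ N'] [IsScalarTower k Rᵐᵒᵖ N']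
    [AddCommGroup N''] [Module k N''] [Module Rᵐᵒᵖ N''] [IsScalarTower k Rᵐᵒᵖ N'']
    [AddCommGroup M] [Module k M] [Module R M] [IsScalarTower k R M]
    [AddCommGroup M'] [Module k M'] [Module R M'] [IsScalarTower k R M']
    [AddCommGroup M''] [Module k M''] [Module R M''] [IsScalarTower k R M'']
    (f' : N' →ₗ[Rᵐᵒᵖ] N'') (f : N →ₗ[Rᵐᵒᵖ] N') (g' : M' →ₗ[R] M'') (g : M →ₗ[R] M')
    (x : BalancedTensor k R N M) :
    map (k := k) f' g' (map (k := k) f g x) = map (k := k) (f' ∘ₗ f) (g' ∘ₗ g) x := by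
  induction x using BalancedTensor.induction_on <;> simp_all

theorem BalancedTensor.map_zero_left {k R N N' M M' : Type*} [CommRing k] [Ring R] [Algebra k R]
    [AddCommGroup N] [Module k N] [Module Rᵐᵒᵖ N] [IsScalarTower k Rᵐᵒᵖ N]
    [AddCommGroup N'] [Module k N'] [Module Rᵐᵒᵖ N'] [IsScalarTower k Rᵐᵒᵖ N']
    [AddCommGroup M] [Module k M] [Module R M] [IsScalarTower k R M]
    [AddCommGroup M'] [Module k M'] [Module R M'] [IsScalarTower k R M']
    (g : M →ₗ[R] M') (x : BalancedTensor k R N M) :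
    map (k := k) (0 : N →ₗ[Rᵐᵒᵖ] N') g x = 0 := by
  induction x using BalancedTensor.induction_on <;> simp_all

/-! ### Consequences of an equivalence -/

section Equivalence

variable {k H A : Type u} [Field k] [Ring H] [Bialgebra k H] [Ring A] [Algebra k A]
  [RightComoduleAlgebra k H A]

theorem isHopfGalois_of_isEquivalence (h : (inductionFunctor k H A).IsEquivalence) :
    IsHopfGalois k H A := by
  have hbij : Function.Bijective (inducedMap (cofreeCoinvariants k H A)) :=
    (bijective_inducedMap_iff bijective_cofreeCoinvariants).2
      (bijective_inductionCounit_of_isEquivalence h _)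
  rwa [← coe_galoisMap] at hbij

theorem inducedMap_inductionUnit_comp {N N' : Type*}
    [AddCommGroup N] [Module k N] [Module (coinvariants k H A)ᵐᵒᵖ N]
    [IsScalarTower k (coinvariants k H A)ᵐᵒᵖ N]
    [AddCommGroup N'] [Module k N'] [Module (coinvariants k H A)ᵐᵒᵖ N']
    [IsScalarTower k (coinvariants k H A)ᵐᵒᵖ N'] (f : N →ₗ[(coinvariants k H A)ᵐᵒᵖ] N')
    (x : BalancedTensor k (coinvariants k H A) N A) :
    inducedMap (inductionUnit k H A N' ∘ₗ f) x = BalancedTensor.map (k := k) f LinearMap.id x := by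
  rw [← inducedMap_map, inducedMap_inductionUnit]

theorem le_span_coinvariants (h : (inductionFunctor k H A).IsEquivalence) {M : Type u}
    [AddCommGroup M] [Module k M] [Module Aᵐᵒᵖ M] [IsScalarTower k Aᵐᵒᵖ M] [RightComodule k H M]
    [IsHopfModule k H A M] {K : Submodule Aᵐᵒᵖ M}
    (hK : IsSubcomodule H (K.restrictScalars k)) :
    K ≤ Submodule.span Aᵐᵒᵖ ((K : Set M) ∩ comoduleCoinvariants k H M) := by
  let _ := subcomodule hK
  have _ := isHopfModule_subcomodule hK
  intro x hx
  obtain ⟨z, hz⟩ := (bijective_inductionCounit_of_isEquivalence h (K.restrictScalars k)).2 ⟨x, hx⟩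
  suffices hspan : ∀ z, (inductionCounit k H A (K.restrictScalars k) z : M) ∈
      Submodule.span Aᵐᵒᵖ ((K : Set M) ∩ comoduleCoinvariants k H M) by
    simpa only [hz] using hspan z
  intro z
  induction z using BalancedTensor.induction_on with
  | zero => rw [map_zero]; exact zero_mem _
  | add y z hy hz => rw [map_add]; exact add_mem hy hz
  | tmul n a =>
    have hn : coaction k H M (n : M) = (n : M) ⊗ₜ 1 := by
      rw [← Submodule.subtype_apply, (isColinear_subtype hK).coaction_apply,
        mem_comoduleCoinvariants.1 n.2, LinearMap.rTensor_tmul]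
    rw [inductionCounit, inducedMap_mk]
    exact Submodule.smul_mem _ (op a) (Submodule.subset_span ⟨n.1.2, hn⟩)

variable {N₁ N₂ N₃ : Type u}
  [AddCommGroup N₁] [Module k N₁] [Module (coinvariants k H A)ᵐᵒᵖ N₁]
  [IsScalarTower k (coinvariants k H A)ᵐᵒᵖ N₁]
  [AddCommGroup N₂] [Module k N₂] [Module (coinvariants k H A)ᵐᵒᵖ N₂]
  [IsScalarTower k (coinvariants k H A)ᵐᵒᵖ N₂]
  [AddCommGroup N₃] [Module k N₃] [Module (coinvariants k H A)ᵐᵒᵖ N₃]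
  [IsScalarTower k (coinvariants k H A)ᵐᵒᵖ N₃]
  {f : N₁ →ₗ[(coinvariants k H A)ᵐᵒᵖ] N₂} {g : N₂ →ₗ[(coinvariants k H A)ᵐᵒᵖ] N₃}

theorem exact_map_of_isEquivalence (h : (inductionFunctor k H A).IsEquivalence)
    (hfg : Function.Exact f g) : Function.Exact
      (BalancedTensor.map (k := k) f (LinearMap.id : A →ₗ[coinvariants k H A] A))
      (BalancedTensor.map (k := k) g (LinearMap.id : A →ₗ[coinvariants k H A] A)) := by
  let F := inducedMap (inductionUnit k H A N₂ ∘ₗ f)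
  let G := inducedMap (inductionUnit k H A N₃ ∘ₗ g)
  have hF (x) : F x = _ := inducedMap_inductionUnit_comp f x
  have hG (x) : G x = _ := inducedMap_inductionUnit_comp g x
  have hker : IsSubcomodule H ((LinearMap.ker G).restrictScalars k) :=
    (isColinear_inducedMap (inductionUnit k H A N₃ ∘ₗ g)).isSubcomodule_ker
  have ker_le_range : LinearMap.ker G ≤ LinearMap.range F := by
    refine (le_span_coinvariants h hker).trans (Submodule.span_le.2 ?_)
    rintro n ⟨hn, hcoinv⟩
    obtain ⟨y, hy⟩ := (bijective_inductionUnit_of_isEquivalence h N₂).2 ⟨n, hcoinv⟩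
    obtain rfl : BalancedTensor.mk k _ N₂ A (y ⊗ₜ 1) = n := congr($hy.1)
    have hgy : g y = 0 := (bijective_inductionUnit_of_isEquivalence h N₃).1 <| Subtype.ext <| by
      rw [map_zero]
      simpa [hG] using hn
    obtain ⟨x, rfl⟩ := (hfg y).1 hgy
    exact ⟨BalancedTensor.mk k _ N₁ A (x ⊗ₜ 1), by rw [hF, BalancedTensor.map_mk_tmul]; rfl⟩
  intro x
  refine ⟨fun hx => ?_, ?_⟩
  · obtain ⟨y, hy⟩ := ker_le_range (LinearMap.mem_ker.2 ((hG x).trans hx))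
    exact ⟨y, (hF y).symm.trans hy⟩
  · rintro ⟨y, rfl⟩
    rw [BalancedTensor.map_map, hfg.linearMap_comp_eq_zero, BalancedTensor.map_zero_left]

theorem exact_of_exact_map (hunit : ∀ (N : Type u) [AddCommGroup N] [Module k N]
      [Module (coinvariants k H A)ᵐᵒᵖ N] [IsScalarTower k (coinvariants k H A)ᵐᵒᵖ N],
      Function.Injective (inductionUnit k H A N))
    (hfg : Function.Exact
      (BalancedTensor.map (k := k) f (LinearMap.id : A →ₗ[coinvariants k H A] A))
      (BalancedTensor.map (k := k) g (LinearMap.id : A →ₗ[coinvariants k H A] A))) :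
    Function.Exact f g := by
  intro y
  refine ⟨fun hy => ?_, ?_⟩
  · let q := (LinearMap.range f).mkQ
    have hqf : q ∘ₗ f = 0 := (LinearMap.exact_map_mkQ_range f).linearMap_comp_eq_zero
    obtain ⟨x, hx⟩ := (hfg (BalancedTensor.mk k _ N₂ A (y ⊗ₜ 1))).1 (by simp [hy])
    have hqy : BalancedTensor.mk k (coinvariants k H A) _ A (q y ⊗ₜ[k] (1 : A)) = 0 := by
      have h := congr(BalancedTensor.map (k := k) q LinearMap.id $hx)
      rwa [BalancedTensor.map_map, hqf, BalancedTensor.map_zero_left, BalancedTensor.map_mk_tmul,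
        LinearMap.id_apply, eq_comm] at h
    have hy0 : q y = 0 := hunit _ (Subtype.ext (by rw [map_zero]; exact hqy))
    simpa [q] using hy0
  · rintro ⟨x, rfl⟩
    refine hunit N₃ (Subtype.ext ?_)
    have h := hfg.apply_apply_eq_zero (BalancedTensor.mk k _ N₁ A (x ⊗ₜ 1))
    rw [map_zero]
    simpa using h

theorem isLeftFaithfullyFlat_of_isEquivalence (h : (inductionFunctor k H A).IsEquivalence) :
    IsLeftFaithfullyFlat.{u} k (coinvariants k H A) A :=
  fun _ _ _ => fun _ _ => ⟨exact_map_of_isEquivalence h,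
    exact_of_exact_map fun N _ _ _ _ => (bijective_inductionUnit_of_isEquivalence h N).1⟩

end Equivalence

/-! ### Projectivity and retractions -/

theorem exact_of_retract {k X₁ X₂ X₃ Y₁ Y₂ Y₃ : Type*} [CommRing k]
    [AddCommGroup X₁] [Module k X₁] [AddCommGroup X₂] [Module k X₂] [AddCommGroup X₃] [Module k X₃]
    [AddCommGroup Y₁] [Module k Y₁] [AddCommGroup Y₂] [Module k Y₂] [AddCommGroup Y₃] [Module k Y₃]
    {f : X₁ →ₗ[k] X₂} {g : X₂ →ₗ[k] X₃} {f' : Y₁ →ₗ[k] Y₂} {g' : Y₂ →ₗ[k] Y₃}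
    (i₁ : X₁ →ₗ[k] Y₁) (i₂ : X₂ →ₗ[k] Y₂) (i₃ : X₃ →ₗ[k] Y₃)
    (r₁ : Y₁ →ₗ[k] X₁) (r₂ : Y₂ →ₗ[k] X₂) (r₃ : Y₃ →ₗ[k] X₃)
    (hif : ∀ x, i₂ (f x) = f' (i₁ x)) (hig : ∀ x, i₃ (g x) = g' (i₂ x))
    (hrf : ∀ y, r₂ (f' y) = f (r₁ y)) (hr₂ : ∀ x, r₂ (i₂ x) = x) (hr₃ : ∀ x, r₃ (i₃ x) = x)
    (h : Function.Exact f' g') : Function.Exact f g := by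
  intro x
  refine ⟨fun hx => ?_, ?_⟩
  · obtain ⟨y, hy⟩ := (h (i₂ x)).1 (by rw [← hig, hx, map_zero])
    exact ⟨r₁ y, by rw [← hrf, hy, hr₂]⟩
  · rintro ⟨y, rfl⟩
    rw [← hr₃ (g (f y)), hig, hif, h.apply_apply_eq_zero, map_zero]

/-- The action `r ⊗ p ↦ r p` of an algebra on a module, as a linear map from the induced module. -/
noncomputable def smulMap (k R P : Type*) [CommRing k] [Ring R] [Algebra k R] [AddCommGroup P]
    [Module k P] [Module R P] [IsScalarTower k R P] : R ⊗[k] P →ₗ[R] P :=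
  TensorProduct.AlgebraTensorModule.lift
    (LinearMap.toSpanSingleton R (P →ₗ[k] P) LinearMap.id)

@[simp]
theorem smulMap_tmul {k R P : Type*} [CommRing k] [Ring R] [Algebra k R] [AddCommGroup P]
    [Module k P] [Module R P] [IsScalarTower k R P] (r : R) (p : P) :
    smulMap k R P (r ⊗ₜ p) = r • p := rfl

namespace BalancedTensor

section Splitting

variable {k R P M M' : Type*} [CommRing k] [Ring R] [Algebra k R] [AddCommGroup P] [Module k P]
  [Module Rᵐᵒᵖ P] [IsScalarTower k Rᵐᵒᵖ P] [AddCommGroup M] [Module k M] [Module R M]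
  [IsScalarTower k R M] [AddCommGroup M'] [Module k M'] [Module R M'] [IsScalarTower k R M']

variable (k R M) in
/-- The bilinear map `m ↦ (op r ↦ r m)`. -/
noncomputable def unopSMul : M →ₗ[k] Rᵐᵒᵖ →ₗ[k] M :=
  ((Algebra.lsmul k k M).toLinearMap ∘ₗ (opLinearEquiv k (M := R)).symm.toLinearMap).flip

@[simp]
theorem unopSMul_apply (m : M) (r : Rᵐᵒᵖ) : unopSMul k R M m r = r.unop • m := rfl

omit [Module Rᵐᵒᵖ P] [IsScalarTower k Rᵐᵒᵖ P] in
theorem rTensor_unopSMul_op_smul (z : Rᵐᵒᵖ ⊗[k] P) (s : R) (m : M) :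
    (unopSMul k R M m).rTensor P (op s • z) = (unopSMul k R M (s • m)).rTensor P z := by
  induction z <;> simp_all [TensorProduct.smul_tmul', mul_smul]

variable (M) in
/-- The map `p ⊗ m ↦ Σ rᵢ m ⊗ pᵢ`, where `σ(p) = Σ rᵢ ⊗ pᵢ`. -/
noncomputable def splitting (σ : P →ₗ[Rᵐᵒᵖ] Rᵐᵒᵖ ⊗[k] P) :
    BalancedTensor k R P M →ₗ[k] M ⊗[k] P :=
  lift (TensorProduct.lift ((LinearMap.rTensorHom P ∘ₗ unopSMul k R M).flip ∘ₗ
    σ.restrictScalars k)) fun p s m => by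
      simp [rTensor_unopSMul_op_smul]

@[simp]
theorem splitting_mk_tmul (σ : P →ₗ[Rᵐᵒᵖ] Rᵐᵒᵖ ⊗[k] P) (p : P) (m : M) :
    splitting M σ (mk k R P M (p ⊗ₜ m)) = (unopSMul k R M m).rTensor P (σ p) :=
  lift_mk _ _ _

theorem splitting_map (σ : P →ₗ[Rᵐᵒᵖ] Rᵐᵒᵖ ⊗[k] P) (f : M →ₗ[R] M')
    (x : BalancedTensor k R P M) :
    splitting M' σ (map (k := k) LinearMap.id f x) =
      (f.restrictScalars k).rTensor P (splitting M σ x) := by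
  have rTensor_map (m : M) (z : Rᵐᵒᵖ ⊗[k] P) : (unopSMul k R M' (f m)).rTensor P z =
      (f.restrictScalars k).rTensor P ((unopSMul k R M m).rTensor P z) := by
    induction z <;> simp_all
  induction x using BalancedTensor.induction_on <;> simp_all

theorem lift_flip_tmulLeft_splitting {σ : P →ₗ[Rᵐᵒᵖ] Rᵐᵒᵖ ⊗[k] P}
    (hσ : smulMap k Rᵐᵒᵖ P ∘ₗ σ = LinearMap.id) (x : BalancedTensor k R P M) :
    TensorProduct.lift (tmulLeft k R M).flip (splitting M σ x) = x := by
  have lift_rTensor (m : M) (z : Rᵐᵒᵖ ⊗[k] P) :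
      TensorProduct.lift (tmulLeft k R M).flip ((unopSMul k R M m).rTensor P z) =
        mk k R P M (smulMap k Rᵐᵒᵖ P z ⊗ₜ m) := by
    induction z <;> simp_all [TensorProduct.add_tmul, ← mk_smul_tmul]
  induction x using BalancedTensor.induction_on with
  | zero => simp
  | add x y hx hy => simp only [map_add, hx, hy]
  | tmul p m => rw [splitting_mk_tmul, lift_rTensor, ← LinearMap.comp_apply, hσ, LinearMap.id_apply]

theorem lift_flip_tmulLeft_rTensor (f : M →ₗ[R] M') (z : M ⊗[k] P) :
    TensorProduct.lift (tmulLeft k R M').flip ((f.restrictScalars k).rTensor P z) =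
      map (k := k) LinearMap.id f (TensorProduct.lift (tmulLeft k R M).flip z) := by
  induction z <;> simp_all

variable (M) in
/-- The map `p ⊗ m ↦ t(p) m`. -/
noncomputable def evalLeft (t : P →ₗ[Rᵐᵒᵖ] R) : BalancedTensor k R P M →ₗ[k] M :=
  lift (TensorProduct.lift ((Algebra.lsmul k k M).toLinearMap ∘ₗ t.restrictScalars k))
    fun p r m => by simp

@[simp]
theorem evalLeft_mk_tmul (t : P →ₗ[Rᵐᵒᵖ] R) (p : P) (m : M) :
    evalLeft M t (mk k R P M (p ⊗ₜ m)) = t p • m :=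
  lift_mk _ _ _

theorem evalLeft_map (t : P →ₗ[Rᵐᵒᵖ] R) (f : M →ₗ[R] M') (x : BalancedTensor k R P M) :
    evalLeft M' t (map (k := k) LinearMap.id f x) = f (evalLeft M t x) := by
  induction x using BalancedTensor.induction_on <;> simp_all

variable (P) in
/-- The map `p ⊗ m ↦ p t(m)`. -/
noncomputable def evalRight (t : M →ₗ[R] R) : BalancedTensor k R P M →ₗ[k] P :=
  lift (TensorProduct.lift ((rightAction k R P).compl₂ (t.restrictScalars k)))
    fun p r m => by simp [mul_smul]

@[simp]
theorem evalRight_mk_tmul (t : M →ₗ[R] R) (p : P) (m : M) :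
    evalRight P t (mk k R P M (p ⊗ₜ m)) = op (t m) • p :=
  lift_mk _ _ _

theorem evalRight_map {P' : Type*} [AddCommGroup P'] [Module k P'] [Module Rᵐᵒᵖ P']
    [IsScalarTower k Rᵐᵒᵖ P'] (t : M →ₗ[R] R) (f : P →ₗ[Rᵐᵒᵖ] P') (x : BalancedTensor k R P M) :
    evalRight P' t (map (k := k) f LinearMap.id x) = f (evalRight P t x) := by
  induction x using BalancedTensor.induction_on <;> simp_all

end Splitting

end BalancedTensor

theorem isRightFaithfullyFlat_of_projective {k R P : Type*} [CommRing k] [Ring R] [Algebra k R]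
    [AddCommGroup P] [Module k P] [Module.Flat k P] [Module Rᵐᵒᵖ P] [IsScalarTower k Rᵐᵒᵖ P]
    [Module.Projective Rᵐᵒᵖ P] {t : P →ₗ[Rᵐᵒᵖ] R} {e : P} (ht : t e = 1) :
    IsRightFaithfullyFlat.{t} k R P := by
  obtain ⟨σ, hσ⟩ := Module.projective_lifting_property (smulMap k Rᵐᵒᵖ P) LinearMap.id
    fun p => ⟨1 ⊗ₜ p, by simp⟩
  intro M₁ M₂ M₃ _ _ _ _ _ _ _ _ _ _ _ _ f g
  refine ⟨fun hfg => ?_, fun hfg => ?_⟩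
  · exact exact_of_retract (BalancedTensor.splitting M₁ σ) (BalancedTensor.splitting M₂ σ)
      (BalancedTensor.splitting M₃ σ) _ _ _ (BalancedTensor.splitting_map σ f)
      (BalancedTensor.splitting_map σ g) (BalancedTensor.lift_flip_tmulLeft_rTensor f)
      (BalancedTensor.lift_flip_tmulLeft_splitting hσ)
      (BalancedTensor.lift_flip_tmulLeft_splitting hσ) (Module.Flat.rTensor_exact P hfg)
  · exact exact_of_retract (f := f.restrictScalars k) (g := g.restrictScalars k)
      (BalancedTensor.tmulLeft k R M₁ e) (BalancedTensor.tmulLeft k R M₂ e)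
      (BalancedTensor.tmulLeft k R M₃ e) (BalancedTensor.evalLeft M₁ t)
      (BalancedTensor.evalLeft M₂ t) (BalancedTensor.evalLeft M₃ t) (by simp) (by simp)
      (BalancedTensor.evalLeft_map t f) (by simp [ht]) (by simp [ht]) hfg

section Existence

variable {k H A : Type u} [Field k]

theorem exists_isTotalIntegral [Ring H] [Bialgebra k H] [Ring A] [Algebra k A]
    [RightComoduleAlgebra k H A] (hA : IsInjectiveComodule.{u} k H A) :
    ∃ γ : H →ₗ[k] A, IsTotalIntegral γ := by
  let _ : RightComodule k H k :=
    { coact := (TensorProduct.mk k k H).flip 1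
      coact_coassoc := by ext; simp [Algebra.TensorProduct.one_def]
      coact_counit := by ext; simp }
  have isColinear_unit : IsColinear k H (Algebra.linearMap k H) := by
    ext
    change (Algebra.linearMap k H).rTensor H ((1 : k) ⊗ₜ (1 : H)) = comul (algebraMap k H 1)
    simp [Algebra.TensorProduct.one_def]
  have isColinear_unit' : IsColinear k H (Algebra.linearMap k A) := by
    ext
    change (Algebra.linearMap k A).rTensor H ((1 : k) ⊗ₜ (1 : H)) =
      coaction k H A (algebraMap k A 1)
    simp [Algebra.TensorProduct.one_def, coaction_one]
  have injective_unit : Function.Injective (Algebra.linearMap k H) := fun a b h => by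
    simpa using congr(counit (R := k) $h)
  obtain ⟨γ, hγ, hγ'⟩ := hA k H _ _ isColinear_unit injective_unit isColinear_unit'
  exact ⟨γ, hγ, by simpa using congr($hγ' 1)⟩

theorem exists_isTranslationMap [Ring H] [Bialgebra k H] [Ring A] [Algebra k A]
    [RightComoduleAlgebra k H A] (hβ : Function.Surjective (galoisMap k H A)) :
    ∃ ℓ : H →ₗ[k] A ⊗[k] A, IsTranslationMap ℓ := by
  have surjective_preGaloisMap : Function.Surjective (preGaloisMap k H A) :=
    hβ.comp BalancedTensor.mk_surjective
  obtain ⟨s, hs⟩ := (preGaloisMap k H A).exists_rightInverse_of_surjective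
    (LinearMap.range_eq_top.2 surjective_preGaloisMap)
  exact ⟨s ∘ₗ TensorProduct.mk k A H 1, fun h => congr($hs _)⟩

end Existence

section Retraction

variable {k A : Type*} [CommRing k] [Ring A] [Algebra k A] {B : Subalgebra k A}

theorem exists_isCompl_leftSubmodule {t : A →ₗ[B] B} (ht : ∀ b : B, t b = b) :
    ∃ C : Submodule B A, IsCompl (leftSubmodule B) C :=
  let t' : A →ₗ[B] leftSubmodule B := { toFun := t, map_add' := t.map_add, map_smul' := t.map_smul }
  ⟨LinearMap.ker t', LinearMap.isCompl_of_proj fun b => ht b⟩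

theorem exists_isCompl_rightSubmodule {t : A →ₗ[Bᵐᵒᵖ] B} (ht : ∀ b : B, t b = b) :
    ∃ C : Submodule Bᵐᵒᵖ A, IsCompl (rightSubmodule B) C :=
  let t' : A →ₗ[Bᵐᵒᵖ] rightSubmodule B :=
    { toFun := t, map_add' := t.map_add, map_smul' := t.map_smul }
  ⟨LinearMap.ker t', LinearMap.isCompl_of_proj fun b => ht b⟩

end Retraction

section Splitting

variable {k H A : Type*} [CommRing k] [Ring H] [HopfAlgebra k H] [Ring A] [Algebra k A]
  [RightComoduleAlgebra k H A] (hS : Function.Bijective (antipode k : H →ₗ[k] H))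
  {γ : H →ₗ[k] A} (hγ : IsTotalIntegral γ) {ℓ : H →ₗ[k] A ⊗[k] A}

/-- The pairing `⟨x, a⟩` of `A` with itself, with values in the subalgebra of coinvariants. -/
noncomputable def selfPairing : A →ₗ[k] A →ₗ[k] coinvariants k H A :=
  (coinvPairing hS hγ).compr₂ (coinvariantsEquiv k H A).toLinearMap

theorem selfPairing_coe_mul (b : coinvariants k H A) (x a : A) :
    selfPairing hS hγ (b * x) a = b * selfPairing hS hγ x a := by
  have h := coinvPairing_op_smul_coe hS hγ ((coinvariantsEquiv k H A).symm b) x a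
  exact congr(coinvariantsEquiv k H A $h)

theorem selfPairing_mul_coe (x a : A) (b : coinvariants k H A) :
    selfPairing hS hγ x (a * b) = selfPairing hS hγ x a * b :=
  congr(coinvariantsEquiv k H A $(coinvPairing_mul_coe hS hγ x a b))

theorem selfPairing_coe_coe (b c : coinvariants k H A) : selfPairing hS hγ (b : A) c = b * c := by
  have h := coinvPairing_coe_coe hS hγ ((coinvariantsEquiv k H A).symm b) c
  exact congr(coinvariantsEquiv k H A $h)

/-- The `B`-linear retraction `x ↦ ⟨x, 1⟩` of the inclusion of left modules `B → A`. -/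
noncomputable def leftRetraction : A →ₗ[coinvariants k H A] coinvariants k H A where
  toFun x := selfPairing hS hγ x 1
  map_add' x y := by simp
  map_smul' b x := selfPairing_coe_mul hS hγ b x 1

theorem leftRetraction_coe (b : coinvariants k H A) : leftRetraction hS hγ (b : A) = b :=
  (selfPairing_coe_coe hS hγ b 1).trans (mul_one b)

/-- The `B`-linear retraction `a ↦ ⟨1, a⟩` of the inclusion of right modules `B → A`. -/
noncomputable def rightRetraction : A →ₗ[(coinvariants k H A)ᵐᵒᵖ] coinvariants k H A where
  toFun a := selfPairing hS hγ 1 a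
  map_add' a a' := map_add _ a a'
  map_smul' b a := selfPairing_mul_coe hS hγ 1 a b.unop

theorem rightRetraction_coe (b : coinvariants k H A) : rightRetraction hS hγ (b : A) = b :=
  (selfPairing_coe_coe hS hγ 1 b).trans (one_mul b)

theorem rTensor_rightAction_coinvariantsEquiv (b : coinvariants k H A)
    (z : comoduleCoinvariants k H A ⊗[k] A) :
    (coinvariantsEquiv k H A).toLinearMap.rTensor A
      ((rightAction k (coinvariants k H A) (comoduleCoinvariants k H A)
        ((coinvariantsEquiv k H A).symm b) ∘ₗ coinvariantsEquiv k H A).rTensor A z) =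
    b • (coinvariantsEquiv k H A).toLinearMap.rTensor A z := by
  induction z with
  | zero => simp
  | add z w hz hw => simp only [map_add, smul_add, hz, hw]
  | tmul c a => rfl

variable (ℓ) in
/-- The map `a ↦ Σ ⟨a₍₀₎, lᵢ⟩ ⊗ rᵢ` with `ℓ(a₍₁₎) = Σ lᵢ ⊗ rᵢ`, which splits the action
`B ⊗ A → A`. -/
noncomputable def leftSplitting : A →ₗ[coinvariants k H A] coinvariants k H A ⊗[k] A :=
  { (coinvariantsEquiv k H A).toLinearMap.rTensor A ∘ₗ coinvSplitting hS hγ ℓ with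
    map_smul' := fun b a =>
      Eq.trans
        congr((coinvariantsEquiv k H A).toLinearMap.rTensor A
          $(coinvSplitting_op_smul_coe hS hγ ((coinvariantsEquiv k H A).symm b) a))
        (rTensor_rightAction_coinvariantsEquiv b _) }

theorem smulMap_comp_leftSplitting (hℓ : IsTranslationMap ℓ) :
    smulMap k (coinvariants k H A) A ∘ₗ leftSplitting hS hγ ℓ = LinearMap.id := by
  have smulMap_rTensor (z : comoduleCoinvariants k H A ⊗[k] A) :
      smulMap k (coinvariants k H A) A ((coinvariantsEquiv k H A).toLinearMap.rTensor A z) =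
        TensorProduct.lift (rightAction k A A ∘ₗ (comoduleCoinvariants k H A).subtype) z := by
    induction z with
    | zero => simp
    | add z w hz hw => simp only [map_add, hz, hw]
    | tmul c a => rfl
  exact LinearMap.ext fun a =>
    (smulMap_rTensor _).trans (lift_rightAction_coinvSplitting hS hγ hℓ a)

theorem lift_mul_selfPairing (z : A ⊗[k] A) (x : A) :
    TensorProduct.lift ((LinearMap.mul k A).compl₂
      ((coinvariants k H A).val.toLinearMap ∘ₗ (selfPairing hS hγ).flip x)) z =
    TensorProduct.lift ((LinearMap.mul k A).compl₂ (twist hS γ x ∘ₗ antipode k))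
      (preGaloisMap k H A z) := by
  induction z with
  | zero => simp
  | add z w hz hw => simp only [map_add, hz, hw]
  | tmul l r =>
    have h : (selfPairing hS hγ r x : A) = _ :=
      (coe_coinvPairing hS hγ r x).trans (sweedler_twistedAction_apply hS r x)
    simp only [TensorProduct.lift.tmul, LinearMap.compl₂_apply, LinearMap.comp_apply,
      LinearMap.flip_apply, AlgHom.toLinearMap_apply, Subalgebra.val_apply, h, sweedler_apply,
      preGaloisMap_tmul, LinearMap.mul_apply']
    generalize coaction k H A r = w
    induction w <;> simp_all [mul_add, mul_assoc]

/-- The bilinear map `(x, c) ↦ Σ ⟨rᵢ, x⟩ ⊗ lᵢ` with `ℓ(S⁻¹ c) = Σ lᵢ ⊗ rᵢ`. -/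
noncomputable def rightSplittingAux (ℓ : H →ₗ[k] A ⊗[k] A) :
    A →ₗ[k] H →ₗ[k] (coinvariants k H A)ᵐᵒᵖ ⊗[k] A :=
  (LinearMap.rTensorHom A ∘ₗ (selfPairing hS hγ).flip.compr₂
    (opLinearEquiv k (M := coinvariants k H A)).toLinearMap).compl₂
    ((TensorProduct.comm k A A).toLinearMap ∘ₗ ℓ ∘ₗ antipodeInv hS)

theorem rightSplittingAux_mul_coe (x : A) (b : coinvariants k H A) (c : H) :
    rightSplittingAux hS hγ ℓ (x * b) c = op b • rightSplittingAux hS hγ ℓ x c := by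
  simp only [rightSplittingAux, LinearMap.compl₂_apply, LinearMap.comp_apply]
  generalize ℓ (antipodeInv hS c) = z
  induction z <;> simp_all [selfPairing_mul_coe, TensorProduct.smul_tmul']

theorem smulMap_rightSplittingAux (hℓ : IsTranslationMap ℓ) (x : A) (c : H) :
    smulMap k (coinvariants k H A)ᵐᵒᵖ A (rightSplittingAux hS hγ ℓ x c) = twist hS γ x c := by
  have smulMap_rTensor (z : A ⊗[k] A) :
      smulMap k (coinvariants k H A)ᵐᵒᵖ A
        (((opLinearEquiv k (M := coinvariants k H A)).toLinearMap ∘ₗ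
          (selfPairing hS hγ).flip x).rTensor A (TensorProduct.comm k A A z)) =
      TensorProduct.lift ((LinearMap.mul k A).compl₂
        ((coinvariants k H A).val.toLinearMap ∘ₗ (selfPairing hS hγ).flip x)) z := by
    induction z <;> simp_all [op_smul_def]
  refine (smulMap_rTensor (ℓ (antipodeInv hS c))).trans ?_
  rw [lift_mul_selfPairing, hℓ]
  simp

variable (ℓ) in
/-- The map `a ↦ Σ ⟨rᵢ, a₍₀₎⟩ ⊗ lᵢ` with `ℓ(S⁻¹ a₍₁₎) = Σ lᵢ ⊗ rᵢ`, which splits the action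
`Bᵐᵒᵖ ⊗ A → A`. -/
noncomputable def rightSplitting :
    A →ₗ[(coinvariants k H A)ᵐᵒᵖ] (coinvariants k H A)ᵐᵒᵖ ⊗[k] A :=
  { sweedler (rightSplittingAux hS hγ ℓ) with
    map_smul' := fun b a => by
      change sweedler (rightSplittingAux hS hγ ℓ) (a * b.unop) =
        b • sweedler (rightSplittingAux hS hγ ℓ) a
      rw [sweedler_apply, sweedler_apply, coaction_mul_coe]
      generalize coaction k H A a = z
      induction z <;> simp_all [add_mul, rightSplittingAux_mul_coe] }

theorem smulMap_comp_rightSplitting (hℓ : IsTranslationMap ℓ) :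
    smulMap k (coinvariants k H A)ᵐᵒᵖ A ∘ₗ rightSplitting hS hγ ℓ = LinearMap.id := by
  refine LinearMap.ext fun a => ?_
  have h : (rightSplittingAux hS hγ ℓ).compr₂
      ((smulMap k (coinvariants k H A)ᵐᵒᵖ A).restrictScalars k) = twist hS γ :=
    LinearMap.ext₂ fun x c => smulMap_rightSplittingAux hS hγ hℓ x c
  refine (map_sweedler ((smulMap k (coinvariants k H A)ᵐᵒᵖ A).restrictScalars k)
    (rightSplittingAux hS hγ ℓ) a).trans ?_
  rw [h, sweedler_twist hS hγ, LinearMap.id_apply]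

end Splitting

section Counit

variable {k H A M : Type*} [CommRing k] [Ring H] [HopfAlgebra k H] [Ring A] [Algebra k A]
  [RightComoduleAlgebra k H A] [AddCommGroup M] [Module k M] [Module Aᵐᵒᵖ M]
  [IsScalarTower k Aᵐᵒᵖ M] [RightComodule k H M] [IsHopfModule k H A M]
  (hS : Function.Bijective (antipode k : H →ₗ[k] H)) {γ : H →ₗ[k] A} (hγ : IsTotalIntegral γ)
  {ℓ : H →ₗ[k] A ⊗[k] A} (hℓ : IsTranslationMap ℓ)

include hS hγ hℓ in
theorem bijective_inductionCounit : Function.Bijective (inductionCounit k H A M) := by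
  have mk_rTensor (n : comoduleCoinvariants k H M) (z : comoduleCoinvariants k H A ⊗[k] A) :
      BalancedTensor.mk k (coinvariants k H A) _ A
        ((rightAction k (coinvariants k H A) _ n ∘ₗ coinvariantsEquiv k H A).rTensor A z) =
      BalancedTensor.mk k (coinvariants k H A) _ A
        (n ⊗ₜ TensorProduct.lift
          (rightAction k A A ∘ₗ (comoduleCoinvariants k H A).subtype) z) := by
    induction z with
    | zero => simp
    | add z w hz hw => simp only [map_add, hz, hw, TensorProduct.tmul_add]
    | tmul c a =>
      exact BalancedTensor.mk_smul_tmul (k := k) (R := coinvariants k H A) n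
        (coinvariantsEquiv k H A c) a
  have leftInverse (x : BalancedTensor k (coinvariants k H A) (comoduleCoinvariants k H M) A) :
      BalancedTensor.mk k (coinvariants k H A) (comoduleCoinvariants k H M) A
        (coinvSplitting hS hγ ℓ (inductionCounit k H A M x)) = x := by
    induction x using BalancedTensor.induction_on with
    | zero => simp
    | add x y hx hy => simp only [map_add, hx, hy]
    | tmul n a =>
      have h : inductionCounit k H A M (BalancedTensor.mk k _ _ A (n ⊗ₜ a)) = op a • (n : M) :=
        inducedMap_mk LinearMap.id (n ⊗ₜ a)
      rw [h, coinvSplitting_op_smul_coe, mk_rTensor, lift_rightAction_coinvSplitting hS hγ hℓ]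
  refine ⟨Function.HasLeftInverse.injective
    ⟨fun m => BalancedTensor.mk k _ _ A (coinvSplitting hS hγ ℓ m), leftInverse⟩, fun m => ?_⟩
  exact ⟨_, (inducedMap_mk LinearMap.id _).trans (lift_rightAction_coinvSplitting hS hγ hℓ m)⟩

end Counit

section Unit

variable {k H A : Type u} [Field k] [Ring H] [HopfAlgebra k H] [Ring A] [Algebra k A]
  [RightComoduleAlgebra k H A] {N : Type*} [AddCommGroup N] [Module k N]
  [Module (coinvariants k H A)ᵐᵒᵖ N] [IsScalarTower k (coinvariants k H A)ᵐᵒᵖ N]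
  (hS : Function.Bijective (antipode k : H →ₗ[k] H)) {γ : H →ₗ[k] A} (hγ : IsTotalIntegral γ)
  {ℓ : H →ₗ[k] A ⊗[k] A} (hℓ : IsTranslationMap ℓ)

theorem evalRight_leftRetraction_mk_one {P : Type*} [AddCommGroup P] [Module k P]
    [Module (coinvariants k H A)ᵐᵒᵖ P] [IsScalarTower k (coinvariants k H A)ᵐᵒᵖ P] (p : P) :
    BalancedTensor.evalRight P (leftRetraction hS hγ)
      (BalancedTensor.mk k (coinvariants k H A) P A (p ⊗ₜ 1)) = p := by
  have h := leftRetraction_coe hS hγ (1 : coinvariants k H A)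
  rw [OneMemClass.coe_one] at h
  simp [h]

include hS hγ hℓ in
theorem bijective_inductionUnit : Function.Bijective (inductionUnit k H A N) := by
  refine ⟨fun n n' h => ?_, fun y => ?_⟩
  · rw [← evalRight_leftRetraction_mk_one hS hγ n, ← evalRight_leftRetraction_mk_one hS hγ n']
    exact congr(BalancedTensor.evalRight N (leftRetraction hS hγ) (Subtype.val $h))
  · let z := inductionCounit k H A _ (BalancedTensor.mk k _ _ A (y ⊗ₜ 1))
    have hz : BalancedTensor.map (k := k) (inductionUnit k H A N)
        (LinearMap.id : A →ₗ[coinvariants k H A] A) z = BalancedTensor.mk k _ _ A (y ⊗ₜ 1) :=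
      (bijective_inductionCounit hS hγ hℓ).1
        ((inducedMap_map LinearMap.id _ z).trans (inducedMap_inductionUnit z))
    refine ⟨BalancedTensor.evalRight N (leftRetraction hS hγ) z, ?_⟩
    rw [← BalancedTensor.evalRight_map, hz, evalRight_leftRetraction_mk_one]

end Unit

/-! ### Injectivity and finite-dimensional comodules -/

section DualAction

variable {k C : Type*} [Field k] [AddCommGroup C] [Module k C] [Coalgebra k C]

/-- The action `m ↦ φ(m₍₁₎) m₍₀₎` of a functional on `C` on a `C`-comodule. Over a field, the
subcomodules are the subspaces stable under all these maps, and the colinear maps are the linear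
maps commuting with all of them. -/
noncomputable def dualAction (M : Type*) [AddCommGroup M] [Module k M] [RightComodule k C M]
    (φ : Module.Dual k C) : M →ₗ[k] M :=
  slice M φ ∘ₗ coaction k C M

variable {M N : Type*} [AddCommGroup M] [Module k M] [RightComodule k C M]
  [AddCommGroup N] [Module k N] [RightComodule k C N]

theorem isSubcomodule_iff_dualAction_mem {K : Submodule k M} :
    IsSubcomodule C K ↔ ∀ x ∈ K, ∀ φ : Module.Dual k C, dualAction M φ x ∈ K :=
  isSubcomodule_iff_slice_mem

theorem isColinear_iff_dualAction {f : M →ₗ[k] N} :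
    IsColinear k C f ↔
      ∀ (φ : Module.Dual k C) (m : M), f (dualAction M φ m) = dualAction N φ (f m) := by
  refine ⟨fun hf φ m => ?_, fun h => LinearMap.ext fun m => ?_⟩
  · rw [dualAction, dualAction, LinearMap.comp_apply, LinearMap.comp_apply, hf.coaction_apply,
      slice_rTensor]
  · refine sub_eq_zero.1 (eq_zero_of_slice fun φ => ?_)
    rw [map_sub, LinearMap.comp_apply, slice_rTensor]
    exact sub_eq_zero.2 (h φ m)

theorem coe_dualAction_subcomodule {K : Submodule k M} (hK : IsSubcomodule C K)
    (φ : Module.Dual k C) (x : K) :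
    let _ := subcomodule hK
    (dualAction K φ x : M) = dualAction M φ (x : M) :=
  let _ := subcomodule hK
  isColinear_iff_dualAction.1 (isColinear_subtype hK) φ x

theorem dualAction_dualAction (φ ψ : Module.Dual k C) (m : M) :
    dualAction M φ (dualAction M ψ m) =
      dualAction M (LinearMap.mul' k k ∘ₗ TensorProduct.map φ ψ ∘ₗ comul) m := by
  have slice_assoc (m : M) (w : C ⊗[k] C) :
      slice M φ (slice (M ⊗[k] C) ψ ((TensorProduct.assoc k M C C).symm (m ⊗ₜ w))) =
        LinearMap.mul' k k (TensorProduct.map φ ψ w) • m := by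
    induction w <;> simp_all [TensorProduct.tmul_add, add_smul, smul_smul, mul_comm]
  simp only [dualAction, LinearMap.comp_apply]
  rw [← slice_rTensor, coaction_coassoc]
  generalize coaction k C M m = z
  induction z <;> simp_all

variable (k C) in
/-- The subspace `{φ(m₍₁₎) m₍₀₎}`, which is the subcomodule generated by `m`. -/
noncomputable def cyclicSubcomodule (m : M) : Submodule k M :=
  Submodule.span k (Set.range fun φ : Module.Dual k C => dualAction M φ m)

theorem self_mem_cyclicSubcomodule (m : M) : m ∈ cyclicSubcomodule k C m :=
  Submodule.subset_span ⟨counit, slice_counit_coaction m⟩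

theorem isSubcomodule_cyclicSubcomodule (m : M) : IsSubcomodule C (cyclicSubcomodule k C m) :=
  isSubcomodule_iff_dualAction_mem.2 fun x hx φ => by
    refine Submodule.span_le (p := (cyclicSubcomodule k C m).comap (dualAction M φ)).2 ?_ hx
    rintro _ ⟨ψ, rfl⟩
    exact Submodule.subset_span ⟨_, (dualAction_dualAction φ ψ m).symm⟩

omit [Coalgebra k C] [RightComodule k C M] in
theorem exists_finite_slice_mem (z : M ⊗[k] C) :
    ∃ F : Submodule k M, Module.Finite k F ∧ ∀ φ : Module.Dual k C, slice M φ z ∈ F := by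
  induction z with
  | zero => exact ⟨⊥, inferInstance, by simp⟩
  | tmul m c =>
    refine ⟨k ∙ m, inferInstance, fun φ => ?_⟩
    rw [slice_tmul]
    exact Submodule.smul_mem _ _ (Submodule.mem_span_singleton_self m)
  | add x y hx hy =>
    obtain ⟨F, hF, hxF⟩ := hx
    obtain ⟨G, hG, hyG⟩ := hy
    refine ⟨F ⊔ G, inferInstance, fun φ => ?_⟩
    rw [map_add]
    exact Submodule.add_mem_sup (hxF φ) (hyG φ)

instance finite_cyclicSubcomodule (m : M) : Module.Finite k (cyclicSubcomodule k C m) := by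
  obtain ⟨F, _, hF⟩ := exists_finite_slice_mem (coaction k C M m)
  have le : cyclicSubcomodule k C m ≤ F := Submodule.span_le.2 (Set.range_subset_iff.2 hF)
  exact Module.Finite.of_injective _ (Submodule.inclusion_injective le)

end DualAction

section FinInjective

variable {k C : Type*} [Field k] [AddCommGroup C] [Module k C] [Coalgebra k C]

/-- Comodule maps to `I` extend along injective maps of finite-dimensional comodules. This is the
analogue for comodules of the condition in Baer's criterion. -/
def IsFinInjectiveComodule (k C I : Type*) [Field k] [AddCommGroup C] [Module k C] [Coalgebra k C]
    [AddCommGroup I] [Module k I] [RightComodule k C I] : Prop :=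
  ∀ (X Y : Type t) [AddCommGroup X] [Module k X] [RightComodule k C X]
    [AddCommGroup Y] [Module k Y] [RightComodule k C Y] [Module.Finite k X] [Module.Finite k Y]
    (i : X →ₗ[k] Y) (f : X →ₗ[k] I), IsColinear k C i → Function.Injective i → IsColinear k C f →
      ∃ g : Y →ₗ[k] I, IsColinear k C g ∧ g ∘ₗ i = f

variable {I : Type*} {Y : Type t} [AddCommGroup I] [Module k I] [RightComodule k C I]
  [AddCommGroup Y] [Module k Y] [RightComodule k C Y]

variable (C) in
/-- A partially defined linear map between comodules is colinear if its graph is stable under the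
functionals on `C`; in particular its domain is then a subcomodule. -/
def IsColinearPMap (g : Y →ₗ.[k] I) : Prop :=
  ∀ (φ : Module.Dual k C), ∀ p ∈ g.graph, (dualAction Y φ p.1, dualAction I φ p.2) ∈ g.graph

theorem IsColinearPMap.isSubcomodule_domain {g : Y →ₗ.[k] I} (hg : IsColinearPMap C g) :
    IsSubcomodule C g.domain :=
  isSubcomodule_iff_dualAction_mem.2 fun x hx φ =>
    LinearPMap.mem_domain_of_mem_graph (hg φ _ (g.mem_graph ⟨x, hx⟩))

theorem isColinearPMap_iff_isColinear {K : Submodule k Y} (hK : IsSubcomodule C K)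
    {f : K →ₗ[k] I} :
    let _ := subcomodule hK
    IsColinearPMap C ⟨K, f⟩ ↔ IsColinear k C f := by
  intro _
  rw [isColinear_iff_dualAction]
  refine forall_congr' fun φ => ⟨fun h x => ?_, fun h p hp => ?_⟩
  · obtain ⟨y, hy, hfy⟩ := (LinearPMap.mem_graph_iff _).1
      (h _ (LinearPMap.mem_graph (⟨K, f⟩ : Y →ₗ.[k] I) x))
    rw [← coe_dualAction_subcomodule hK, Subtype.coe_inj] at hy
    exact hy ▸ hfy
  · obtain ⟨x, hx, hfx⟩ := (LinearPMap.mem_graph_iff _).1 hp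
    rw [← hx, ← hfx, ← coe_dualAction_subcomodule hK]
    exact (h x) ▸ LinearPMap.mem_graph (⟨K, f⟩ : Y →ₗ.[k] I) (dualAction K φ x)

theorem IsColinearPMap.sup {g h : Y →ₗ.[k] I} (hg : IsColinearPMap C g) (hh : IsColinearPMap C h)
    (compatible : ∀ (x : g.domain) (y : h.domain), (x : Y) = y → g x = h y) :
    IsColinearPMap C (g.sup h compatible) := by
  rintro φ ⟨_, _⟩ hp
  obtain ⟨⟨_, hx⟩, rfl, rfl⟩ := (LinearPMap.mem_graph_iff _).1 hp
  obtain ⟨a, ha, b, hb, rfl⟩ := Submodule.mem_sup.1 hx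
  have apply_add : g.sup h compatible ⟨a + b, hx⟩ = g ⟨a, ha⟩ + h ⟨b, hb⟩ :=
    LinearPMap.sup_apply compatible ⟨a, ha⟩ ⟨b, hb⟩ ⟨_, hx⟩ rfl
  rw [apply_add, map_add, map_add]
  exact Submodule.add_mem _
    (LinearPMap.le_graph_of_le (LinearPMap.left_le_sup _ _ _) (hg φ _ (g.mem_graph ⟨a, ha⟩)))
    (LinearPMap.le_graph_of_le (LinearPMap.right_le_sup _ _ _) (hh φ _ (h.mem_graph ⟨b, hb⟩)))

theorem IsColinearPMap.sSup {c : Set (Y →ₗ.[k] I)} (hc : DirectedOn (· ≤ ·) c)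
    (nonempty : c.Nonempty) (h : ∀ g ∈ c, IsColinearPMap C g) :
    IsColinearPMap C (LinearPMap.sSup c hc) := by
  rintro φ ⟨_, _⟩ hp
  obtain ⟨⟨y, hy⟩, rfl, rfl⟩ := (LinearPMap.mem_graph_iff _).1 hp
  obtain ⟨g, hg, hyg⟩ := (LinearPMap.mem_domain_sSup_iff nonempty hc).1 hy
  have le := LinearPMap.le_sSup hc hg
  rw [← le.2 (x := ⟨y, hyg⟩) rfl]
  exact LinearPMap.le_graph_of_le le (h g hg φ _ (g.mem_graph ⟨y, hyg⟩))

theorem IsColinearPMap.exists_extension (hI : IsFinInjectiveComodule.{t} k C I)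
    {g : Y →ₗ.[k] I} (hg : IsColinearPMap C g) (y : Y) :
    ∃ g' : Y →ₗ.[k] I, IsColinearPMap C g' ∧ g ≤ g' ∧ y ∈ g'.domain := by
  let E := cyclicSubcomodule k C y
  have hE : IsSubcomodule C E := isSubcomodule_cyclicSubcomodule y
  have hF : IsSubcomodule C (E ⊓ g.domain) := isSubcomodule_iff_dualAction_mem.2 fun x hx φ =>
    ⟨isSubcomodule_iff_dualAction_mem.1 hE x hx.1 φ,
      isSubcomodule_iff_dualAction_mem.1 hg.isSubcomodule_domain x hx.2 φ⟩
  let _ := subcomodule hE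
  let _ := subcomodule hF
  let _ := subcomodule hg.isSubcomodule_domain
  let i : ↥(E ⊓ g.domain) →ₗ[k] E := Submodule.inclusion inf_le_left
  let j : ↥(E ⊓ g.domain) →ₗ[k] g.domain := Submodule.inclusion inf_le_right
  have : Module.Finite k ↥(E ⊓ g.domain) :=
    Module.Finite.of_injective i (Submodule.inclusion_injective _)
  have hi : IsColinear k C i := isColinear_iff_dualAction.2 fun φ x => Subtype.ext <|
    (coe_dualAction_subcomodule hF φ x).trans (coe_dualAction_subcomodule hE φ (i x)).symm
  have hj : IsColinear k C j := isColinear_iff_dualAction.2 fun φ x => Subtype.ext <|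
    (coe_dualAction_subcomodule hF φ x).trans (coe_dualAction_subcomodule _ φ (j x)).symm
  have hgj : IsColinear k C (g.toFun ∘ₗ j) := isColinear_iff_dualAction.2 fun φ x => by
    have hg' := (isColinearPMap_iff_isColinear hg.isSubcomodule_domain).1 hg
    rw [LinearMap.comp_apply, isColinear_iff_dualAction.1 hj, isColinear_iff_dualAction.1 hg',
      LinearMap.comp_apply]
  obtain ⟨f, hf, hfi⟩ := hI _ _ i _ hi (Submodule.inclusion_injective _) hgj
  have compatible (a : g.domain) (b : E) (hab : (a : Y) = b) : g a = f b := by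
    obtain ⟨a, ha⟩ := a
    obtain ⟨b, hb⟩ := b
    subst hab
    exact congr($hfi.symm ⟨a, hb, ha⟩)
  let f' : Y →ₗ.[k] I := ⟨E, f⟩
  exact ⟨g.sup f' compatible, hg.sup ((isColinearPMap_iff_isColinear hE).2 hf) compatible,
    LinearPMap.left_le_sup _ _ _,
    (LinearPMap.right_le_sup g f' compatible).1 (self_mem_cyclicSubcomodule y)⟩

theorem IsFinInjectiveComodule.exists_extension (hI : IsFinInjectiveComodule.{t} k C I)
    {g : Y →ₗ.[k] I} (hg : IsColinearPMap C g) :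
    ∃ f : Y →ₗ[k] I, IsColinear k C f ∧ ∀ y : g.domain, f y = g y := by
  obtain ⟨m, hgm, hm⟩ := zorn_le_nonempty₀ {g : Y →ₗ.[k] I | IsColinearPMap C g}
    (fun c hc chain g₁ hg₁ => ⟨LinearPMap.sSup c chain.directedOn,
      IsColinearPMap.sSup chain.directedOn ⟨g₁, hg₁⟩ hc, fun _ => LinearPMap.le_sSup _⟩) g hg
  have mem_domain (y : Y) : y ∈ m.domain := by
    obtain ⟨g', hg', hmg', hy⟩ := hm.1.exists_extension hI y
    exact (hm.2 hg' hmg').1 hy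
  let e : Y →ₗ[k] m.domain := LinearMap.id.codRestrict _ mem_domain
  refine ⟨m.toFun ∘ₗ e, isColinear_iff_dualAction.2 fun φ y => ?_, fun y => ?_⟩
  · exact LinearPMap.mem_graph_snd_inj m (m.mem_graph (e (dualAction Y φ y)))
      (hm.1 φ _ (m.mem_graph (e y))) rfl
  · exact (hgm.2 (x := y) (y := e y) rfl).symm

theorem IsFinInjectiveComodule.isInjectiveComodule (hI : IsFinInjectiveComodule.{t} k C I) :
    IsInjectiveComodule.{t} k C I := by
  intro X Y _ _ _ _ _ _ i f hi injective hf
  let e := LinearEquiv.ofInjective i injective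
  let g : Y →ₗ.[k] I := ⟨LinearMap.range i, f ∘ₗ e.symm⟩
  have g_apply (x : X) : g ⟨i x, x, rfl⟩ = f x := congr(f $(e.symm_apply_apply x))
  have hg : IsColinearPMap C g := by
    rintro φ ⟨_, _⟩ hp
    obtain ⟨⟨_, x, rfl⟩, rfl, rfl⟩ := (LinearPMap.mem_graph_iff _).1 hp
    rw [g_apply, ← isColinear_iff_dualAction.1 hi, ← isColinear_iff_dualAction.1 hf, ← g_apply]
    exact g.mem_graph ⟨i _, _, rfl⟩
  obtain ⟨f', hf', eq_g⟩ := hI.exists_extension hg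
  exact ⟨f', hf', LinearMap.ext fun x => (eq_g ⟨i x, x, rfl⟩).trans (g_apply x)⟩

end FinInjective

theorem sum_coord_smulRight {ι k E Y : Type*} [Fintype ι] [CommRing k] [AddCommGroup E]
    [Module k E] [AddCommGroup Y] [Module k Y] (b : Module.Basis ι k E) (f : E →ₗ[k] Y) :
    ∑ i, (b.coord i).smulRight (f (b i)) = f :=
  b.ext fun j => by
    classical
    simp [Finsupp.single_apply]

/-! ### Faithfully flat descent -/

namespace BalancedTensor

section RightFactor

variable (k R P X : Type*) [CommRing k] [Ring R] [Algebra k R] [AddCommGroup P] [Module k P]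
  [Module Rᵐᵒᵖ P] [AddCommGroup X] [Module k X] [Module R X] [IsScalarTower k R X]

/-- The canonical map `P ⊗_R (X ⊗ C) → (P ⊗_R X) ⊗ C`. -/
noncomputable def assocRight (C : Type*) [AddCommGroup C] [Module k C] :
    BalancedTensor k R P (X ⊗[k] C) →ₗ[k] BalancedTensor k R P X ⊗[k] C :=
  lift ((mk k R P X).rTensor C ∘ₗ (TensorProduct.assoc k P X C).symm.toLinearMap) <| by
    intro p r z
    induction z with
    | zero => simp
    | add x y hx hy => simp only [smul_add, TensorProduct.tmul_add, map_add, hx, hy]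
    | tmul x c => simp [TensorProduct.smul_tmul', mk_smul_tmul]

/-- The canonical map `P ⊗_R Hom(E, X) → Hom(E, P ⊗_R X)`. -/
noncomputable def evalHom (E : Type*) [AddCommGroup E] [Module k E] :
    BalancedTensor k R P (E →ₗ[k] X) →ₗ[k] E →ₗ[k] BalancedTensor k R P X :=
  lift (TensorProduct.lift (LinearMap.llcomp k E X (BalancedTensor k R P X) ∘ₗ
      tmulLeft k R X)) <| by
    intro p r f
    ext e
    simp [mk_smul_tmul]

variable {k R P X} {C E : Type*} [AddCommGroup C] [Module k C] [AddCommGroup E] [Module k E]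

theorem assocRight_mk_tmul (p : P) (z : X ⊗[k] C) :
    assocRight k R P X C (mk k R P _ (p ⊗ₜ z)) = (tmulLeft k R X p).rTensor C z := by
  induction z <;> simp_all [TensorProduct.tmul_add, assocRight]

theorem assocRight_injective : Function.Injective (assocRight k R P X C) := by
  let inv : BalancedTensor k R P X ⊗[k] C →ₗ[k] BalancedTensor k R P (X ⊗[k] C) :=
    TensorProduct.lift <| lift (TensorProduct.curry (mk k R P (X ⊗[k] C) ∘ₗ
      (TensorProduct.assoc k P X C).toLinearMap)) <| by
        intro p r x
        ext c
        simp [mk_smul_tmul, TensorProduct.smul_tmul']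
  have leftInverse : inv ∘ₗ assocRight k R P X C = LinearMap.id := by
    refine hom_ext fun p z => ?_
    rw [LinearMap.comp_apply, assocRight_mk_tmul]
    induction z <;> simp_all [TensorProduct.tmul_add, inv]
  exact Function.LeftInverse.injective fun x => congr($leftInverse x)

theorem evalHom_mk_tmul (p : P) (f : E →ₗ[k] X) :
    evalHom k R P X E (mk k R P _ (p ⊗ₜ f)) = tmulLeft k R X p ∘ₗ f :=
  LinearMap.ext fun _ => rfl

variable [IsScalarTower k Rᵐᵒᵖ P]

variable (R X) in
/-- The map `x ↦ (e ↦ φ(e) x)`. -/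
def smulRightHom (φ : Module.Dual k E) : X →ₗ[R] E →ₗ[k] X where
  toFun x := φ.smulRight x
  map_add' x y := by ext; simp
  map_smul' r x := by ext e; exact smul_comm _ _ _

theorem evalHom_map_smulRightHom (φ : Module.Dual k E) (x : BalancedTensor k R P X) :
    evalHom k R P X E (map (k := k) (LinearMap.id : P →ₗ[Rᵐᵒᵖ] P) (smulRightHom R X φ) x) =
      φ.smulRight x := by
  induction x using induction_on with
  | zero => ext; simp
  | add x y hx hy => rw [map_add, map_add, hx, hy]; ext; simp
  | tmul p x =>
    ext e
    simp [evalHom_mk_tmul, smulRightHom]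

theorem bijective_evalHom [Module.Free k E] [Module.Finite k E] :
    Function.Bijective (evalHom k R P X E) := by
  let b := Module.Free.chooseBasis k E
  let inv : (E →ₗ[k] BalancedTensor k R P X) →ₗ[k] BalancedTensor k R P (E →ₗ[k] X) :=
    ∑ i, map (k := k) LinearMap.id (smulRightHom R X (b.coord i)) ∘ₗ LinearMap.applyₗ (b i)
  have leftInverse : inv ∘ₗ evalHom k R P X E = LinearMap.id := by
    refine hom_ext fun p f => ?_
    simp only [inv, LinearMap.comp_apply, LinearMap.sum_apply, evalHom_mk_tmul,
      LinearMap.applyₗ_apply_apply, tmulLeft_apply, map_mk_tmul, LinearMap.id_apply]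
    rw [← map_sum, ← TensorProduct.tmul_sum]
    exact congr(mk k R P _ (p ⊗ₜ $(sum_coord_smulRight b f)))
  have rightInverse (u : E →ₗ[k] BalancedTensor k R P X) : evalHom k R P X E (inv u) = u := by
    simp only [inv, LinearMap.sum_apply, map_sum, LinearMap.comp_apply,
      evalHom_map_smulRightHom, LinearMap.applyₗ_apply_apply]
    exact sum_coord_smulRight b u
  exact ⟨Function.LeftInverse.injective fun x => congr($leftInverse x),
    Function.RightInverse.surjective rightInverse⟩

end RightFactor

end BalancedTensor

section FaithfullyFlat

variable {k R P : Type*} [CommRing k] [Ring R] [Algebra k R] [AddCommGroup P] [Module k P]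
  [Module Rᵐᵒᵖ P] [IsScalarTower k Rᵐᵒᵖ P] {M N : Type t} [AddCommGroup M] [Module k M]
  [Module R M] [IsScalarTower k R M] [AddCommGroup N] [Module k N] [Module R N]
  [IsScalarTower k R N]

theorem BalancedTensor.map_zero_right {P' : Type*} [AddCommGroup P'] [Module k P'] [Module Rᵐᵒᵖ P']
    [IsScalarTower k Rᵐᵒᵖ P'] (f : P →ₗ[Rᵐᵒᵖ] P') (x : BalancedTensor k R P M) :
    BalancedTensor.map (k := k) f (0 : M →ₗ[R] N) x = 0 := by
  induction x using BalancedTensor.induction_on <;> simp_all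

theorem IsRightFaithfullyFlat.injective_map (hP : IsRightFaithfullyFlat.{t} k R P)
    {f : M →ₗ[R] N} (hf : Function.Injective f) :
    Function.Injective (BalancedTensor.map (k := k) (LinearMap.id : P →ₗ[Rᵐᵒᵖ] P) f) := by
  have exact_zero : Function.Exact (0 : PUnit.{t + 1} →ₗ[R] M) f := fun x => by
    simp [map_eq_zero_iff f hf, eq_comm]
  refine (injective_iff_map_eq_zero _).2 fun x hx => ?_
  obtain ⟨w, rfl⟩ := ((hP _ _ _ _ _).1 exact_zero x).1 hx
  exact BalancedTensor.map_zero_right _ _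

theorem IsRightFaithfullyFlat.surjective_of_map (hP : IsRightFaithfullyFlat.{t} k R P)
    {f : M →ₗ[R] N}
    (hf : Function.Surjective (BalancedTensor.map (k := k) (LinearMap.id : P →ₗ[Rᵐᵒᵖ] P) f)) :
    Function.Surjective f := by
  have exact_zero : Function.Exact f (0 : N →ₗ[R] PUnit.{t + 1}) :=
    (hP _ _ _ _ _).2 fun x => by simp [BalancedTensor.map_zero_right, hf x]
  exact fun x => (exact_zero x).1 rfl

end FaithfullyFlat

section LinearCoaction

variable {k C R X E E' : Type*} [CommRing k] [AddCommGroup C] [Module k C] [Coalgebra k C]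
  [Ring R] [Algebra k R] [AddCommGroup X] [Module k X] [Module R X] [IsScalarTower k R X]
  [RightComodule k C X] [AddCommGroup E] [Module k E] [RightComodule k C E]
  [AddCommGroup E'] [Module k E'] [RightComodule k C E']

/-- The ring `R` acts on the comodule `X` by comodule maps. -/
def IsLinearCoaction (k C R X : Type*) [CommRing k] [AddCommGroup C] [Module k C] [Coalgebra k C]
    [Ring R] [Algebra k R] [AddCommGroup X] [Module k X] [Module R X] [IsScalarTower k R X]
    [RightComodule k C X] : Prop :=
  ∀ (r : R) (x : X), coaction k C X (r • x) = r • coaction k C X x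

variable (hX : IsLinearCoaction k C R X)

/-- The coaction of `X`, as an `R`-linear map. -/
noncomputable def coactionLinear : X →ₗ[R] X ⊗[k] C where
  toFun := coaction k C X
  map_add' := map_add _
  map_smul' := hX

variable (E) in
/-- The map `f ↦ δ ∘ f - (f ⊗ C) ∘ δ`, whose kernel consists of the comodule maps `E → X`. -/
noncomputable def colinearDefect : (E →ₗ[k] X) →ₗ[R] E →ₗ[k] X ⊗[k] C where
  toFun f := coaction k C X ∘ₗ f - f.rTensor C ∘ₗ coaction k C E
  map_add' f g := by
    rw [LinearMap.comp_add, LinearMap.rTensor_add, LinearMap.add_comp, add_sub_add_comm]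
  map_smul' r f := by
    have rTensor_smul (z : E ⊗[k] C) : (r • f).rTensor C z = r • f.rTensor C z := by
      induction z <;> simp_all [TensorProduct.smul_tmul']
    ext e
    simp [hX r, rTensor_smul, smul_sub]

theorem colinearDefect_apply (f : E →ₗ[k] X) :
    colinearDefect E hX f = coaction k C X ∘ₗ f - f.rTensor C ∘ₗ coaction k C E := rfl

theorem mem_ker_colinearDefect {f : E →ₗ[k] X} :
    f ∈ LinearMap.ker (colinearDefect E hX) ↔ IsColinear k C f :=
  sub_eq_zero.trans eq_comm

/-- Restriction of comodule maps `E → X` along a comodule map `E' → E`. -/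
noncomputable def colinearRestrict {i : E' →ₗ[k] E} (hi : IsColinear k C i) :
    LinearMap.ker (colinearDefect E hX) →ₗ[R] LinearMap.ker (colinearDefect E' hX) where
  toFun f := ⟨f.1 ∘ₗ i, (mem_ker_colinearDefect hX).2 <| by
    rw [IsColinear, LinearMap.rTensor_comp, LinearMap.comp_assoc, hi, ← LinearMap.comp_assoc,
      (mem_ker_colinearDefect hX).1 f.2, LinearMap.comp_assoc]⟩
  map_add' _ _ := rfl
  map_smul' _ _ := rfl

variable (P : Type*) [AddCommGroup P] [Module k P] [Module Rᵐᵒᵖ P] [IsScalarTower k Rᵐᵒᵖ P]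

/-- The coaction of `P ⊗_R X` induced by that of `X`. -/
noncomputable def tensorCoact :
    BalancedTensor k R P X →ₗ[k] BalancedTensor k R P X ⊗[k] C :=
  BalancedTensor.assocRight k R P X C ∘ₗ
    BalancedTensor.map (k := k) LinearMap.id (coactionLinear hX)

variable {P}

theorem tensorCoact_mk_tmul (p : P) (x : X) :
    tensorCoact hX P (BalancedTensor.mk k R P X (p ⊗ₜ x)) =
      (BalancedTensor.tmulLeft k R X p).rTensor C (coaction k C X x) := by
  rw [tensorCoact, LinearMap.comp_apply, BalancedTensor.map_mk_tmul]
  exact BalancedTensor.assocRight_mk_tmul _ _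

theorem rTensor_tensorCoact_eq_cofreeCoact {Q : Type*} [AddCommGroup Q] [Module k Q]
    {β : BalancedTensor k R P X →ₗ[k] Q ⊗[k] C} {f : P → X →ₗ[k] Q}
    (hβ : ∀ p x, β (BalancedTensor.mk k R P X (p ⊗ₜ x)) = (f p).rTensor C (coaction k C X x))
    (x : BalancedTensor k R P X) :
    β.rTensor C (tensorCoact hX P x) = cofreeCoact k C Q (β x) := by
  induction x using BalancedTensor.induction_on with
  | zero => simp
  | add x y hx hy => simp only [map_add, hx, hy]
  | tmul p x =>
    have comp_tmulLeft : β ∘ₗ BalancedTensor.tmulLeft k R X p =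
        (f p).rTensor C ∘ₗ coaction k C X := LinearMap.ext fun x => hβ p x
    rw [tensorCoact_mk_tmul, ← LinearMap.rTensor_comp_apply, comp_tmulLeft,
      LinearMap.rTensor_comp_apply, hβ, cofreeCoact_rTensor, cofreeCoact_coaction]

theorem assocRight_evalHom_colinearDefect (z : BalancedTensor k R P (E →ₗ[k] X)) (e : E) :
    BalancedTensor.assocRight k R P X C (BalancedTensor.evalHom k R P (X ⊗[k] C) E
      (BalancedTensor.map (k := k) LinearMap.id (colinearDefect E hX) z) e) =
    tensorCoact hX P (BalancedTensor.evalHom k R P X E z e) -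
      (BalancedTensor.evalHom k R P X E z).rTensor C (coaction k C E e) := by
  induction z using BalancedTensor.induction_on with
  | zero => simp
  | add x y hx hy =>
    simp only [map_add, LinearMap.add_apply, LinearMap.rTensor_add, hx, hy]
    abel
  | tmul p f =>
    simp only [BalancedTensor.map_mk_tmul, BalancedTensor.evalHom_mk_tmul, LinearMap.comp_apply,
      BalancedTensor.tmulLeft_apply, LinearMap.id_apply, BalancedTensor.assocRight_mk_tmul,
      tensorCoact_mk_tmul, colinearDefect_apply, LinearMap.sub_apply, map_sub,
      LinearMap.rTensor_comp_apply]

theorem map_colinearDefect_eq_zero_iff [Module.Free k E] [Module.Finite k E]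
    {z : BalancedTensor k R P (E →ₗ[k] X)} :
    BalancedTensor.map (k := k) (LinearMap.id : P →ₗ[Rᵐᵒᵖ] P) (colinearDefect E hX) z = 0 ↔
      ∀ e, tensorCoact hX P (BalancedTensor.evalHom k R P X E z e) =
        (BalancedTensor.evalHom k R P X E z).rTensor C (coaction k C E e) := by
  rw [← map_eq_zero_iff _ BalancedTensor.bijective_evalHom.1, LinearMap.ext_iff]
  refine forall_congr' fun e => ?_
  rw [LinearMap.zero_apply, ← map_eq_zero_iff _ BalancedTensor.assocRight_injective,
    assocRight_evalHom_colinearDefect, sub_eq_zero]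

theorem evalHom_map_colinearRestrict {i : E' →ₗ[k] E} (hi : IsColinear k C i)
    (y : BalancedTensor k R P (LinearMap.ker (colinearDefect E hX))) :
    BalancedTensor.evalHom k R P X E' (BalancedTensor.map (k := k) LinearMap.id
      (LinearMap.ker (colinearDefect E' hX)).subtype
        (BalancedTensor.map (k := k) LinearMap.id (colinearRestrict hX hi) y)) =
    BalancedTensor.evalHom k R P X E (BalancedTensor.map (k := k) LinearMap.id
      (LinearMap.ker (colinearDefect E hX)).subtype y) ∘ₗ i := by
  induction y using BalancedTensor.induction_on with
  | zero => simp
  | add x y hx hy => simp only [map_add, hx, hy, LinearMap.add_comp]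
  | tmul p f => simp [BalancedTensor.evalHom_mk_tmul, colinearRestrict, LinearMap.comp_assoc]

end LinearCoaction

section Descent

theorem exists_cofree_extension {k C Q E' E : Type*} [Field k] [AddCommGroup C] [Module k C]
    [Coalgebra k C] [AddCommGroup Q] [Module k Q] [AddCommGroup E'] [Module k E']
    [RightComodule k C E'] [AddCommGroup E] [Module k E] [RightComodule k C E]
    {i : E' →ₗ[k] E} (hi : IsColinear k C i) (injective : Function.Injective i)
    {f : E' →ₗ[k] Q ⊗[k] C}
    (hf : ∀ e, f.rTensor C (coaction k C E' e) = cofreeCoact k C Q (f e)) :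
    ∃ g : E →ₗ[k] Q ⊗[k] C,
      (∀ e, g.rTensor C (coaction k C E e) = cofreeCoact k C Q (g e)) ∧ g ∘ₗ i = f := by
  obtain ⟨r, hr⟩ := i.exists_leftInverse_of_injective (LinearMap.ker_eq_bot.2 injective)
  let f₀ : E' →ₗ[k] Q := slice Q counit ∘ₗ f
  have rTensor_f₀ (e : E') : f₀.rTensor C (coaction k C E' e) = f e := by
    rw [LinearMap.rTensor_comp_apply, hf, rTensor_slice_counit_cofreeCoact]
  refine ⟨(f₀ ∘ₗ r).rTensor C ∘ₗ coaction k C E, fun e => ?_, LinearMap.ext fun e => ?_⟩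
  · rw [LinearMap.rTensor_comp_apply, ← cofreeCoact_coaction, ← cofreeCoact_rTensor,
      LinearMap.comp_apply]
  · rw [LinearMap.comp_apply, LinearMap.comp_apply, hi.coaction_apply,
      ← LinearMap.rTensor_comp_apply, LinearMap.comp_assoc, hr, LinearMap.comp_id, rTensor_f₀]

variable {k R P Q : Type*} {C X E E' : Type t} [Field k] [AddCommGroup C] [Module k C]
  [Coalgebra k C] [Ring R] [Algebra k R] [AddCommGroup X] [Module k X] [Module R X]
  [IsScalarTower k R X] [RightComodule k C X] [AddCommGroup P] [Module k P] [Module Rᵐᵒᵖ P]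
  [IsScalarTower k Rᵐᵒᵖ P] [AddCommGroup Q] [Module k Q]
  (hX : IsLinearCoaction k C R X) (hP : IsRightFaithfullyFlat.{t} k R P)
  {β : BalancedTensor k R P X ≃ₗ[k] Q ⊗[k] C}
  (hβ : ∀ x, β.toLinearMap.rTensor C (tensorCoact hX P x) = cofreeCoact k C Q (β x))

include hP hβ

/- By flatness, `P ⊗_R Hom^C(E, X)` is the space of comodule maps `E → P ⊗_R X`, so the claim says
that comodule maps to the cofree comodule `P ⊗_R X` extend. -/
theorem surjective_map_colinearRestrict [AddCommGroup E] [Module k E] [RightComodule k C E]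
    [Module.Finite k E] [AddCommGroup E'] [Module k E'] [RightComodule k C E'] [Module.Finite k E']
    {i : E' →ₗ[k] E} (hi : IsColinear k C i) (injective : Function.Injective i) :
    Function.Surjective (BalancedTensor.map (k := k) (LinearMap.id : P →ₗ[Rᵐᵒᵖ] P)
      (colinearRestrict hX hi)) := by
  intro z'
  have exact_subtype := (hP _ _ _ _ _).1 (LinearMap.exact_subtype_ker_map (colinearDefect E hX))
  have exact_subtype' := (hP _ _ _ _ _).1 (LinearMap.exact_subtype_ker_map (colinearDefect E' hX))
  let u' := BalancedTensor.evalHom k R P X E' (BalancedTensor.map (k := k) LinearMap.id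
    (LinearMap.ker (colinearDefect E' hX)).subtype z')
  have hu' (e : E') : tensorCoact hX P (u' e) = u'.rTensor C (coaction k C E' e) :=
    (map_colinearDefect_eq_zero_iff hX).1 (exact_subtype'.apply_apply_eq_zero z') e
  obtain ⟨w, hw, w_comp⟩ := exists_cofree_extension hi injective (f := β.toLinearMap ∘ₗ u')
    fun e => by
      rw [LinearMap.rTensor_comp_apply, ← hu', hβ]
      rfl
  obtain ⟨z, hz⟩ := BalancedTensor.bijective_evalHom.2 (β.symm.toLinearMap ∘ₗ w)
  have hDz : BalancedTensor.map (k := k) LinearMap.id (colinearDefect E hX) z = 0 := by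
    have comp_symm_comp : β.toLinearMap ∘ₗ β.symm.toLinearMap ∘ₗ w = w :=
      LinearMap.ext fun e => β.apply_symm_apply _
    refine (map_colinearDefect_eq_zero_iff hX).2 fun e => (LinearEquiv.rTensor C β).injective ?_
    change β.toLinearMap.rTensor C _ = β.toLinearMap.rTensor C _
    rw [hβ, hz, ← LinearMap.rTensor_comp_apply, comp_symm_comp, hw]
    exact congr(cofreeCoact k C Q $(β.apply_symm_apply _))
  obtain ⟨y, hy⟩ := (exact_subtype z).1 hDz
  refine ⟨y, hP.injective_map (Submodule.subtype_injective _)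
    (BalancedTensor.bijective_evalHom.1 ?_)⟩
  rw [evalHom_map_colinearRestrict, hy, hz, LinearMap.comp_assoc, w_comp]
  ext e
  exact β.symm_apply_apply _

theorem isFinInjectiveComodule_of_faithfullyFlat : IsFinInjectiveComodule.{t} k C X := by
  intro E' E _ _ _ _ _ _ _ _ i f hi injective hf
  obtain ⟨g, hg⟩ := hP.surjective_of_map (surjective_map_colinearRestrict hX hP hβ hi injective)
    ⟨f, (mem_ker_colinearDefect hX).2 hf⟩
  exact ⟨g.1, (mem_ker_colinearDefect hX).1 g.2, congr(Subtype.val $hg)⟩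

end Descent

section Opposite

variable {k R M : Type*} [CommRing k] [Ring R] [AddCommGroup M] [Module k M] [Module R M]
  [Module Rᵐᵒᵖᵐᵒᵖ M] (hM : ∀ (r : R) (m : M), op (op r) • m = r • m)

/-- The isomorphism `M ⊗_{Rᵒᵖ} N ≃ N ⊗_R M`. -/
noncomputable def BalancedTensor.swap (N : Type*) [AddCommGroup N] [Module k N]
    [Module Rᵐᵒᵖ N] : BalancedTensor k Rᵐᵒᵖ M N ≃ₗ[k] BalancedTensor k R N M :=
  LinearEquiv.ofLinearMap
    (lift (mk k R N M ∘ₗ (TensorProduct.comm k M N).toLinearMap) fun m r n => by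
      induction r using MulOpposite.rec' with
      | h r => simp [hM, mk_smul_tmul])
    (lift (mk k Rᵐᵒᵖ M N ∘ₗ (TensorProduct.comm k N M).toLinearMap) fun n r m => by
      simp [← hM, mk_smul_tmul])
    (hom_ext fun _ _ => rfl) (hom_ext fun _ _ => rfl)

theorem BalancedTensor.swap_mk_tmul {N : Type*} [AddCommGroup N] [Module k N]
    [Module Rᵐᵒᵖ N] (m : M) (n : N) :
    swap hM N (mk k Rᵐᵒᵖ M N (m ⊗ₜ n)) = mk k R N M (n ⊗ₜ m) := rfl

theorem IsLeftFaithfullyFlat.opposite [Algebra k R] [IsScalarTower k R M]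
    [IsScalarTower k Rᵐᵒᵖᵐᵒᵖ M] (hM : ∀ (r : R) (m : M), op (op r) • m = r • m)
    (h : IsLeftFaithfullyFlat.{t} k R M) : IsRightFaithfullyFlat.{t} k Rᵐᵒᵖ M := by
  intro N₁ N₂ N₃ _ _ _ _ _ _ _ _ _ _ _ _ f g
  rw [h N₁ N₂ N₃ f g]
  refine Function.Exact.iff_of_ladder_linearEquiv (e₁ := BalancedTensor.swap hM N₁)
    (e₂ := BalancedTensor.swap hM N₂) (e₃ := BalancedTensor.swap hM N₃) ?_ ?_ <;>
  exact BalancedTensor.hom_ext fun m n => by simp [BalancedTensor.swap_mk_tmul]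

/-- A left `R`-module, as a right module over the opposite ring. -/
@[reducible]
def opOpModule (R M : Type*) [Ring R] [AddCommGroup M] [Module R M] : Module Rᵐᵒᵖᵐᵒᵖ M :=
  Module.compHom M (RingEquiv.opOp R).symm.toRingHom

end Opposite

section CoinvariantsAction

variable {k H A : Type*} [CommRing k] [Ring H] [Bialgebra k H] [Ring A] [Algebra k A]
  [RightComoduleAlgebra k H A]

theorem isLinearCoaction_coinvariants : IsLinearCoaction k H (coinvariants k H A) A := by
  intro b a
  refine (coaction_coe_mul k H A b a).trans ?_
  generalize coaction k H A a = z
  induction z with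
  | zero => exact (mul_zero _).trans (smul_zero _).symm
  | add x y hx hy => rw [mul_add, hx, hy]; exact (smul_add _ _ _).symm
  | tmul x h => rw [Algebra.TensorProduct.tmul_mul_tmul, one_mul, TensorProduct.smul_tmul']; rfl

theorem isLinearCoaction_op_coinvariants : IsLinearCoaction k H (coinvariants k H A)ᵐᵒᵖ A := by
  intro b a
  refine (coaction_mul_coe a b.unop).trans ?_
  induction coaction k H A a <;> simp_all [TensorProduct.smul_tmul', add_mul, ← op_smul_def]

theorem preGaloisMap_tmul_eq_rTensor (x y : A) :
    preGaloisMap k H A (x ⊗ₜ y) = (LinearMap.mulLeft k x).rTensor H (coaction k H A y) := by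
  rw [preGaloisMap_tmul]
  induction coaction k H A y <;> simp_all [mul_add]

end CoinvariantsAction

section GaloisFlip

variable {k H A : Type*} [CommRing k] [Ring H] [HopfAlgebra k H] [Ring A] [Algebra k A]
  [RightComoduleAlgebra k H A] (hS : Function.Bijective (antipode k : H →ₗ[k] H))

variable (k H A) in
/-- The map `a ⊗ h ↦ a₍₀₎ ⊗ a₍₁₎ S(h)`, which interchanges the Galois map `x ⊗ y ↦ (x ⊗ 1) δ(y)`
with its variant `x ⊗ y ↦ δ(x) (y ⊗ 1)`. -/
noncomputable def galoisFlip : A ⊗[k] H →ₗ[k] A ⊗[k] H :=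
  TensorProduct.lift ((LinearMap.mul k (A ⊗[k] H)).compl₁₂ (coaction k H A)
    (Algebra.TensorProduct.includeRight.toLinearMap ∘ₗ antipode k))

variable (A) in
/-- The map `a ⊗ h ↦ a₍₀₎ ⊗ S⁻¹(h) a₍₁₎`, inverse to `galoisFlip`. -/
noncomputable def galoisFlipInv : A ⊗[k] H →ₗ[k] A ⊗[k] H :=
  TensorProduct.lift ((LinearMap.mul k (A ⊗[k] H)).flip.compl₁₂ (coaction k H A)
    (Algebra.TensorProduct.includeRight.toLinearMap ∘ₗ antipodeInv hS))

@[simp]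
theorem galoisFlip_tmul (a : A) (h : H) :
    galoisFlip k H A (a ⊗ₜ h) = coaction k H A a * (1 ⊗ₜ antipode k h) := rfl

@[simp]
theorem galoisFlipInv_tmul (a : A) (h : H) :
    galoisFlipInv A hS (a ⊗ₜ h) = (1 ⊗ₜ antipodeInv hS h) * coaction k H A a := rfl

theorem galoisFlip_coaction (a : A) : galoisFlip k H A (coaction k H A a) = a ⊗ₜ 1 :=
  sweedler_eq_of_coassoc_of_counit
    ((LinearMap.mul k (A ⊗[k] H)).compl₁₂ LinearMap.id
      (Algebra.TensorProduct.includeRight.toLinearMap ∘ₗ antipode k))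
    (f := (TensorProduct.mk k A H).flip 1) (fun _ _ => rfl)
    (fun m c => by
      simp [← TensorProduct.tmul_sum, sum_mul_antipode_eq_smul]) a

theorem galoisFlipInv_coaction (a : A) : galoisFlipInv A hS (coaction k H A a) = a ⊗ₜ 1 :=
  sweedler_eq_of_coassoc_of_counit
    ((LinearMap.mul k (A ⊗[k] H)).flip.compl₁₂ LinearMap.id
      (Algebra.TensorProduct.includeRight.toLinearMap ∘ₗ antipodeInv hS))
    (f := (TensorProduct.mk k A H).flip 1) (fun _ _ => rfl)
    (fun m c => by
      simp [← TensorProduct.tmul_sum, sum_antipodeInv_mul, Algebra.algebraMap_eq_smul_one]) a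

theorem galoisFlip_tmul_one_mul (a : A) (z : A ⊗[k] H) :
    galoisFlip k H A ((a ⊗ₜ 1) * z) = coaction k H A a * galoisFlip k H A z := by
  induction z <;> simp_all [mul_add, coaction_mul, mul_assoc]

theorem galoisFlip_one_tmul_mul (h : H) (z : A ⊗[k] H) :
    galoisFlip k H A ((1 ⊗ₜ h) * z) = galoisFlip k H A z * (1 ⊗ₜ antipode k h) := by
  induction z <;> simp_all [mul_add, add_mul, mul_assoc, antipode_mul_antidistrib]

theorem galoisFlipInv_mul_one_tmul (h : H) (z : A ⊗[k] H) :
    galoisFlipInv A hS (z * (1 ⊗ₜ h)) = (1 ⊗ₜ antipodeInv hS h) * galoisFlipInv A hS z := by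
  induction z <;> simp_all [mul_add, add_mul, ← mul_assoc, antipodeInv_mul]

theorem galoisFlip_preGaloisMap (x y : A) : galoisFlip k H A (preGaloisMap k H A (x ⊗ₜ y)) =
    (LinearMap.mulRight k y).rTensor H (coaction k H A x) := by
  rw [preGaloisMap_tmul, galoisFlip_tmul_one_mul, galoisFlip_coaction]
  induction coaction k H A x <;> simp_all [add_mul]

include hS in
theorem bijective_galoisFlip : Function.Bijective (galoisFlip k H A) := by
  have leftInverse : galoisFlipInv A hS ∘ₗ galoisFlip k H A = LinearMap.id :=
    TensorProduct.ext' fun a h => by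
      simp [galoisFlipInv_mul_one_tmul, galoisFlipInv_coaction]
  have rightInverse : galoisFlip k H A ∘ₗ galoisFlipInv A hS = LinearMap.id :=
    TensorProduct.ext' fun a h => by
      simp [galoisFlip_one_tmul_mul, galoisFlip_coaction]
  exact ⟨Function.LeftInverse.injective fun x => congr($leftInverse x),
    Function.RightInverse.surjective fun x => congr($rightInverse x)⟩

end GaloisFlip

section InjectiveComodule

variable {k : Type*} {H A : Type t} [Field k] [Ring H] [Ring A] [Algebra k A]

theorem isInjectiveComodule_of_right_faithfullyFlat [Bialgebra k H] [RightComoduleAlgebra k H A]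
    (hG : IsHopfGalois k H A) (hA : IsRightFaithfullyFlat.{t} k (coinvariants k H A) A) :
    IsInjectiveComodule.{t} k H A :=
  have hβ (x y : A) := (galoisMap_mk (x ⊗ₜ[k] y)).trans (preGaloisMap_tmul_eq_rTensor x y)
  (isFinInjectiveComodule_of_faithfullyFlat isLinearCoaction_coinvariants hA
    (β := LinearEquiv.ofBijective (galoisMap k H A) hG)
    (rTensor_tensorCoact_eq_cofreeCoact _ hβ)).isInjectiveComodule

theorem isInjectiveComodule_of_left_faithfullyFlat [HopfAlgebra k H] [RightComoduleAlgebra k H A]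
    (hS : Function.Bijective (antipode k : H →ₗ[k] H)) (hG : IsHopfGalois k H A)
    (hA : IsLeftFaithfullyFlat.{t} k (coinvariants k H A) A) : IsInjectiveComodule.{t} k H A := by
  let _ := opOpModule (coinvariants k H A) A
  have op_op_smul (b : coinvariants k H A) (a : A) : op (op b) • a = b • a := rfl
  have _ : IsScalarTower k (coinvariants k H A)ᵐᵒᵖᵐᵒᵖ A :=
    ⟨fun c b a => smul_assoc c b.unop.unop a⟩
  let β := BalancedTensor.swap (k := k) op_op_smul A ≪≫ₗ
    LinearEquiv.ofBijective (galoisMap k H A) hG ≪≫ₗ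
      LinearEquiv.ofBijective (galoisFlip k H A) (bijective_galoisFlip hS)
  have hβ (y x : A) : β (BalancedTensor.mk k _ A A (y ⊗ₜ x)) =
      (LinearMap.mulRight k y).rTensor H (coaction k H A x) := by
    rw [← galoisFlip_preGaloisMap, ← galoisMap_mk]
    rfl
  exact (isFinInjectiveComodule_of_faithfullyFlat isLinearCoaction_op_coinvariants
    (hA.opposite op_op_smul) (β := β)
    (rTensor_tensorCoact_eq_cofreeCoact _ hβ)).isInjectiveComodule

end InjectiveComodule

section TotalIntegral

variable {k H A : Type u} [Field k] [Ring H] [HopfAlgebra k H] [Ring A] [Algebra k A]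
  [RightComoduleAlgebra k H A] (hS : Function.Bijective (antipode k : H →ₗ[k] H))
  {γ : H →ₗ[k] A} (hγ : IsTotalIntegral γ) {ℓ : H →ₗ[k] A ⊗[k] A} (hℓ : IsTranslationMap ℓ)

include hS hγ hℓ

theorem isEquivalence_inductionFunctor : (inductionFunctor k H A).IsEquivalence :=
  isEquivalence_inductionFunctor_of_bijective
    (fun _ _ _ _ _ => bijective_inductionUnit hS hγ hℓ)
    (fun _ _ _ _ _ _ _ => bijective_inductionCounit hS hγ hℓ)

theorem projective_coinvariants : Module.Projective (coinvariants k H A) A :=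
  .of_split (leftSplitting hS hγ ℓ) (smulMap k (coinvariants k H A) A)
    (smulMap_comp_leftSplitting hS hγ hℓ)

theorem projective_op_coinvariants : Module.Projective (coinvariants k H A)ᵐᵒᵖ A :=
  .of_split (rightSplitting hS hγ ℓ) (smulMap k (coinvariants k H A)ᵐᵒᵖ A)
    (smulMap_comp_rightSplitting hS hγ hℓ)

theorem isRightFaithfullyFlat_coinvariants :
    IsRightFaithfullyFlat.{t} k (coinvariants k H A) A :=
  have := projective_op_coinvariants hS hγ hℓ
  isRightFaithfullyFlat_of_projective (rightRetraction_coe hS hγ 1)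

end TotalIntegral

end HopfGalois

theorem mainTheorem5 {k H A : Type u} [Field k] [Ring H] [HopfAlgebra k H]
    (hS : Function.Bijective (HopfAlgebra.antipode k : H →ₗ[k] H))
    [Ring A] [Algebra k A] [RightComoduleAlgebra k H A] :
    List.TFAE
      [Function.Surjective (galoisMap k H A) ∧ IsInjectiveComodule.{u} k H A,
        IsHopfGalois k H A ∧ IsLeftFaithfullyFlat.{u} k (coinvariants k H A) A,
        IsHopfGalois k H A ∧ IsRightFaithfullyFlat.{u} k (coinvariants k H A) A,
        (inductionFunctor k H A).IsEquivalence] ∧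
    (Function.Surjective (galoisMap k H A) ∧ IsInjectiveComodule.{u} k H A →
      Module.Projective (coinvariants k H A) A ∧
      Module.Projective (coinvariants k H A)ᵐᵒᵖ A ∧
      (∃ C : Submodule (coinvariants k H A) A,
        IsCompl (leftSubmodule (coinvariants k H A)) C) ∧
      (∃ C : Submodule (coinvariants k H A)ᵐᵒᵖ A,
        IsCompl (rightSubmodule (coinvariants k H A)) C)) := by
  have exists_integral_and_translation
      (h : Function.Surjective (galoisMap k H A) ∧ IsInjectiveComodule.{u} k H A) :
      ∃ (γ : H →ₗ[k] A) (ℓ : H →ₗ[k] A ⊗[k] A), IsTotalIntegral γ ∧ IsTranslationMap ℓ :=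
    let ⟨γ, hγ⟩ := exists_isTotalIntegral h.2
    let ⟨ℓ, hℓ⟩ := exists_isTranslationMap h.1
    ⟨γ, ℓ, hγ, hℓ⟩
  refine ⟨?_, fun h => ?_⟩
  · tfae_have 1 → 4 := fun h =>
      let ⟨_, _, hγ, hℓ⟩ := exists_integral_and_translation h
      isEquivalence_inductionFunctor hS hγ hℓ
    tfae_have 4 → 2 := fun h =>
      ⟨isHopfGalois_of_isEquivalence h, isLeftFaithfullyFlat_of_isEquivalence h⟩
    tfae_have 2 → 1 := fun h => ⟨h.1.2, isInjectiveComodule_of_left_faithfullyFlat hS h.1 h.2⟩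
    tfae_have 1 → 3 := fun h =>
      let ⟨_, _, hγ, hℓ⟩ := exists_integral_and_translation h
      ⟨isHopfGalois_of_isEquivalence (isEquivalence_inductionFunctor hS hγ hℓ),
        isRightFaithfullyFlat_coinvariants hS hγ hℓ⟩
    tfae_have 3 → 1 := fun h => ⟨h.1.2, isInjectiveComodule_of_right_faithfullyFlat h.1 h.2⟩
    tfae_finish
  · obtain ⟨_, _, hγ, hℓ⟩ := exists_integral_and_translation h
    exact ⟨projective_coinvariants hS hγ hℓ, projective_op_coinvariants hS hγ hℓ,
      exists_isCompl_leftSubmodule (leftRetraction_coe hS hγ),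
      exists_isCompl_rightSubmodule (rightRetraction_coe hS hγ)⟩
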